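/- **Notation.** Let $\mathbb T^3=(\mathbb R/2\pi\mathbb Z)^3$ with normalised Lebesgue measure, $e_n(x)=e^{in\cdot x}$, $\langle n\rangle=(1+|n|^2)^{1/2}$, $[\![n]\!]=(\tfrac34+|n|^2)^{1/2}$ for $n\in\mathbb Z^3$. $W^{s,p}(\mathbb T^3)$ is normed by $\|\langle\nabla\rangle^sf\|_{L^p}$, $H^s=W^{s,2}$, $\mathcal H^s=H^s\times H^{s-1}$, and $V*f=(1-\Delta)^{-\beta/2}f$. Fix a smooth bump function $\phi:\mathbb R\to[0,1]$, supported on $[-\frac85,\frac85]$ and equal to $1$ on $[-\frac54,\frac54]$; let $\phi_0(\xi)=\phi(|\xi|)$, $\phi_j(\xi)=\phi(2^{-j}|\xi|)-\phi(2^{-j+1}|\xi|)$ for $j\ge1$, $\varphi_j=\phi_j/\sum_k\phi_k$, and let $\mathbf P_j$ be the Fourier multiplier with symbol $\varphi_j$. Put $$f\prec g=\sum_{j<k-2}\mathbf P_jf\,\mathbf P_kg,\quad f\circeq g=\sum_{|j-k|\le2}\mathbf P_jf\,\mathbf P_kg,\quad f\succ g=\sum_{k<j-2}\mathbf P_jf\,\mathbf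 P_kg .$$ Let $\mathcal D(t)=e^{-t/2}\,\frac{\sin(t\sqrt{3/4-\Delta})}{\sqrt{3/4-\Delta}}$, $S(t)(f,g)=\partial_t\mathcal D(t)f+\mathcal D(t)(f+g)$ and $\mathcal I F(t)=\int_0^t\mathcal D(t-t')F(t')\,dt'$. For $\theta>0$ and a fixed constant $c_0\in\mathbb R$ let $$\mathfrak I^{(1)}_{\prec}(w)=\mathcal I\Big(\sum_{\theta k+c_0\le j<k-2}\mathbf P_jw\,\mathbf P_k\Psi\Big).$$ For $0<T\le 1$ let $X^s(T)=C([0,T];H^s)\cap C^1([0,T];H^{s-1})$ and $Z^{s_1,s_2,s_3}(T)=X^{s_1}(T)\times X^{s_2}(T)\times L^3([0,T];H^{s_3})$. Let $\mathcal L_2(\frac32,T)$ be the space of bounded linear operators from $L^{3/2}([0,T];L^2)$ to $L^\infty([0,T];H^{s_3})$. Such an operator $\mathfrak J$ is *causal* if, for every $\tau$, $w=0$ a.e. on $[0,\tau]\cap[0,T]$ implies $\mathfrak Jw=0$ a.e. on $[0,\tau]\cap[0,T]$. An *enhanced data set* on $[0,T]$ is a tuple $\Xi=(X_0,X_1,Y_0,Y_1,\Psi,W,Z,\mathfrak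 J)$ in $$\begin{aligned}\mathcal X_T^{s_1,s_2,\varepsilon}={}&\mathcal H^{s_1}\times\mathcal H^{s_2}\times\big(C([0,T];W^{-\frac12-\varepsilon,\infty})\cap C^1([0,T];W^{-\frac32-\varepsilon,\infty})\big)\\&\times C([0,T];W^{-1-\varepsilon,\infty})\times C([0,T];W^{\beta-\frac32-\varepsilon,\infty})\times\mathcal L_2(\tfrac32,T)\end{aligned}$$ with $\mathfrak J$ causal; $W$, $Z$, $\mathfrak J$ are prescribed independently of each other and of $\Psi$, and play the roles of $:\!\Psi^2\!:$, $(V*:\!\Psi^2\!:)\circeq\Psi$ and $\mathfrak I_{\prec,\circeq}$. A data set on $[0,1]$ restricts to one on $[0,T]$ ($\mathfrak J$ is applied to functions extended by $0$ and its output is restricted to $[0,T]$). With $$Q_{X,Y}=(X+Y)^2+2X\prec\Psi+2X\succ\Psi+2Y\Psi,\qquad v=V*(Q_{X,Y}+2\mathfrak R+W),$$ consider on $[0,T]$ the defocusing system $$\begin{aligned}(\partial_t^2+\partial_t+1-\Delta)X&=-\,v\prec\Psi,\\(\partial_t^2+\partial_t+1-\Delta)Y&=-\,v\,(X+Y)-v\succ\Psi-\big(V*(Q_{X,Y}+2\mathfrak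 R)\big)\circeq\Psi-Z,\\\mathfrak R&=-\,\mathfrak I^{(1)}_{\prec}(v)\circeq\Psi-\mathfrak J(v),\\(X,\partial_tX,Y,\partial_tY,\mathfrak R)|_{t=0}&=(X_0,X_1,Y_0,Y_1,0).\end{aligned}$$ The two wave equations are understood in the Duhamel sense, $X=S(t)(X_0,X_1)+\mathcal I(\cdots)$ and $Y=S(t)(Y_0,Y_1)+\mathcal I(\cdots)$; the $\mathfrak R$-equation holds for a.e. $t$, and $\mathfrak R|_{t=0}=0$ means that $\|\mathfrak R(t)\|_{H^{s_3}}\to0$ as $t\to0+$ off a null set. **Theorem.** Let $-\frac12<s_3<0$. There exists $\theta_0=\theta_0(s_3)>0$ such that for every $0<\theta\le\theta_0$ the following holds. Let $\beta>1$, $\frac14<s_1<\frac12<s_2<1$ and $\beta>-3s_1+s_2+2$. There exists $\varepsilon=\varepsilon(s_1,s_2,s_3,\beta,\theta)>0$ such that for every $\phi$ and $c_0$ as above, and for every enhanced data set $\Xi_1$ on $[0,1]$, there exist $0<T\le1$ and an open neighbourhood $\mathcal U\subset\mathcal X_T^{s_1,s_2,\varepsilon}$ of the restriction of $\Xi_1$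 to $[0,T]$ such that, for every $\Xi\in\mathcal U$, the system has exactly one solution $(X,Y,\mathfrak R)$ in $Z^{s_1,s_2,s_3}(T)$, and the solution map $\Xi\mapsto(X,Y,\mathfrak R)$ is continuous from $\mathcal U$ to $Z^{s_1,s_2,s_3}(T)$. All functions may be complex-valued; if the data are real-valued (and $\mathfrak J$ maps real-valued functions to real-valued functions), then so is the solution. -/

import Mathlib

open MeasureTheory Set Filter Topology
open scoped ENNReal NNReal

noncomputable section

namespace HartreeSdNLW

/-! ### Fourier side of the torus

The torus is realised as `(ℝ/ℤ)³` with its normalised Haar measure; the map `x ↦ 2π x` identifies it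
with `(ℝ/2πℤ)³`, and `mFourier n` with `e_n(x) = exp(i n · x)`.  All multipliers below are written in
terms of the frequency `n ∈ ℤ³`, so that `-Δ` has the symbol `|n|²`.  A distribution on the torus
is handled through its Fourier coefficients. -/

/-- Frequencies. -/
abbrev Freq : Type := Fin 3 → ℤ

/-- Families of Fourier coefficients. -/
abbrev Coef : Type := Freq → ℂ

/-- The normalised Lebesgue measure on the three-dimensional torus. -/
def torusMeasure : Measure (UnitAddTorus (Fin 3)) :=
  Measure.pi fun _ => AddCircle.haarAddCircle

/-- The Euclidean norm `|n|`. -/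
def nrm (n : Freq) : ℝ := Real.sqrt (∑ i, (n i : ℝ) ^ 2)

/-- The bracket `⟨n⟩ = (1 + |n|²)^{1/2}`. -/
def jap (n : Freq) : ℝ := Real.sqrt (1 + nrm n ^ 2)

/-- The bracket `⟦n⟧ = (3/4 + |n|²)^{1/2}`. -/
def jbb (n : Freq) : ℝ := Real.sqrt (3 / 4 + nrm n ^ 2)

/-- The coefficients are those of a real-valued distribution. -/
def IsRealCoef (f : Coef) : Prop := ∀ n, f (-n) = starRingEnd ℂ (f n)

/-! ### Sobolev spaces -/

/-- The Sobolev space `W^{s,p}(𝕋³)`, normed by `‖f‖_{W^{s,p}} = ‖⟨∇⟩^s f‖_{L^p}`.  The distribution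
`f = ⟨∇⟩^{-s} g` with `g ∈ L^p` is stored as `g = ⟨∇⟩^s f`; its own Fourier coefficients are
`Sob.coeff`.  In particular `H^s = W^{s,2}`. -/
def Sob (_s : ℝ) (p : ℝ≥0∞) : Type := Lp ℂ p torusMeasure

instance (s : ℝ) (p : ℝ≥0∞) [Fact (1 ≤ p)] : NormedAddCommGroup (Sob s p) :=
  inferInstanceAs (NormedAddCommGroup (Lp ℂ p torusMeasure))

instance (s : ℝ) (p : ℝ≥0∞) [Fact (1 ≤ p)] : NormedSpace ℂ (Sob s p) :=
  inferInstanceAs (NormedSpace ℂ (Lp ℂ p torusMeasure))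

instance (s : ℝ) (p : ℝ≥0∞) [Fact (1 ≤ p)] : CompleteSpace (Sob s p) :=
  inferInstanceAs (CompleteSpace (Lp ℂ p torusMeasure))

/-- The function `⟨∇⟩^s f ∈ L^p` behind an element `f` of `W^{s,p}`. -/
def Sob.lift {s : ℝ} {p : ℝ≥0∞} (f : Sob s p) : Lp ℂ p torusMeasure := f

/-- The Fourier coefficients of an element of `W^{s,p}`, as a distribution. -/
def Sob.coeff {s : ℝ} {p : ℝ≥0∞} (f : Sob s p) : Coef := fun n =>
  ((jap n ^ (-s) : ℝ) : ℂ) * UnitAddTorus.mFourierCoeff (f.lift : UnitAddTorus (Fin 3) → ℂ) n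

instance : Fact ((1 : ℝ≥0∞) ≤ 3 / 2) :=
  ⟨by rw [ENNReal.le_div_iff_mul_le (Or.inl (by norm_num)) (Or.inl (by norm_num))]; norm_num⟩

instance : Fact ((1 : ℝ≥0∞) ≤ 3) := ⟨by norm_num⟩

/-! ### Littlewood–Paley pieces and Bony's decomposition -/

/-- A smooth bump function `ℝ → [0,1]` supported on `[-8/5, 8/5]` and equal to `1` on
`[-5/4, 5/4]`. -/
structure IsBump (φ : ℝ → ℝ) : Prop where
  smooth : ContDiff ℝ (⊤ : ℕ∞) φ
  nonneg : ∀ x, 0 ≤ φ x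
  le_one : ∀ x, φ x ≤ 1
  support : Function.support φ ⊆ Icc (-(8 / 5)) (8 / 5)
  eq_one : ∀ x ∈ Icc (-(5 / 4) : ℝ) (5 / 4), φ x = 1

/-- `φ_0(ξ) = φ(|ξ|)` and `φ_j(ξ) = φ(|ξ|/2^j) - φ(|ξ|/2^{j-1})` for `j ≥ 1`. -/
def dyadic (φ : ℝ → ℝ) : ℕ → Freq → ℝ
  | 0, n => φ (nrm n)
  | j + 1, n => φ (nrm n / 2 ^ (j + 1)) - φ (nrm n / 2 ^ j)

/-- The symbol `φ_j / ∑_k φ_k` of the Littlewood–Paley projector `P_j`. -/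
def lp (φ : ℝ → ℝ) (j : ℕ) (n : Freq) : ℝ := dyadic φ j n / ∑' k, dyadic φ k n

open Classical in
/-- `∑_{(j,k) : r j k} P_j f · P_k g`, on the Fourier side.  (For given frequencies only finitely
many pairs `(j,k)` contribute.) -/
def blocks (φ : ℝ → ℝ) (r : ℕ → ℕ → Prop) (f g : Coef) : Coef := fun n =>
  ∑' m : Freq,
    ((∑' jk : ℕ × ℕ, if r jk.1 jk.2 then lp φ jk.1 m * lp φ jk.2 (n - m) else 0 : ℝ) : ℂ)
      * (f m * g (n - m))

/-- The paraproduct with low frequencies on `f`: `∑_{j < k-2} P_j f P_k g`. -/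
def paraLow (φ : ℝ → ℝ) (f g : Coef) : Coef := blocks φ (fun j k => j + 2 < k) f g

/-- The resonant product `∑_{|j-k| ≤ 2} P_j f P_k g`. -/
def reson (φ : ℝ → ℝ) (f g : Coef) : Coef := blocks φ (fun j k => j ≤ k + 2 ∧ k ≤ j + 2) f g

/-- The paraproduct with low frequencies on `g`: `∑_{k < j-2} P_j f P_k g`. -/
def paraHigh (φ : ℝ → ℝ) (f g : Coef) : Coef := blocks φ (fun j k => k + 2 < j) f g

/-- The part `θ k + c₀ ≤ j < k - 2` of the paraproduct `paraLow`. -/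
def paraLow₁ (φ : ℝ → ℝ) (θ c₀ : ℝ) (f g : Coef) : Coef :=
  blocks φ (fun j k => θ * k + c₀ ≤ j ∧ j + 2 < k) f g

/-- The pointwise product. -/
def conv (f g : Coef) : Coef := fun n => ∑' m : Freq, f m * g (n - m)

/-- Convolution with the Bessel potential `V` of order `β`: `V ∗ f = (1 - Δ)^{-β/2} f`. -/
def bessel (β : ℝ) (f : Coef) : Coef := fun n => ((jap n ^ (-β) : ℝ) : ℂ) * f n

/-! ### The damped wave propagators -/

/-- The symbol of `𝒟(t) = e^{-t/2} sin(t √(3/4 - Δ)) / √(3/4 - Δ)`. -/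
def waveSym (n : Freq) (t : ℝ) : ℝ := Real.exp (-t / 2) * (Real.sin (t * jbb n) / jbb n)

/-- The linear evolution `S(t)(f, g) = ∂_t 𝒟(t) f + 𝒟(t)(f + g)`. -/
def linEvol (f g : Coef) (t : ℝ) : Coef := fun n =>
  ((deriv (waveSym n) t : ℝ) : ℂ) * f n + (waveSym n t : ℂ) * (f n + g n)

/-- The Duhamel operator `ℐ F(t) = ∫_0^t 𝒟(t - t') F(t') dt'`. -/
def duhamel (F : ℝ → Coef) (t : ℝ) : Coef := fun n =>
  ∫ t' in (0 : ℝ)..t, (waveSym n (t - t') : ℂ) * F t' n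

/-! ### Spaces of functions of time -/

/-- Fourier coefficients at time `t` of an element of `C([0,T]; W^{s,p})` (zero off `[0,T]`). -/
def coeffAt {s T : ℝ} {p : ℝ≥0∞} [Fact (1 ≤ p)] (u : C(Icc (0 : ℝ) T, Sob s p)) (t : ℝ) : Coef :=
  open Classical in if h : t ∈ Icc (0 : ℝ) T then (u ⟨t, h⟩).coeff else 0

/-- `v` is the time derivative of `u` in `W^{s',p}`: at every `t ∈ [0,T]` the difference quotients
of `u` are elements of `W^{s',p}` which converge to `v t` in the norm of that space. -/
def IsTimeDeriv {s s' T : ℝ} {p : ℝ≥0∞} [Fact (1 ≤ p)]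
    (u : C(Icc (0 : ℝ) T, Sob s p)) (v : C(Icc (0 : ℝ) T, Sob s' p)) : Prop :=
  ∀ t : Icc (0 : ℝ) T, ∃ q : Icc (0 : ℝ) T → Sob s' p,
    (∀ r n, (q r).coeff n = (((r : ℝ) - t : ℝ) : ℂ)⁻¹ * ((u r).coeff n - (u t).coeff n)) ∧
      Tendsto q (𝓝[≠] t) (𝓝 (v t))

/-- `C([0,T]; W^{s,p}) ∩ C¹([0,T]; W^{s-1,p})`, an element `u` being recorded together with its
time derivative; the topology is that of the norm
`sup ‖u(t)‖_{W^{s,p}} + sup ‖∂_t u(t)‖_{W^{s-1,p}}`. -/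
abbrev CC1 (s : ℝ) (p : ℝ≥0∞) [Fact (1 ≤ p)] (T : ℝ) : Type :=
  {u : C(Icc (0 : ℝ) T, Sob s p) × C(Icc (0 : ℝ) T, Sob (s - 1) p) // IsTimeDeriv u.1 u.2}

/-- Lebesgue measure on `[0,T]`. -/
abbrev timeMeasure (T : ℝ) : Measure ℝ := volume.restrict (Icc (0 : ℝ) T)

/-- The Bochner space `L^q([0,T]; W^{s,p})`. -/
abbrev LqSob (q : ℝ≥0∞) (T s : ℝ) (p : ℝ≥0∞) [Fact (1 ≤ p)] : Type :=
  Lp (Sob s p) q (timeMeasure T)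

/-- The class `ℒ₂(3/2, T)` of bounded linear operators from `L^{3/2}([0,T]; L²)` to
`L^∞([0,T]; H^{s₃})`, with the operator norm. -/
abbrev L2Class (s₃ T : ℝ) : Type := LqSob (3 / 2) T 0 2 →L[ℂ] LqSob ∞ T s₃ 2

/-- An operator is causal if the output up to time `τ` depends only on the input up to time `τ`. -/
def IsCausal {s₃ T : ℝ} (J : L2Class s₃ T) : Prop :=
  ∀ (τ : ℝ) (w : LqSob (3 / 2) T 0 2), (∀ᵐ t ∂timeMeasure T, t ≤ τ → w t = 0) →
    ∀ᵐ t ∂timeMeasure T, t ≤ τ → J w t = 0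

/-- The solution space `Z^{s₁,s₂,s₃}(T) = X^{s₁}(T) × X^{s₂}(T) × L³([0,T]; H^{s₃})`. -/
abbrev ZSpace (s₁ s₂ s₃ T : ℝ) : Type := CC1 s₁ 2 T × CC1 s₂ 2 T × LqSob 3 T s₃ 2

/-! ### Enhanced data -/

/-- Enhanced data sets on `[0,T]`: the initial data, `Ψ` (with its time derivative),
`W = :Ψ²:`, `Z = (V ∗ :Ψ²:) ⊜ Ψ`, and the paracontrolled operator `J`, all of them
prescribed independently of each other. -/
structure EnhancedData (s₁ s₂ s₃ β ε T : ℝ) where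
  X₀ : Sob s₁ 2
  X₁ : Sob (s₁ - 1) 2
  Y₀ : Sob s₂ 2
  Y₁ : Sob (s₂ - 1) 2
  Ψ : CC1 (-(1 / 2) - ε) ∞ T
  W : C(Icc (0 : ℝ) T, Sob (-1 - ε) ∞)
  Z : C(Icc (0 : ℝ) T, Sob (β - 3 / 2 - ε) ∞)
  J : L2Class s₃ T
  causal : IsCausal J

variable {s₁ s₂ s₃ β ε T : ℝ}

/-- The components of an enhanced data set, in the product of the respective normed spaces. -/
def EnhancedData.toProd (Ξ : EnhancedData s₁ s₂ s₃ β ε T) :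
    (Sob s₁ 2 × Sob (s₁ - 1) 2) × (Sob s₂ 2 × Sob (s₂ - 1) 2) × CC1 (-(1 / 2) - ε) ∞ T ×
      C(Icc (0 : ℝ) T, Sob (-1 - ε) ∞) × C(Icc (0 : ℝ) T, Sob (β - 3 / 2 - ε) ∞) × L2Class s₃ T :=
  ((Ξ.X₀, Ξ.X₁), (Ξ.Y₀, Ξ.Y₁), Ξ.Ψ, Ξ.W, Ξ.Z, Ξ.J)

/-- The product (norm) topology on enhanced data sets. -/
instance : TopologicalSpace (EnhancedData s₁ s₂ s₃ β ε T) :=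
  TopologicalSpace.induced EnhancedData.toProd inferInstance

/-- The data are real-valued, and `J` maps real-valued functions to real-valued functions. -/
structure EnhancedData.IsReal (Ξ : EnhancedData s₁ s₂ s₃ β ε T) : Prop where
  X₀ : IsRealCoef Ξ.X₀.coeff
  X₁ : IsRealCoef Ξ.X₁.coeff
  Y₀ : IsRealCoef Ξ.Y₀.coeff
  Y₁ : IsRealCoef Ξ.Y₁.coeff
  Ψ : ∀ t, IsRealCoef (Ξ.Ψ.1.1 t).coeff
  W : ∀ t, IsRealCoef (Ξ.W t).coeff
  Z : ∀ t, IsRealCoef (Ξ.Z t).coeff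
  J : ∀ w : LqSob (3 / 2) T 0 2, (∀ᵐ t ∂timeMeasure T, IsRealCoef (w t).coeff) →
    ∀ᵐ t ∂timeMeasure T, IsRealCoef (Ξ.J w t).coeff

/-- The three components of `z = (X, Y, ℜ)` are real-valued. -/
def IsRealSol (z : ZSpace s₁ s₂ s₃ T) : Prop :=
  (∀ t, IsRealCoef (z.1.1.1 t).coeff) ∧ (∀ t, IsRealCoef (z.2.1.1.1 t).coeff) ∧
    ∀ᵐ t ∂timeMeasure T, IsRealCoef (z.2.2 t).coeff

/-! ### Restriction of enhanced data to a shorter time interval -/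

section restriction

variable {T' : ℝ}

/-- The inclusion `[0,T] ⊆ [0,T']`. -/
def inclTime (hT : T ≤ T') : C(Icc (0 : ℝ) T, Icc (0 : ℝ) T') where
  toFun t := ⟨t, t.2.1, t.2.2.trans hT⟩
  continuous_toFun := by fun_prop

theorem IsTimeDeriv.restrict {s s' : ℝ} {p : ℝ≥0∞} [Fact (1 ≤ p)] (hT : T ≤ T')
    {u : C(Icc (0 : ℝ) T', Sob s p)} {v : C(Icc (0 : ℝ) T', Sob s' p)} (h : IsTimeDeriv u v) :
    IsTimeDeriv (u.comp (inclTime hT)) (v.comp (inclTime hT)) := by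
  intro t
  obtain ⟨q, hq, hlim⟩ := h (inclTime hT t)
  refine ⟨fun r => q (inclTime hT r), fun r n => hq (inclTime hT r) n, hlim.comp ?_⟩
  refine tendsto_nhdsWithin_iff.2 ⟨?_, ?_⟩
  · exact ((inclTime hT).continuous.tendsto t).mono_left nhdsWithin_le_nhds
  · filter_upwards [self_mem_nhdsWithin] with r hr hrt
    have h0 : inclTime hT r = inclTime hT t := hrt
    have h1 : (inclTime hT r : ℝ) = inclTime hT t := congrArg Subtype.val h0
    exact hr (Subtype.ext h1)

/-- Restriction to a shorter time interval. -/
def CC1.restrict {s : ℝ} {p : ℝ≥0∞} [Fact (1 ≤ p)] (hT : T ≤ T') (u : CC1 s p T') : CC1 s p T :=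
  ⟨(u.1.1.comp (inclTime hT), u.1.2.comp (inclTime hT)), u.2.restrict hT⟩

theorem eLpNorm_extend {E : Type*} [NormedAddCommGroup E] {q : ℝ≥0∞} (hT : T ≤ T') (f : ℝ → E) :
    eLpNorm ((Icc (0 : ℝ) T).indicator f) q (timeMeasure T') = eLpNorm f q (timeMeasure T) := by
  rw [eLpNorm_indicator_eq_eLpNorm_restrict measurableSet_Icc,
    Measure.restrict_restrict measurableSet_Icc,
    inter_eq_left.2 (Icc_subset_Icc_right hT)]

theorem memLp_extend {E : Type*} [NormedAddCommGroup E] {q : ℝ≥0∞} (hT : T ≤ T') (f : Lp E q (timeMeasure T)) :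
    MemLp ((Icc (0 : ℝ) T).indicator f) q (timeMeasure T') := by
  rw [memLp_indicator_iff_restrict measurableSet_Icc,
    Measure.restrict_restrict measurableSet_Icc,
    inter_eq_left.2 (Icc_subset_Icc_right hT)]
  exact Lp.memLp f

variable {E : Type*} [NormedAddCommGroup E] [NormedSpace ℂ E] {q : ℝ≥0∞} [Fact (1 ≤ q)]

theorem timeMeasure_mono (hT : T ≤ T') : timeMeasure T ≤ timeMeasure T' :=
  Measure.restrict_mono (Icc_subset_Icc_right hT) le_rfl

/-- Restriction of functions in `L^q([0,T'])` to `[0,T]`. -/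
def restrictLq (hT : T ≤ T') : Lp E q (timeMeasure T') →L[ℂ] Lp E q (timeMeasure T) :=
  LinearMap.mkContinuous
    { toFun := fun f => ((Lp.memLp f).mono_measure (timeMeasure_mono hT)).toLp f
      map_add' := fun f g => by
        ext1
        filter_upwards [MemLp.coeFn_toLp ((Lp.memLp (f + g)).mono_measure (timeMeasure_mono hT)),
          Lp.coeFn_add (((Lp.memLp f).mono_measure (timeMeasure_mono hT)).toLp f)
            (((Lp.memLp g).mono_measure (timeMeasure_mono hT)).toLp g),
          MemLp.coeFn_toLp ((Lp.memLp f).mono_measure (timeMeasure_mono hT)),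
          MemLp.coeFn_toLp ((Lp.memLp g).mono_measure (timeMeasure_mono hT)),
          ae_mono (timeMeasure_mono hT) (Lp.coeFn_add f g)] with t h1 h2 h3 h4 h5
        rw [h1, h2, h5, Pi.add_apply, Pi.add_apply, h3, h4]
      map_smul' := fun c f => by
        ext1
        filter_upwards [MemLp.coeFn_toLp ((Lp.memLp (c • f)).mono_measure (timeMeasure_mono hT)),
          Lp.coeFn_smul c (((Lp.memLp f).mono_measure (timeMeasure_mono hT)).toLp f),
          MemLp.coeFn_toLp ((Lp.memLp f).mono_measure (timeMeasure_mono hT)),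
          ae_mono (timeMeasure_mono hT) (Lp.coeFn_smul c f)] with t h1 h2 h3 h4
        simp only [RingHom.id_apply]
        rw [h1, h2, h4, Pi.smul_apply, Pi.smul_apply, h3] }
    1 (fun f => by
      rw [one_mul]
      change ‖((Lp.memLp f).mono_measure (timeMeasure_mono hT)).toLp f‖ ≤ ‖f‖
      rw [Lp.norm_toLp, Lp.norm_def]
      exact ENNReal.toReal_mono (Lp.eLpNorm_ne_top _)
        (eLpNorm_mono_measure _ (timeMeasure_mono hT)))

theorem restrictLq_ae (hT : T ≤ T') (f : Lp E q (timeMeasure T')) :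
    restrictLq hT f =ᵐ[timeMeasure T] f :=
  MemLp.coeFn_toLp ((Lp.memLp f).mono_measure (timeMeasure_mono hT))

theorem ae_extend {P : ℝ → Prop} (h : ∀ᵐ t ∂timeMeasure T, P t) :
    ∀ᵐ t ∂timeMeasure T', t ∈ Icc (0 : ℝ) T → P t := by
  have h1 := (ae_restrict_iff' measurableSet_Icc).1 h
  exact ae_restrict_of_ae h1

/-- Extension by zero of functions in `L^q([0,T])` to `[0,T']`. -/
def extendLq (hT : T ≤ T') : Lp E q (timeMeasure T) →L[ℂ] Lp E q (timeMeasure T') :=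
  LinearMap.mkContinuous
    { toFun := fun f => (memLp_extend hT f).toLp _
      map_add' := fun f g => by
        ext1
        filter_upwards [MemLp.coeFn_toLp (memLp_extend hT (f + g)),
          Lp.coeFn_add ((memLp_extend hT f).toLp _) ((memLp_extend hT g).toLp _),
          MemLp.coeFn_toLp (memLp_extend hT f), MemLp.coeFn_toLp (memLp_extend hT g),
          ae_extend (Lp.coeFn_add f g)] with t h1 h2 h3 h4 h5
        rw [h1, h2, Pi.add_apply, h3, h4]
        by_cases ht : t ∈ Icc (0 : ℝ) T
        · simp only [indicator_of_mem ht, h5 ht, Pi.add_apply]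
        · simp only [indicator_of_notMem ht, add_zero]
      map_smul' := fun c f => by
        ext1
        filter_upwards [MemLp.coeFn_toLp (memLp_extend hT (c • f)),
          Lp.coeFn_smul c ((memLp_extend hT f).toLp _),
          MemLp.coeFn_toLp (memLp_extend hT f),
          ae_extend (Lp.coeFn_smul c f)] with t h1 h2 h3 h4
        simp only [RingHom.id_apply]
        rw [h1, h2, Pi.smul_apply, h3]
        by_cases ht : t ∈ Icc (0 : ℝ) T
        · simp only [indicator_of_mem ht, h4 ht, Pi.smul_apply]
        · simp only [indicator_of_notMem ht, smul_zero] }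
    1 (fun f => by
      rw [one_mul]
      change ‖(memLp_extend hT f).toLp _‖ ≤ ‖f‖
      rw [Lp.norm_toLp, Lp.norm_def, eLpNorm_extend hT])

theorem extendLq_ae (hT : T ≤ T') (f : Lp E q (timeMeasure T)) :
    extendLq hT f =ᵐ[timeMeasure T'] (Icc (0 : ℝ) T).indicator f :=
  MemLp.coeFn_toLp (memLp_extend hT f)

/-- The operator `J` on `[0,T]`: extend the input by zero, apply `J`, restrict the output. -/
def L2Class.restrict (hT : T ≤ T') (J : L2Class s₃ T') : L2Class s₃ T :=
  (restrictLq hT).comp (J.comp (extendLq hT))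

theorem IsCausal.restrict (hT : T ≤ T') {J : L2Class s₃ T'} (hJ : IsCausal J) :
    IsCausal (L2Class.restrict hT J) := by
  intro τ w hw
  have h1 : ∀ᵐ t ∂timeMeasure T', t ≤ τ → extendLq hT w t = 0 := by
    filter_upwards [extendLq_ae hT w, ae_extend hw] with t h2 h3 ht
    rw [h2]
    by_cases h4 : t ∈ Icc (0 : ℝ) T
    · rw [indicator_of_mem h4, h3 h4 ht]
    · rw [indicator_of_notMem h4]
  filter_upwards [restrictLq_ae hT (J (extendLq hT w)),
    ae_mono (timeMeasure_mono hT) (hJ τ _ h1)] with t h2 h3 ht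
  exact h2.trans (h3 ht)

/-- Restriction of an enhanced data set to a shorter time interval. -/
def EnhancedData.restrict (hT : T ≤ T') (Ξ : EnhancedData s₁ s₂ s₃ β ε T') :
    EnhancedData s₁ s₂ s₃ β ε T where
  X₀ := Ξ.X₀
  X₁ := Ξ.X₁
  Y₀ := Ξ.Y₀
  Y₁ := Ξ.Y₁
  Ψ := CC1.restrict hT Ξ.Ψ
  W := Ξ.W.comp (inclTime hT)
  Z := Ξ.Z.comp (inclTime hT)
  J := L2Class.restrict hT Ξ.J
  causal := Ξ.causal.restrict hT

end restriction

/-! ### The system -/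

section system

variable (φ : ℝ → ℝ) (θ c₀ : ℝ) (Ξ : EnhancedData s₁ s₂ s₃ β ε T) (z : ZSpace s₁ s₂ s₃ T)

/-- `X(t)`. -/
def curveX (t : ℝ) : Coef := coeffAt z.1.1.1 t

/-- `Y(t)`. -/
def curveY (t : ℝ) : Coef := coeffAt z.2.1.1.1 t

/-- `ℜ(t)`. -/
def curveR (t : ℝ) : Coef := (z.2.2 t).coeff

/-- `Ψ(t)`. -/
def curveΨ (t : ℝ) : Coef := coeffAt Ξ.Ψ.1.1 t

/-- `Q_{X,Y} = (X+Y)² + 2 X ≺ Ψ + 2 X ≻ Ψ + 2 Y Ψ`. -/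
def curveQ (t : ℝ) : Coef :=
  conv (curveX z t + curveY z t) (curveX z t + curveY z t)
    + 2 * paraLow φ (curveX z t) (curveΨ Ξ t) + 2 * paraHigh φ (curveX z t) (curveΨ Ξ t)
    + 2 * conv (curveY z t) (curveΨ Ξ t)

/-- `V ∗ (Q_{X,Y} + 2ℜ)`. -/
def curveU (t : ℝ) : Coef := bessel β (curveQ φ Ξ z t + 2 * curveR z t)

/-- `V ∗ (Q_{X,Y} + 2ℜ + :Ψ²:)`. -/
def curveV (t : ℝ) : Coef :=
  bessel β (curveQ φ Ξ z t + 2 * curveR z t + coeffAt Ξ.W t)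

/-- The right-hand side of the `X`-equation: `-(V ∗ (Q_{X,Y} + 2ℜ + :Ψ²:)) ≺ Ψ`. -/
def forceX (t : ℝ) : Coef := -paraLow φ (curveV φ Ξ z t) (curveΨ Ξ t)

/-- `(V ∗ (Q_{X,Y} + 2ℜ + :Ψ²:)) ⊜ Ψ`, where the resonant product `(V ∗ :Ψ²:) ⊜ Ψ` is the
prescribed datum `Z`. -/
def resonV (t : ℝ) : Coef := reson φ (curveU φ Ξ z t) (curveΨ Ξ t) + coeffAt Ξ.Z t

/-- The right-hand side of the `Y`-equation:
`-(V ∗ (Q_{X,Y} + 2ℜ + :Ψ²:)) (X + Y) - (V ∗ (Q_{X,Y} + 2ℜ + :Ψ²:)) (≻ + ⊜) Ψ`. -/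
def forceY (t : ℝ) : Coef :=
  -conv (curveV φ Ξ z t) (curveX z t + curveY z t)
    - (paraHigh φ (curveV φ Ξ z t) (curveΨ Ξ t) + resonV φ Ξ z t)

/-- The paracontrolled operator `𝔍_≺^{(1)}`, the part `θ k + c₀ ≤ j < k - 2` of `ℐ(w ≺ Ψ)`. -/
def para₁ (w : ℝ → Coef) (t : ℝ) : Coef :=
  duhamel (fun t' => paraLow₁ φ θ c₀ (w t') (curveΨ Ξ t')) t

/-- `z = (X, Y, ℜ) ∈ Z^{s₁,s₂,s₃}(T)` solves the defocusing system with data `Ξ` on `[0,T]`, the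
two wave equations being written in Duhamel form.  As `ℜ` is only an element of
`L³([0,T]; H^{s₃})`, its initial value is that of the limit in `H^{s₃}` as `t → 0+`, off null
sets.  (In these spaces all frequency sums converge absolutely and all time integrals
exist.) -/
structure IsSolution : Prop where
  init_X : curveX z 0 = Ξ.X₀.coeff
  init_dX : coeffAt z.1.1.2 0 = Ξ.X₁.coeff
  init_Y : curveY z 0 = Ξ.Y₀.coeff
  init_dY : coeffAt z.2.1.1.2 0 = Ξ.Y₁.coeff
  init_R : Tendsto (fun t => ‖z.2.2 t‖) (𝓝[>] 0 ⊓ ae volume) (𝓝 0)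
  eq_X : ∀ t ∈ Icc (0 : ℝ) T,
    curveX z t = linEvol Ξ.X₀.coeff Ξ.X₁.coeff t + duhamel (forceX φ Ξ z) t
  eq_Y : ∀ t ∈ Icc (0 : ℝ) T,
    curveY z t = linEvol Ξ.Y₀.coeff Ξ.Y₁.coeff t + duhamel (forceY φ Ξ z) t
  eq_R : ∃ w : LqSob (3 / 2) T 0 2,
    (∀ᵐ t ∂timeMeasure T, (w t).coeff = curveV φ Ξ z t) ∧
    ∀ᵐ t ∂timeMeasure T, curveR z t =
      -reson φ (para₁ φ θ c₀ Ξ (curveV φ Ξ z) t) (curveΨ Ξ t) - (Ξ.J w t).coeff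

end system

end HartreeSdNLW

end

open HartreeSdNLW

/-! The solution is a fixed point of the Duhamel map, and energy estimates suffice: the propagator
gains one derivative, so a forcing term only has to be placed in `H^{s-1}`. Write v = U + V∗W with U
= V∗(Q + 2ℜ). Products of Sobolev functions and paraproducts with Ψ put Q in `H^κ`, κ = 2s₁ - 3/2 -
ε, hence U in `H^{κ+β}`; V∗W lies in `H^{β-1-ε}` and is in addition a bounded function. The
condition β > -3s₁ + s₂ + 2 is what places U(X+Y) in `H^{s₂-1}`. It also gives κ + β > 1/2 + ε for
small ε, so that U ⊜ Ψ makes sense; the resonance of V∗W with Ψ, which need not, is the datum Z.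

The ℜ-equation contains a Duhamel integral, P = 𝔍_≺^{(1)}(v). It is adjoined to the unknowns: P
solves a damped wave equation with zero initial data, forced by the blocks θk + c₀ ≤ j < k - 2 of v
≺ Ψ. Since v has positive regularity σ = β - 1 - ε, the factor 2^{-σj} gains σθ derivatives over an
ordinary paraproduct. For ε small in terms of θ this lifts P to regularity 1/2 + 4ε, and P ⊜ Ψ
becomes a continuous bilinear expression. No smallness of θ is needed.

What remains is the abstract system x = l + ∫ D(t-s) F(x,g)(r) ds, r = ρ(x,g) - J(V(x,g)(r)) of
`Model`, where F and V are Lipschitz on bounded sets of (x,g) and grow affinely in r. Thus r in L³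
of time makes the forcing integrable and the argument of J an element of `L^{3/2}`, while J returns
`L^∞`. On a window of length τ³ both L³ ⊂ L¹ and `L^∞` ⊂ L³ gain a factor τ. `Model.exists_diff` is
this estimate for two pairs that agree before the window. On the whole interval it gives a
contraction, Lipschitz in the data (`Model.exists_solution`). Applied window after window, with
causality of J, it gives uniqueness in the full space (`Model.step_unique`). Causality also makes
the J-term vanish at time 0, where P vanishes too. Real-valuedness passes to the limit of the
iterates started at 0.

Products with elements of `W^{s,∞}` are handled on the Fourier side, as bounded bilinear forms on ℓ²
(`FormBdd`, `MulBdd`). Multiplication by an `L^∞` function is such a form, and the class is stable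
under superposition of characters, hence under Gaussians, then under resolvents and fractional
powers of the bracket by integration. This yields the bound `2^{(a+ε)k}` for multiplication by the
k-th block of an element of `W^{-a,∞}` (`IsBump.exists_mulBdd_lp`), and `IsBump.exists_blocks` sums
over pairs of blocks. `exists_model` assembles the nonlinearities; `IsHartree.isSolution_toZ` and
`IsHartree.exists_step_eq` identify solutions with fixed points. -/

noncomputable section

namespace HartreeSdNLW

/-! ### Square-summable families and bounded bilinear forms -/

/-- The Hilbert space `ℓ²(ℤ³)`. -/
abbrev SqSum : Type := _root_.lp (fun _ : Freq => ℂ) 2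

theorem SqSum.sum_sq_le (f : SqSum) (s : Finset Freq) : ∑ m ∈ s, ‖f m‖ ^ 2 ≤ ‖f‖ ^ 2 := by
  have h := lp.sum_rpow_le_norm_rpow (p := 2) (by norm_num) f s
  simpa using h

theorem SqSum.exists_of_sum_le (a : Coef) {C : ℝ} (hC : 0 ≤ C)
    (h : ∀ s : Finset Freq, ∑ m ∈ s, ‖a m‖ ^ 2 ≤ C ^ 2) : ∃ f : SqSum, ⇑f = a ∧ ‖f‖ ≤ C := by
  have hm : Memℓp a 2 := memℓp_gen' (C := C ^ 2) fun s => by simpa using h s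
  refine ⟨⟨a, hm⟩, rfl, ?_⟩
  exact lp.norm_le_of_forall_sum_le (p := 2) (by norm_num) hC fun s => by simpa using h s

theorem SqSum.summable_sq (f : SqSum) : Summable fun m => ‖f m‖ ^ 2 :=
  summable_of_sum_le (fun _ => sq_nonneg _) (SqSum.sum_sq_le f)

theorem SqSum.norm_sq_eq (f : SqSum) : ‖f‖ ^ 2 = ∑' m, ‖f m‖ ^ 2 := by
  have := lp.norm_rpow_eq_tsum (p := 2) (by norm_num) f
  simpa using this

theorem SqSum.norm_apply_le (f : SqSum) (n : Freq) : ‖f n‖ ≤ ‖f‖ :=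
  lp.norm_apply_le_norm (by norm_num) f n

/-- The form `∑ K n m f m h n` is bounded by `C` on `ℓ² × ℓ²`. -/
def FormBdd (K : Freq → Freq → ℂ) (C : ℝ) : Prop :=
  ∀ (s : Finset Freq) (f h : Coef), ‖∑ n ∈ s, ∑ m ∈ s, K n m * f m * h n‖ ≤
    C * √(∑ m ∈ s, ‖f m‖ ^ 2) * √(∑ n ∈ s, ‖h n‖ ^ 2)

namespace FormBdd

variable {K : Freq → Freq → ℂ} {C : ℝ}

theorem nonneg (hK : FormBdd K C) : 0 ≤ C := by
  have := hK {0} 1 1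
  simp at this
  exact (norm_nonneg _).trans this

theorem mono (hK : FormBdd K C) {C' : ℝ} (h : C ≤ C') : FormBdd K C' := fun s f g =>
  (hK s f g).trans (by gcongr)

theorem congr (hK : FormBdd K C) {K' : Freq → Freq → ℂ} (h : ∀ n m, K' n m = K n m) :
    FormBdd K' C := by
  have : K' = K := by ext n m; exact h n m
  rwa [this]

/-- Diagonal factors in the input and output frequencies are absorbed into f and h. Sobolev weights
and cut-offs enter forms in this way. -/
theorem mul (hK : FormBdd K C) {p q : Coef} {α γ : ℝ} (hα : 0 ≤ α) (hγ : 0 ≤ γ)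
    (hp : ∀ m, ‖p m‖ ≤ α) (hq : ∀ n, ‖q n‖ ≤ γ) :
    FormBdd (fun n m => K n m * p m * q n) (C * α * γ) := by
  intro s f h
  have hC := hK.nonneg
  have key : ∀ (p f : Coef) (α : ℝ), 0 ≤ α → (∀ m, ‖p m‖ ≤ α) →
      √(∑ m ∈ s, ‖p m * f m‖ ^ 2) ≤ α * √(∑ m ∈ s, ‖f m‖ ^ 2) := by
    intro p f α hα hp
    refine Real.sqrt_le_iff.2 ⟨by positivity, ?_⟩
    rw [mul_pow, Real.sq_sqrt (Finset.sum_nonneg fun _ _ => sq_nonneg _), Finset.mul_sum]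
    refine Finset.sum_le_sum fun m _ => ?_
    rw [norm_mul, mul_pow]
    gcongr
    exact hp m
  calc _ = ‖∑ n ∈ s, ∑ m ∈ s, K n m * (p m * f m) * (q n * h n)‖ := by
        congr 1
        exact Finset.sum_congr rfl fun n _ => Finset.sum_congr rfl fun m _ => by ring
    _ ≤ C * √(∑ m ∈ s, ‖p m * f m‖ ^ 2) * √(∑ n ∈ s, ‖q n * h n‖ ^ 2) :=
        hK s (fun m => p m * f m) (fun n => q n * h n)
    _ ≤ C * (α * √(∑ m ∈ s, ‖f m‖ ^ 2)) * (γ * √(∑ n ∈ s, ‖h n‖ ^ 2)) := by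
        gcongr
        · exact key p f α hα hp
        · exact key q h γ hγ hq
    _ = _ := by ring

theorem const_mul (hK : FormBdd K C) (c : ℂ) : FormBdd (fun n m => c * K n m) (‖c‖ * C) := by
  intro s f h
  have := hK s f h
  calc _ = ‖c * ∑ n ∈ s, ∑ m ∈ s, K n m * f m * h n‖ := by
        simp only [Finset.mul_sum]
        congr 1
        exact Finset.sum_congr rfl fun n _ => Finset.sum_congr rfl fun m _ => by ring
    _ ≤ ‖c‖ * (C * √(∑ m ∈ s, ‖f m‖ ^ 2) * √(∑ n ∈ s, ‖h n‖ ^ 2)) := by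
        rw [norm_mul]; gcongr
    _ = _ := by ring

/-- Triangle inequality for a superposition of kernels, with only pointwise convergence of the
kernels. It is used to sum over pairs of dyadic blocks; `integral` is the continuous analogue, used
for integral representations of multipliers. -/
theorem hasSum {ι : Type*} {k : ι → Freq → Freq → ℂ} {c : ι → ℝ}
    (hk : ∀ i, FormBdd (k i) (c i)) (hc : Summable c) (h : ∀ n m, HasSum (fun i => k i n m) (K n m)) :
    FormBdd K (∑' i, c i) := by
  intro s f g
  have h1 : HasSum (fun i => ∑ n ∈ s, ∑ m ∈ s, k i n m * f m * g n)
      (∑ n ∈ s, ∑ m ∈ s, K n m * f m * g n) :=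
    hasSum_sum fun n _ => hasSum_sum fun m _ => ((h n m).mul_right _).mul_right _
  have h2 := (hc.hasSum.mul_right (√(∑ m ∈ s, ‖f m‖ ^ 2))).mul_right (√(∑ n ∈ s, ‖g n‖ ^ 2))
  exact h1.norm_le_of_bounded h2 fun i => hk i s f g

theorem sub (hK : FormBdd K C) {K' : Freq → Freq → ℂ} {C' : ℝ} (hK' : FormBdd K' C') :
    FormBdd (fun n m => K n m - K' n m) (C + C') := by
  intro s f g
  calc _ = ‖∑ n ∈ s, ∑ m ∈ s, K n m * f m * g n - ∑ n ∈ s, ∑ m ∈ s, K' n m * f m * g n‖ := by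
        simp only [sub_mul, Finset.sum_sub_distrib]
    _ ≤ _ := (norm_sub_le _ _).trans (add_le_add (hK s f g) (hK' s f g))
    _ = _ := by ring

theorem integral {α : Type*} [MeasurableSpace α] {μ : Measure α} {k : α → Freq → Freq → ℂ}
    {c : α → ℝ} (hk : ∀ᵐ x ∂μ, FormBdd (k x) (c x)) (hc : Integrable c μ)
    (hi : ∀ n m, Integrable (fun x => k x n m) μ) :
    FormBdd (fun n m => ∫ x, k x n m ∂μ) (∫ x, c x ∂μ) := by
  intro s f g
  have h1 : ∑ n ∈ s, ∑ m ∈ s, (∫ x, k x n m ∂μ) * f m * g n =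
      ∫ x, ∑ n ∈ s, ∑ m ∈ s, k x n m * f m * g n ∂μ := by
    rw [integral_finsetSum _ fun n _ => integrable_finsetSum _ fun m _ =>
      ((hi n m).mul_const _).mul_const _]
    refine Finset.sum_congr rfl fun n _ => ?_
    rw [integral_finsetSum _ fun m _ => ((hi n m).mul_const _).mul_const _]
    refine Finset.sum_congr rfl fun m _ => ?_
    rw [integral_mul_const, integral_mul_const]
  rw [h1, ← integral_mul_const, ← integral_mul_const]
  refine norm_integral_le_of_norm_le ((hc.mul_const _).mul_const _) ?_
  filter_upwards [hk] with x hx using hx s f g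

/-- Testing the form on the conjugate of the n-th row and on the unit vector at n bounds the row in
ℓ². By Cauchy–Schwarz the sums defining the associated operator then converge absolutely. -/
theorem row_sum_le (hK : FormBdd K C) (n : Freq) (s : Finset Freq) :
    ∑ m ∈ s, ‖K n m‖ ^ 2 ≤ C ^ 2 := by
  classical
  have hC := hK.nonneg
  set t := insert n s
  have h := hK t (fun m => starRingEnd ℂ (K n m)) (fun k => if k = n then 1 else 0)
  have hn : n ∈ t := Finset.mem_insert_self _ _
  have e1 : ∑ k ∈ t, ∑ m ∈ t, K k m * starRingEnd ℂ (K n m) * (if k = n then (1 : ℂ) else 0) =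
      ((∑ m ∈ t, ‖K n m‖ ^ 2 : ℝ) : ℂ) := by
    rw [Finset.sum_eq_single n]
    · simp [Complex.mul_conj, Complex.normSq_eq_norm_sq]
    · intro b _ hb; simp [hb]
    · simp [hn]
  have e2 : ∑ k ∈ t, ‖(if k = n then (1 : ℂ) else 0)‖ ^ 2 = 1 := by
    rw [Finset.sum_eq_single n] <;> simp +contextual [hn]
  have h0 : 0 ≤ ∑ m ∈ t, ‖K n m‖ ^ 2 := Finset.sum_nonneg fun _ _ => sq_nonneg _
  rw [e1, e2, Complex.norm_real, Real.norm_of_nonneg h0] at h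
  simp only [RCLike.norm_conj, Real.sqrt_one, mul_one] at h
  set A := ∑ m ∈ t, ‖K n m‖ ^ 2
  have hA : A ≤ C ^ 2 := by
    have h3 := Real.sq_sqrt h0
    have h4 := Real.sqrt_nonneg A
    by_cases h5 : √A = 0
    · rw [h5] at h3; nlinarith [sq_nonneg C]
    · have : 0 < √A := lt_of_le_of_ne h4 (Ne.symm h5)
      have : √A ≤ C := by
        by_contra hcon
        push Not at hcon
        nlinarith
      nlinarith
  exact (Finset.sum_le_sum_of_subset_of_nonneg (Finset.subset_insert _ _)
    fun _ _ _ => sq_nonneg _).trans hA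

theorem summable (hK : FormBdd K C) (f : SqSum) (n : Freq) : Summable fun m => K n m * f m := by
  have h1 : Summable fun m => ‖K n m‖ ^ 2 :=
    summable_of_sum_le (fun _ => sq_nonneg _) (hK.row_sum_le n)
  refine Summable.of_norm_bounded (h1.add f.summable_sq) fun m => ?_
  rw [norm_mul]
  nlinarith [sq_nonneg (‖K n m‖ - ‖f m‖), sq_nonneg (‖K n m‖), sq_nonneg (‖f m‖)]

/-- Duality: the form is tested on the conjugate of the output, cut to s, while the inner truncation
t exhausts all frequencies. -/
theorem sum_sq_le (hK : FormBdd K C) (f : SqSum) (s : Finset Freq) :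
    ∑ n ∈ s, ‖∑' m, K n m * f m‖ ^ 2 ≤ (C * ‖f‖) ^ 2 := by
  classical
  have hC := hK.nonneg
  have hlim : Tendsto (fun t : Finset Freq => ∑ n ∈ s, ‖∑ m ∈ t, K n m * f m‖ ^ 2) atTop
      (𝓝 (∑ n ∈ s, ‖∑' m, K n m * f m‖ ^ 2)) :=
    tendsto_finsetSum _ fun n _ => ((hK.summable f n).hasSum.norm).pow 2
  refine le_of_tendsto hlim ?_
  filter_upwards [eventually_ge_atTop s] with t ht
  set a : Coef := fun n => ∑ m ∈ t, K n m * f m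
  have h := hK t f (fun n => if n ∈ s then starRingEnd ℂ (a n) else 0)
  have e1 : ∑ n ∈ t, ∑ m ∈ t, K n m * f m * (if n ∈ s then starRingEnd ℂ (a n) else 0) =
      ((∑ n ∈ s, ‖a n‖ ^ 2 : ℝ) : ℂ) := by
    push_cast
    rw [← Finset.sum_subset ht]
    · refine Finset.sum_congr rfl fun n hn => ?_
      rw [if_pos hn, ← Finset.sum_mul, Complex.mul_conj, Complex.normSq_eq_norm_sq]
      push_cast; rfl
    · intro n _ hn; simp [hn]
  have e2 : ∑ n ∈ t, ‖(if n ∈ s then starRingEnd ℂ (a n) else 0)‖ ^ 2 = ∑ n ∈ s, ‖a n‖ ^ 2 := by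
    rw [← Finset.sum_subset ht]
    · refine Finset.sum_congr rfl fun n hn => ?_
      rw [if_pos hn, RCLike.norm_conj]
    · intro n _ hn; simp [hn]
  have h0 : 0 ≤ ∑ n ∈ s, ‖a n‖ ^ 2 := Finset.sum_nonneg fun _ _ => sq_nonneg _
  rw [e1, e2, Complex.norm_real, Real.norm_of_nonneg h0] at h
  have h2 : √(∑ m ∈ t, ‖f m‖ ^ 2) ≤ ‖f‖ := by
    rw [← Real.sqrt_sq (norm_nonneg f)]
    exact Real.sqrt_le_sqrt (f.sum_sq_le t)
  have h6 : ∑ n ∈ s, ‖a n‖ ^ 2 ≤ C * ‖f‖ * √(∑ n ∈ s, ‖a n‖ ^ 2) := h.trans (by gcongr)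
  change ∑ n ∈ s, ‖a n‖ ^ 2 ≤ _
  set A := ∑ n ∈ s, ‖a n‖ ^ 2
  have h3 := Real.sq_sqrt h0
  have h4 := Real.sqrt_nonneg A
  have h7 : 0 ≤ C * ‖f‖ := by positivity
  by_cases h5 : √A = 0
  · rw [h5] at h3; nlinarith [sq_nonneg (C * ‖f‖)]
  · have : 0 < √A := lt_of_le_of_ne h4 (Ne.symm h5)
    have : √A ≤ C * ‖f‖ := by
      by_contra hcon
      push Not at hcon
      nlinarith
    nlinarith

theorem exists_apply (hK : FormBdd K C) (f : SqSum) :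
    ∃ g : SqSum, (⇑g = fun n => ∑' m, K n m * f m) ∧ ‖g‖ ≤ C * ‖f‖ :=
  SqSum.exists_of_sum_le _ (mul_nonneg hK.nonneg (norm_nonneg f)) (hK.sum_sq_le f)

end FormBdd

/-! ### Brackets -/

theorem one_le_jap (n : Freq) : 1 ≤ jap n := by
  rw [jap, Real.one_le_sqrt]; nlinarith [sq_nonneg (nrm n)]

theorem jap_pos (n : Freq) : 0 < jap n := zero_lt_one.trans_le (one_le_jap n)

theorem nrm_nonneg (n : Freq) : 0 ≤ nrm n := Real.sqrt_nonneg _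

theorem jap_sq (n : Freq) : jap n ^ 2 = 1 + nrm n ^ 2 := Real.sq_sqrt (by positivity)

theorem nrm_le_jap (n : Freq) : nrm n ≤ jap n := Real.le_sqrt_of_sq_le (by linarith)

theorem nrm_neg (n : Freq) : nrm (-n) = nrm n := by simp [nrm]

theorem jap_neg (n : Freq) : jap (-n) = jap n := by simp [jap, nrm_neg]

theorem jap_rpow_ne (n : Freq) (s : ℝ) : ((jap n ^ s : ℝ) : ℂ) ≠ 0 :=
  Complex.ofReal_ne_zero.2 (Real.rpow_pos_of_pos (jap_pos n) s).ne'

theorem jap_rpow_add (n : Freq) (s t : ℝ) :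
    ((jap n ^ (s + t) : ℝ) : ℂ) = ((jap n ^ s : ℝ) : ℂ) * ((jap n ^ t : ℝ) : ℂ) := by
  rw [Real.rpow_add (jap_pos n)]; push_cast; rfl

theorem jap_rpow_neg_mul (n : Freq) (s : ℝ) :
    ((jap n ^ (-s) : ℝ) : ℂ) * ((jap n ^ s : ℝ) : ℂ) = 1 := by
  rw [← jap_rpow_add]; simp

theorem jap_rpow_mul_neg (n : Freq) (s : ℝ) :
    ((jap n ^ s : ℝ) : ℂ) * ((jap n ^ (-s) : ℝ) : ℂ) = 1 := by
  rw [← jap_rpow_add]; simp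

theorem norm_jap_rpow (n : Freq) (s : ℝ) : ‖((jap n ^ s : ℝ) : ℂ)‖ = jap n ^ s := by
  rw [Complex.norm_real, Real.norm_of_nonneg (Real.rpow_nonneg (jap_pos n).le s)]

/-! ### Coefficients in Sobolev spaces -/

instance : IsProbabilityMeasure torusMeasure :=
  inferInstanceAs (IsProbabilityMeasure (Measure.pi fun _ => AddCircle.haarAddCircle))

/-- The isometry `f ↦ (⟨n⟩^s f̂(n))ₙ` from `H^s` onto `ℓ²`. -/
def Sob.repr (s : ℝ) : Sob s 2 ≃ₗᵢ[ℂ] SqSum := UnitAddTorus.mFourierBasis.repr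

theorem Sob.repr_eq {s : ℝ} (f : Sob s 2) (n : Freq) :
    Sob.repr s f n =
      UnitAddTorus.mFourierCoeff (f.lift : UnitAddTorus (Fin 3) → ℂ) n :=
  UnitAddTorus.mFourierBasis_repr _ _

theorem Sob.coeff_eq_repr {s : ℝ} (f : Sob s 2) (n : Freq) :
    f.coeff n = ((jap n ^ (-s) : ℝ) : ℂ) * Sob.repr s f n := by
  rw [Sob.repr_eq, Sob.coeff]

theorem Sob.repr_apply {s : ℝ} (f : Sob s 2) (n : Freq) :
    Sob.repr s f n = ((jap n ^ s : ℝ) : ℂ) * f.coeff n := by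
  rw [Sob.coeff_eq_repr, ← mul_assoc, jap_rpow_mul_neg, one_mul]

theorem Sob.ext {s : ℝ} {f g : Sob s 2} (h : f.coeff = g.coeff) : f = g := by
  apply (Sob.repr s).injective
  ext n
  rw [Sob.repr_apply, Sob.repr_apply, h]

theorem integrable_mFourier_mul {p : ℝ≥0∞} [Fact (1 ≤ p)] (f : Lp ℂ p torusMeasure) (n : Freq) :
    Integrable (fun x => UnitAddTorus.mFourier (-n) x • (f : UnitAddTorus (Fin 3) → ℂ) x)
      torusMeasure := by
  have h1 : Integrable (f : UnitAddTorus (Fin 3) → ℂ) torusMeasure :=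
    (Lp.memLp f).integrable Fact.out
  refine h1.bdd_mul (c := 1) ?_ ?_
  · exact (UnitAddTorus.mFourier (-n)).continuous.aestronglyMeasurable
  · filter_upwards with x
    exact ((UnitAddTorus.mFourier (-n)).norm_coe_le_norm x).trans_eq UnitAddTorus.mFourier_norm

theorem Sob.coeff_add {s : ℝ} {p : ℝ≥0∞} [Fact (1 ≤ p)] (f g : Sob s p) :
    (f + g).coeff = f.coeff + g.coeff := by
  ext n
  have h : UnitAddTorus.mFourierCoeff ((f + g).lift : UnitAddTorus (Fin 3) → ℂ) n =
      UnitAddTorus.mFourierCoeff (f.lift : UnitAddTorus (Fin 3) → ℂ) n +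
      UnitAddTorus.mFourierCoeff (g.lift : UnitAddTorus (Fin 3) → ℂ) n := by
    refine (integral_congr_ae ?_).trans
      (integral_add (integrable_mFourier_mul f.lift n) (integrable_mFourier_mul g.lift n))
    filter_upwards [Lp.coeFn_add f.lift g.lift] with x hx
    have : (f + g).lift x = f.lift x + g.lift x := hx
    rw [this, smul_add]
  simp only [Sob.coeff, Pi.add_apply, h, mul_add]

theorem Sob.coeff_smul {s : ℝ} {p : ℝ≥0∞} [Fact (1 ≤ p)] (c : ℂ) (f : Sob s p) :
    (c • f).coeff = c • f.coeff := by
  ext n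
  have h : UnitAddTorus.mFourierCoeff ((c • f).lift : UnitAddTorus (Fin 3) → ℂ) n =
      c * UnitAddTorus.mFourierCoeff (f.lift : UnitAddTorus (Fin 3) → ℂ) n := by
    refine (integral_congr_ae ?_).trans (integral_const_mul c _)
    filter_upwards [Lp.coeFn_smul c f.lift] with x hx
    have : (c • f).lift x = c • f.lift x := hx
    rw [this, smul_eq_mul, smul_eq_mul, smul_eq_mul]
    ring
  simp only [Sob.coeff, Pi.smul_apply, h, smul_eq_mul]
  ring

/-- Taking coefficients, as a linear map. -/
def Sob.coeffₗ (s : ℝ) (p : ℝ≥0∞) [Fact (1 ≤ p)] : Sob s p →ₗ[ℂ] Coef where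
  toFun := Sob.coeff
  map_add' := Sob.coeff_add
  map_smul' := Sob.coeff_smul

theorem Sob.coeff_zero {s : ℝ} {p : ℝ≥0∞} [Fact (1 ≤ p)] : (0 : Sob s p).coeff = 0 :=
  (Sob.coeffₗ s p).map_zero

theorem Sob.coeff_neg {s : ℝ} {p : ℝ≥0∞} [Fact (1 ≤ p)] (f : Sob s p) :
    (-f).coeff = -f.coeff := (Sob.coeffₗ s p).map_neg f

theorem Sob.coeff_sub {s : ℝ} {p : ℝ≥0∞} [Fact (1 ≤ p)] (f g : Sob s p) :
    (f - g).coeff = f.coeff - g.coeff := (Sob.coeffₗ s p).map_sub f g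

/-- The `n`-th coefficient, as a continuous functional on `H^s`. -/
def Sob.coeffL (s : ℝ) (n : Freq) : Sob s 2 →L[ℂ] ℂ :=
  LinearMap.mkContinuous ((LinearMap.proj n).comp (Sob.coeffₗ s 2)) (jap n ^ (-s)) fun f => by
    change ‖f.coeff n‖ ≤ _
    rw [Sob.coeff_eq_repr, norm_mul, norm_jap_rpow, ← (Sob.repr s).norm_map f]
    have := Real.rpow_nonneg (jap_pos n).le (-s)
    gcongr
    exact SqSum.norm_apply_le _ n

theorem Sob.exists_of_repr {s : ℝ} (a : Coef) (g : SqSum)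
    (h : ∀ n, g n = ((jap n ^ s : ℝ) : ℂ) * a n) : ∃ f : Sob s 2, f.coeff = a ∧ ‖f‖ = ‖g‖ := by
  refine ⟨(Sob.repr s).symm g, ?_, (Sob.repr s).symm.norm_map g⟩
  ext n
  rw [Sob.coeff_eq_repr, LinearIsometryEquiv.apply_symm_apply, h, ← mul_assoc, jap_rpow_neg_mul,
    one_mul]

/-- A bounded kernel depending linearly on `g` defines a bounded bilinear operator. -/
theorem exists_bilinear {p : ℝ≥0∞} [Fact (1 ≤ p)] {a b c : ℝ} (κ : Freq → Freq → ℂ) (C : ℝ)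
    (h : ∀ g : Sob a p, FormBdd (fun n m => κ n m * g.coeff (n - m) *
      ((jap m ^ (-b) : ℝ) : ℂ) * ((jap n ^ c : ℝ) : ℂ)) (C * ‖g‖)) :
    ∃ B : Sob b 2 →L[ℂ] Sob a p →L[ℂ] Sob c 2, ∀ f g,
      (∀ n, Summable fun m => κ n m * (f.coeff m * g.coeff (n - m))) ∧
      (B f g).coeff = fun n => ∑' m, κ n m * (f.coeff m * g.coeff (n - m)) := by
  -- The weighted kernel acts on ⟨m⟩^b f̂(m), a square-summable family, and returns ⟨n⟩^c times the
  -- wanted output; both norms are then plain ℓ² norms.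
  have hrw : ∀ (f : Sob b 2) (g : Sob a p) n m, κ n m * g.coeff (n - m) *
      ((jap m ^ (-b) : ℝ) : ℂ) * ((jap n ^ c : ℝ) : ℂ) * Sob.repr b f m =
      ((jap n ^ c : ℝ) : ℂ) * (κ n m * (f.coeff m * g.coeff (n - m))) := by
    intro f g n m
    rw [Sob.coeff_eq_repr f m]; ring
  have hs : ∀ (f : Sob b 2) (g : Sob a p) n,
      Summable fun m => κ n m * (f.coeff m * g.coeff (n - m)) := by
    intro f g n
    have h1 := (h g).summable (Sob.repr b f) n
    simp only [hrw] at h1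
    exact (summable_mul_left_iff (jap_rpow_ne n c)).1 h1
  have hex : ∀ (f : Sob b 2) (g : Sob a p), ∃ u : Sob c 2,
      (u.coeff = fun n => ∑' m, κ n m * (f.coeff m * g.coeff (n - m))) ∧
        ‖u‖ ≤ C * ‖f‖ * ‖g‖ := by
    intro f g
    obtain ⟨v, hv, hvn⟩ := (h g).exists_apply (Sob.repr b f)
    obtain ⟨u, hu, hun⟩ := Sob.exists_of_repr (s := c)
      (fun n => ∑' m, κ n m * (f.coeff m * g.coeff (n - m))) v (fun n => by
        rw [hv]; simp only [hrw]; rw [tsum_mul_left])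
    refine ⟨u, hu, ?_⟩
    rw [hun]
    refine hvn.trans_eq ?_
    rw [(Sob.repr b).norm_map]; ring
  choose B hB hBn using hex
  refine ⟨LinearMap.mkContinuous₂ (LinearMap.mk₂ ℂ B ?_ ?_ ?_ ?_) C hBn,
    fun f g => ⟨hs f g, hB f g⟩⟩
  · intro f f' g
    apply Sob.ext
    rw [Sob.coeff_add, hB, hB, hB]
    ext n
    rw [Pi.add_apply, ← (hs f g n).tsum_add (hs f' g n), Sob.coeff_add]
    exact tsum_congr fun m => by rw [Pi.add_apply]; ring
  · intro r f g
    apply Sob.ext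
    rw [Sob.coeff_smul, hB, hB]
    ext n
    rw [Pi.smul_apply, smul_eq_mul, ← tsum_mul_left, Sob.coeff_smul]
    exact tsum_congr fun m => by rw [Pi.smul_apply, smul_eq_mul]; ring
  · intro f g g'
    apply Sob.ext
    rw [Sob.coeff_add, hB, hB, hB]
    ext n
    rw [Pi.add_apply, ← (hs f g n).tsum_add (hs f g' n), Sob.coeff_add]
    exact tsum_congr fun m => by rw [Pi.add_apply]; ring
  · intro r f g
    apply Sob.ext
    rw [Sob.coeff_smul, hB, hB]
    ext n
    rw [Pi.smul_apply, smul_eq_mul, ← tsum_mul_left, Sob.coeff_smul]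
    exact tsum_congr fun m => by rw [Pi.smul_apply, smul_eq_mul]; ring

/-- Fourier multipliers between Sobolev spaces. -/
theorem exists_multiplier {s s' C : ℝ} (hC : 0 ≤ C) (μ : Coef)
    (h : ∀ n, ‖μ n‖ * jap n ^ (s' - s) ≤ C) :
    ∃ M : Sob s 2 →L[ℂ] Sob s' 2, (∀ f n, (M f).coeff n = μ n * f.coeff n) ∧ ‖M‖ ≤ C := by
  have hex : ∀ f : Sob s 2, ∃ u : Sob s' 2, (u.coeff = fun n => μ n * f.coeff n) ∧
      ‖u‖ ≤ C * ‖f‖ := by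
    intro f
    obtain ⟨v, hv, hvn⟩ := SqSum.exists_of_sum_le
      (fun n => ((jap n ^ s' : ℝ) : ℂ) * (μ n * f.coeff n)) (C := C * ‖f‖) (by positivity) (by
        intro t
        rw [← (Sob.repr s).norm_map f, mul_pow]
        refine le_trans ?_ (mul_le_mul_of_nonneg_left (SqSum.sum_sq_le (Sob.repr s f) t)
          (sq_nonneg C))
        rw [Finset.mul_sum]
        refine Finset.sum_le_sum fun n _ => ?_
        rw [← mul_pow]
        refine pow_le_pow_left₀ (norm_nonneg _) ?_ 2
        have e : ((jap n ^ s' : ℝ) : ℂ) * (μ n * f.coeff n) =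
            (μ n * ((jap n ^ (s' - s) : ℝ) : ℂ)) * Sob.repr s f n := by
          rw [Sob.coeff_eq_repr, sub_eq_add_neg, jap_rpow_add]; ring
        rw [e, norm_mul, norm_mul, norm_jap_rpow]
        gcongr
        exact h n)
    obtain ⟨u, hu, hun⟩ := Sob.exists_of_repr (s := s') (fun n => μ n * f.coeff n) v
      (fun n => by rw [hv])
    exact ⟨u, hu, hun.trans_le hvn⟩
  choose M hM hMn using hex
  refine ⟨LinearMap.mkContinuous ⟨⟨M, fun f g => ?_⟩, fun r f => ?_⟩ C hMn,
    fun f n => congrFun (hM f) n, LinearMap.mkContinuous_norm_le _ hC _⟩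
  · apply Sob.ext
    rw [Sob.coeff_add, hM, hM, hM, Sob.coeff_add]
    ext n
    simp only [Pi.add_apply]; ring
  · apply Sob.ext
    rw [RingHom.id_apply, Sob.coeff_smul, hM, hM, Sob.coeff_smul]
    ext n
    simp only [Pi.smul_apply, smul_eq_mul]; ring

/-! ### Multiplication operators -/

/-- Multiplication by the distribution with coefficients `g` is bounded by `C` on `L²`. -/
def MulBdd (g : Coef) (C : ℝ) : Prop := FormBdd (fun n m => g (n - m)) C

theorem MulBdd.congr {g g' : Coef} {C : ℝ} (hg : MulBdd g C) (h : ∀ l, g' l = g l) :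
    MulBdd g' C := by
  rwa [show g' = g from funext h]

theorem integral_norm_sq_trigPoly (s : Finset Freq) (f : Coef) :
    ∫ x, ‖(∑ m ∈ s, f m • UnitAddTorus.mFourier m : C(UnitAddTorus (Fin 3), ℂ)) x‖ ^ 2
      ∂torusMeasure = ∑ m ∈ s, ‖f m‖ ^ 2 := by
  set F : C(UnitAddTorus (Fin 3), ℂ) := ∑ m ∈ s, f m • UnitAddTorus.mFourier m
  have h1 : ContinuousMap.toLp (E := ℂ) 2 torusMeasure ℂ F =
      ∑ m ∈ s, f m • UnitAddTorus.mFourierLp 2 m := by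
    simp only [F, map_sum, map_smul]; rfl
  have h2 := UnitAddTorus.orthonormal_mFourier (d := Fin 3).inner_sum f f s
  have h3 : inner ℂ (ContinuousMap.toLp (E := ℂ) 2 torusMeasure ℂ F)
      (ContinuousMap.toLp (E := ℂ) 2 torusMeasure ℂ F) = ∑ m ∈ s, starRingEnd ℂ (f m) * f m := by
    rw [h1]; exact h2
  rw [ContinuousMap.inner_toLp] at h3
  have h4 : ∀ z : ℂ, z * starRingEnd ℂ z = ((‖z‖ ^ 2 : ℝ) : ℂ) := fun z => by
    rw [Complex.mul_conj, Complex.normSq_eq_norm_sq]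
  simp only [mul_comm (starRingEnd ℂ _), h4] at h3
  rw [integral_complex_ofReal, ← Complex.ofReal_sum] at h3
  exact_mod_cast h3

theorem norm_integral_mul_trigPoly_le (G : Lp ℂ ∞ torusMeasure) (F H : C(UnitAddTorus (Fin 3), ℂ)) :
    ‖∫ x, G x * F x * H x ∂torusMeasure‖ ≤
      ‖G‖ * √(∫ x, ‖F x‖ ^ 2 ∂torusMeasure) * √(∫ x, ‖H x‖ ^ 2 ∂torusMeasure) := by
  have hF : MemLp (fun x => ‖F x‖) (ENNReal.ofReal 2) torusMeasure :=
    (F.continuous.norm.memLp_of_hasCompactSupport (HasCompactSupport.of_compactSpace _))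
  have hH : MemLp (fun x => ‖H x‖) (ENNReal.ofReal 2) torusMeasure :=
    (H.continuous.norm.memLp_of_hasCompactSupport (HasCompactSupport.of_compactSpace _))
  have hFH : Integrable (fun x => ‖G‖ * (‖F x‖ * ‖H x‖)) torusMeasure :=
    ((F.continuous.norm.mul H.continuous.norm).integrable_of_hasCompactSupport
      (HasCompactSupport.of_compactSpace _)).const_mul _
  have h1 : ‖∫ x, G x * F x * H x ∂torusMeasure‖ ≤ ∫ x, ‖G‖ * (‖F x‖ * ‖H x‖) ∂torusMeasure := by
    refine norm_integral_le_of_norm_le hFH ?_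
    have : ∀ᵐ x ∂torusMeasure, ‖G x‖ ≤ ‖G‖ := by
      have h := ae_le_eLpNormEssSup (f := G) (μ := torusMeasure)
      filter_upwards [h] with x hx
      rw [Lp.norm_def, eLpNorm_exponent_top, ← toReal_enorm]
      refine ENNReal.toReal_mono ?_ hx
      rw [← eLpNorm_exponent_top]
      exact Lp.eLpNorm_ne_top G
    filter_upwards [this] with x hx
    rw [norm_mul, norm_mul, mul_assoc]
    gcongr
  have h2 := integral_mul_le_Lp_mul_Lq_of_nonneg (μ := torusMeasure) Real.HolderConjugate.two_two
    (ae_of_all _ fun x => norm_nonneg (F x)) (ae_of_all _ fun x => norm_nonneg (H x)) hF hH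
  simp only [Real.rpow_two, ← Real.sqrt_eq_rpow] at h2
  rw [integral_const_mul] at h1
  calc _ ≤ _ := h1
    _ ≤ ‖G‖ * (√(∫ x, ‖F x‖ ^ 2 ∂torusMeasure) * √(∫ x, ‖H x‖ ^ 2 ∂torusMeasure)) := by gcongr
    _ = _ := by ring

/-- On finitely supported families the form is the integral of G F H', with trigonometric
polynomials F and H'; Hölder and Parseval conclude. -/
theorem mulBdd_of_Linfty (G : Lp ℂ ∞ torusMeasure) :
    MulBdd (UnitAddTorus.mFourierCoeff (G : UnitAddTorus (Fin 3) → ℂ)) ‖G‖ := by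
  intro s f h
  set F : C(UnitAddTorus (Fin 3), ℂ) := ∑ m ∈ s, f m • UnitAddTorus.mFourier m
  set H : C(UnitAddTorus (Fin 3), ℂ) := ∑ n ∈ s, starRingEnd ℂ (h n) • UnitAddTorus.mFourier n
  set H' : C(UnitAddTorus (Fin 3), ℂ) := ∑ n ∈ s, h n • UnitAddTorus.mFourier (-n)
  have hH' : ∀ x, H' x = starRingEnd ℂ (H x) := by
    intro x
    simp only [H, H', ContinuousMap.coe_sum, Finset.sum_apply, ContinuousMap.coe_smul,
      Pi.smul_apply, smul_eq_mul, map_sum, map_mul, Complex.conj_conj, UnitAddTorus.mFourier_neg]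
  have hi : ∀ n, Integrable (fun x => UnitAddTorus.mFourier (-n) x • G x) torusMeasure :=
    integrable_mFourier_mul G
  have hprod : ∀ (n m : Freq) x, UnitAddTorus.mFourier (-(n - m)) x =
      UnitAddTorus.mFourier m x * UnitAddTorus.mFourier (-n) x := by
    intro n m x
    rw [← UnitAddTorus.mFourier_add]; congr 2; abel
  have e : ∑ n ∈ s, ∑ m ∈ s, UnitAddTorus.mFourierCoeff (G : UnitAddTorus (Fin 3) → ℂ) (n - m) *
      f m * h n = ∫ x, G x * F x * H' x ∂torusMeasure := by
    have e1 : ∀ x, G x * F x * H' x = ∑ n ∈ s, ∑ m ∈ s,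
        (UnitAddTorus.mFourier (-(n - m)) x • G x) * f m * h n := by
      intro x
      simp only [F, H', ContinuousMap.coe_sum, Finset.sum_apply, ContinuousMap.coe_smul,
        Pi.smul_apply, smul_eq_mul, Finset.mul_sum, Finset.sum_mul, hprod]
      exact Finset.sum_congr rfl fun n _ => Finset.sum_congr rfl fun m _ => by ring
    simp only [e1]
    rw [integral_finsetSum _ fun n _ => integrable_finsetSum _ fun m _ =>
      ((hi (n - m)).mul_const _).mul_const _]
    refine Finset.sum_congr rfl fun n _ => ?_
    rw [integral_finsetSum _ fun m _ => ((hi (n - m)).mul_const _).mul_const _]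
    refine Finset.sum_congr rfl fun m _ => ?_
    rw [integral_mul_const, integral_mul_const]
    rfl
  rw [e]
  refine (norm_integral_mul_trigPoly_le G F H').trans_eq ?_
  simp only [hH', RCLike.norm_conj]
  rw [integral_norm_sq_trigPoly, integral_norm_sq_trigPoly]
  simp only [RCLike.norm_conj]

theorem Sob.mulBdd {a : ℝ} (G : Sob a ∞) :
    MulBdd (fun l => ((jap l ^ a : ℝ) : ℂ) * G.coeff l) ‖G‖ := by
  refine (mulBdd_of_Linfty G.lift).congr fun l => ?_
  rw [Sob.coeff, ← mul_assoc, jap_rpow_mul_neg, one_mul]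

/-- A character of the difference n - m splits into unimodular factors in n and in m. In physical
space g is merely translated. -/
theorem MulBdd.mul_phase {g : Coef} {C : ℝ} (hg : MulBdd g C) (χ : Coef)
    (h1 : ∀ n, ‖χ n‖ = 1) (h2 : ∀ n m, χ (n - m) = χ n * starRingEnd ℂ (χ m)) :
    MulBdd (fun l => χ l * g l) C := by
  have := FormBdd.mul hg (p := fun m => starRingEnd ℂ (χ m)) (q := χ) zero_le_one zero_le_one
    (fun m => by rw [RCLike.norm_conj, h1]) (fun n => (h1 n).le)
  rw [mul_one, mul_one] at this
  exact this.congr fun n m => by simp only [h2]; ring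

/-! ### Multipliers with integrable Fourier transform -/

/-- Three-dimensional Euclidean space. -/
abbrev E3 : Type := EuclideanSpace ℝ (Fin 3)

/-- A frequency as a vector. -/
def vec (n : Freq) : E3 := WithLp.toLp 2 fun i => (n i : ℝ)

theorem norm_vec (n : Freq) : ‖vec n‖ = nrm n := by
  simp [vec, nrm, EuclideanSpace.norm_eq]

theorem vec_sub (n m : Freq) : vec (n - m) = vec n - vec m := by
  ext i; simp [vec]

/-- Continuous functions that are integrable together with their Fourier transform. -/
def IsWiener (F : E3 → ℂ) : Prop :=
  Continuous F ∧ Integrable F ∧ Integrable (FourierTransform.fourier F)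

/-- Fourier inversion writes the multiplier as a superposition of characters, each of which
preserves the bound. The constant is the L¹ norm of the Fourier transform of F and does not depend
on the dilation r; this uniformity is what serves for all dyadic scales and all heat times. -/
theorem IsWiener.exists_mulBdd {F : E3 → ℂ} (hF : IsWiener F) :
    ∃ C : ℝ, 0 ≤ C ∧ ∀ (r : ℝ) (g : Coef) (C₀ : ℝ), MulBdd g C₀ →
      MulBdd (fun l => F (r • vec l) * g l) (C * C₀) := by
  obtain ⟨hc, hi, hi'⟩ := hF
  refine ⟨∫ v, ‖FourierTransform.fourier F v‖, integral_nonneg fun _ => norm_nonneg _,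
    fun r g C₀ hg => ?_⟩
  set χ : E3 → Coef := fun v l => Complex.exp (↑(2 * Real.pi * inner ℝ v (r • vec l)) * Complex.I)
  have hχ : ∀ v l, ‖χ v l‖ = 1 := fun v l => Complex.norm_exp_ofReal_mul_I _
  have hinv : ∀ w, F w = ∫ v, Complex.exp (↑(2 * Real.pi * inner ℝ v w) * Complex.I) •
      FourierTransform.fourier F v := by
    intro w
    rw [← Real.fourierInv_eq', hc.fourierInv_fourier_eq hi hi']
  have key : ∀ v, FormBdd (fun n m => FourierTransform.fourier F v * (χ v (n - m) * g (n - m)))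
      (‖FourierTransform.fourier F v‖ * C₀) := by
    intro v
    refine FormBdd.const_mul (MulBdd.mul_phase hg (χ v) (hχ v) fun n m => ?_) _
    simp only [χ, vec_sub]
    rw [← Complex.exp_conj, ← Complex.exp_add]
    congr 1
    rw [smul_sub, inner_sub_right, map_mul, Complex.conj_ofReal, Complex.conj_I]
    push_cast; ring
  have hint : ∀ n m, Integrable fun v =>
      FourierTransform.fourier F v * (χ v (n - m) * g (n - m)) := by
    intro n m
    refine hi'.mul_bdd (c := ‖g (n - m)‖) ?_ ?_
    · refine Continuous.aestronglyMeasurable ?_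
      simp only [χ]
      fun_prop
    · filter_upwards with v
      rw [norm_mul, hχ, one_mul]
  have := FormBdd.integral (Eventually.of_forall key) (hi'.norm.mul_const C₀) hint
  rw [integral_mul_const] at this
  refine this.congr fun n m => ?_
  simp only []
  rw [hinv, ← integral_mul_const]
  refine integral_congr_ae (Eventually.of_forall fun v => ?_)
  simp only [χ, smul_eq_mul]
  ring

theorem isWiener_gaussian : IsWiener fun v => Complex.exp (-(‖v‖ : ℂ) ^ 2) := by
  have h : ∀ b : ℝ, 0 < b → Integrable fun v : E3 => Complex.exp (-(b : ℂ) * (‖v‖ : ℂ) ^ 2) := by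
    intro b hb
    simpa using GaussianFourier.integrable_cexp_neg_mul_sq_norm_add (V := E3) (b := (b : ℂ))
      (by simpa using hb) 0 0
  refine ⟨by fun_prop, by simpa using h 1 one_pos, ?_⟩
  have e : FourierTransform.fourier (fun v : E3 => Complex.exp (-(‖v‖ : ℂ) ^ 2)) =
      fun w => ((Real.pi : ℂ) / 1) ^ ((Module.finrank ℝ E3 : ℂ) / 2) *
        Complex.exp (-((Real.pi ^ 2 : ℝ) : ℂ) * (‖w‖ : ℂ) ^ 2) := by
    ext w
    have := fourier_gaussian_innerProductSpace (V := E3) (b := 1) (by simp) w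
    simp only [neg_mul, one_mul] at this
    rw [this]
    congr 2
    push_cast; ring
  rw [e]
  exact (h _ (by positivity)).const_mul _

theorem isWiener_of_smooth {F : E3 → ℂ} (h1 : HasCompactSupport F)
    (h2 : ContDiff ℝ (⊤ : ℕ∞) F) : IsWiener F := by
  set S : SchwartzMap E3 ℂ := h1.toSchwartzMap h2
  have hS : (S : E3 → ℂ) = F := rfl
  refine ⟨h2.continuous, hS ▸ S.integrable, ?_⟩
  rw [← hS, ← SchwartzMap.fourier_coe]
  exact (FourierTransform.fourier S).integrable

/-- The norm is not smooth at the origin, but φ is constant near 0. -/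
theorem IsBump.contDiff_norm {φ : ℝ → ℝ} (hφ : IsBump φ) :
    ContDiff ℝ (⊤ : ℕ∞) fun v : E3 => φ ‖v‖ := by
  rw [contDiff_iff_contDiffAt]
  intro v
  by_cases hv : v = 0
  · have : (fun v : E3 => φ ‖v‖) =ᶠ[𝓝 v] fun _ => 1 := by
      have : Metric.ball (0 : E3) 1 ∈ 𝓝 v := hv ▸ Metric.ball_mem_nhds _ one_pos
      filter_upwards [this] with w hw
      rw [mem_ball_zero_iff] at hw
      exact hφ.eq_one _ ⟨by linarith [norm_nonneg w], by linarith⟩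
    exact contDiffAt_const.congr_of_eventuallyEq this
  · exact hφ.smooth.contDiffAt.comp v (contDiffAt_norm ℝ hv)

theorem IsBump.eq_zero {φ : ℝ → ℝ} (hφ : IsBump φ) {x : ℝ} (hx : 8 / 5 < x) : φ x = 0 := by
  by_contra h
  exact absurd (hφ.support h).2 (not_le.2 hx)

theorem IsBump.isWiener {φ : ℝ → ℝ} (hφ : IsBump φ) (i : ℕ) :
    IsWiener fun v => ((‖v‖ ^ (2 * i) * φ ‖v‖ : ℝ) : ℂ) := by
  apply isWiener_of_smooth
  · refine HasCompactSupport.intro (isCompact_closedBall (0 : E3) (8 / 5)) fun v hv => ?_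
    rw [mem_closedBall_zero_iff, not_le] at hv
    rw [hφ.eq_zero hv]; simp
  · refine Complex.ofRealCLM.contDiff.comp (ContDiff.mul ?_ hφ.contDiff_norm)
    simp only [pow_mul]
    exact (contDiff_norm_sq ℝ).pow i

/-! ### Resolvents and powers of the bracket -/

theorem exists_mulBdd_gaussian : ∃ C : ℝ, 0 ≤ C ∧ ∀ (s : ℝ), 0 ≤ s → ∀ (g : Coef) (C₀ : ℝ),
    MulBdd g C₀ → MulBdd (fun l => (Real.exp (-(s * nrm l ^ 2)) : ℂ) * g l) (C * C₀) := by
  obtain ⟨C, hC, h⟩ := isWiener_gaussian.exists_mulBdd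
  refine ⟨C, hC, fun s hs g C₀ hg => (h (√s) g C₀ hg).congr fun l => ?_⟩
  congr 1
  rw [norm_smul, norm_vec, Real.norm_of_nonneg (Real.sqrt_nonneg s), ← Complex.ofReal_pow, mul_pow,
    Real.sq_sqrt hs]
  push_cast; rfl

/-- The resolvent is the Laplace transform of the heat semigroup: 1/(t + ⟨l⟩²) is the integral over
s > 0 of e^{-(1+t)s} e^{-s|l|²}. The mass of e^{-(1+t)s} gives the decay in t. -/
theorem exists_mulBdd_resolvent : ∃ C : ℝ, 0 ≤ C ∧ ∀ (t : ℝ), 0 ≤ t → ∀ (g : Coef) (C₀ : ℝ),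
    MulBdd g C₀ →
      MulBdd (fun l => (((t + jap l ^ 2)⁻¹ : ℝ) : ℂ) * g l) (C * C₀ * (1 + t)⁻¹) := by
  obtain ⟨C, hC, h⟩ := exists_mulBdd_gaussian
  refine ⟨C, hC, fun t ht g C₀ hg => ?_⟩
  have hI : ∀ x : ℝ, 0 < x → ∫ s in Ioi (0 : ℝ), Real.exp (-x * s) = x⁻¹ := by
    intro x hx
    rw [integral_exp_mul_Ioi (neg_neg_of_pos hx)]
    simp [div_neg, neg_div]
  have hi : ∀ x : ℝ, 0 < x → Integrable (fun s => Real.exp (-x * s)) (volume.restrict (Ioi 0)) :=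
    fun x hx => integrableOn_exp_mul_Ioi (neg_neg_of_pos hx) 0
  have key : ∀ᵐ s ∂(volume.restrict (Ioi (0 : ℝ))), FormBdd (fun n m =>
      (Real.exp (-(1 + t) * s) : ℂ) * ((Real.exp (-(s * nrm (n - m) ^ 2)) : ℂ) * g (n - m)))
      (Real.exp (-(1 + t) * s) * (C * C₀)) := by
    filter_upwards [ae_restrict_mem measurableSet_Ioi] with s hs
    have := FormBdd.const_mul (h s (le_of_lt hs) g C₀ hg) (Real.exp (-(1 + t) * s) : ℂ)
    rwa [Complex.norm_real, Real.norm_of_nonneg (Real.exp_pos _).le] at this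
  have e : ∀ n m s, (Real.exp (-(1 + t) * s) : ℂ) * ((Real.exp (-(s * nrm (n - m) ^ 2)) : ℂ) *
      g (n - m)) = ((Real.exp (-(t + jap (n - m) ^ 2) * s) : ℝ) : ℂ) * g (n - m) := by
    intro n m s
    rw [← mul_assoc, ← Complex.ofReal_mul, ← Real.exp_add, jap_sq]
    congr 3; ring
  have hpos : ∀ l, 0 < t + jap l ^ 2 := fun l => by have := jap_pos l; positivity
  have := FormBdd.integral key ((hi (1 + t) (by positivity)).mul_const _) (fun n m => by
    simp only [e]
    exact (hi _ (hpos _)).ofReal.mul_const _)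
  rw [integral_mul_const, hI _ (by positivity), mul_comm] at this
  refine this.congr fun n m => ?_
  simp only [e]
  rw [integral_mul_const, integral_complex_ofReal, hI _ (hpos _)]

/-- Subordination to the heat semigroup through the Gamma integral. This is what makes V∗W a bounded
function when β exceeds the negative order of W. -/
theorem exists_mulBdd_jap_neg {δ : ℝ} (hδ : 0 < δ) : ∃ C : ℝ, 0 ≤ C ∧ ∀ (g : Coef) (C₀ : ℝ),
    MulBdd g C₀ → MulBdd (fun l => ((jap l ^ (-δ) : ℝ) : ℂ) * g l) (C * C₀) := by
  obtain ⟨C, hC, h⟩ := exists_mulBdd_gaussian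
  have hδ2 : 0 < δ / 2 := by positivity
  have hΓ := Real.Gamma_pos_of_pos hδ2
  have hg1 : Integrable (fun t : ℝ => t ^ (δ / 2 - 1) * Real.exp (-t))
      (volume.restrict (Ioi 0)) := by
    refine (Real.GammaIntegral_convergent hδ2).congr (ae_of_all _ fun t => ?_)
    exact mul_comm _ _
  set A := ∫ t in Ioi (0 : ℝ), t ^ (δ / 2 - 1) * Real.exp (-t)
  have hA : 0 ≤ A := setIntegral_nonneg measurableSet_Ioi fun t ht =>
    mul_nonneg (Real.rpow_nonneg (le_of_lt ht) _) (Real.exp_pos _).le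
  refine ⟨(Real.Gamma (δ / 2))⁻¹ * (A * C), by positivity, fun g C₀ hg => ?_⟩
  have e : ∀ l t, ((t ^ (δ / 2 - 1) * Real.exp (-t) : ℝ) : ℂ) *
      ((Real.exp (-(t * nrm l ^ 2)) : ℂ) * g l) =
      ((t ^ (δ / 2 - 1) * Real.exp (-(jap l ^ 2 * t)) : ℝ) : ℂ) * g l := by
    intro l t
    rw [← mul_assoc, ← Complex.ofReal_mul, mul_assoc, ← Real.exp_add, jap_sq]
    congr 4; ring
  have key : ∀ᵐ t ∂(volume.restrict (Ioi (0 : ℝ))), FormBdd (fun n m =>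
      ((t ^ (δ / 2 - 1) * Real.exp (-t) : ℝ) : ℂ) *
        ((Real.exp (-(t * nrm (n - m) ^ 2)) : ℂ) * g (n - m)))
      (t ^ (δ / 2 - 1) * Real.exp (-t) * (C * C₀)) := by
    filter_upwards [ae_restrict_mem measurableSet_Ioi] with t ht
    have := FormBdd.const_mul (h t (le_of_lt ht) g C₀ hg)
      ((t ^ (δ / 2 - 1) * Real.exp (-t) : ℝ) : ℂ)
    rwa [Complex.norm_real, Real.norm_of_nonneg
      (mul_nonneg (Real.rpow_nonneg (le_of_lt ht) _) (Real.exp_pos _).le)] at this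
  have hi : ∀ l, Integrable (fun t : ℝ => t ^ (δ / 2 - 1) * Real.exp (-(jap l ^ 2 * t)))
      (volume.restrict (Ioi 0)) := by
    intro l
    refine hg1.mono' (by fun_prop) ?_
    filter_upwards [ae_restrict_mem measurableSet_Ioi] with t ht
    rw [Real.norm_of_nonneg (mul_nonneg (Real.rpow_nonneg (le_of_lt ht) _) (Real.exp_pos _).le)]
    have := Real.rpow_nonneg (le_of_lt ht) (δ / 2 - 1)
    gcongr
    have h1 : 1 ≤ jap l ^ 2 := by nlinarith [one_le_jap l]
    exact le_mul_of_one_le_left (le_of_lt ht) h1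
  have := (FormBdd.integral key (hg1.mul_const _) (fun n m => by
    simp only [e]
    exact (hi _).ofReal.mul_const _)).const_mul (((Real.Gamma (δ / 2))⁻¹ : ℝ) : ℂ)
  rw [integral_mul_const, Complex.norm_real, Real.norm_of_nonneg (by positivity)] at this
  refine FormBdd.congr (this.mono (le_of_eq (by ring))) fun n m => ?_
  simp only [e]
  have hj := jap_pos (n - m)
  rw [integral_mul_const, integral_complex_ofReal,
    Real.integral_rpow_mul_exp_neg_mul_Ioi hδ2 (by positivity), ← mul_assoc,
    ← Complex.ofReal_mul]
  congr 2
  rw [one_div, Real.inv_rpow (by positivity), ← Real.rpow_natCast, ← Real.rpow_mul hj.le,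
    Real.rpow_neg hj.le]
  push_cast
  rw [mul_div_cancel₀ δ (by norm_num)]
  field_simp

/-! ### Low-pass filters -/

theorem IsBump.exists_mulBdd_lowpass {φ : ℝ → ℝ} (hφ : IsBump φ) (i : ℕ) :
    ∃ C : ℝ, 0 ≤ C ∧ ∀ (k : ℕ) (g : Coef) (C₀ : ℝ), MulBdd g C₀ →
      MulBdd (fun l => (((nrm l / 2 ^ k) ^ (2 * i) * φ (nrm l / 2 ^ k) : ℝ) : ℂ) * g l)
        (C * C₀) := by
  obtain ⟨C, hC, h⟩ := (hφ.isWiener i).exists_mulBdd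
  refine ⟨C, hC, fun k g C₀ hg => (h (1 / 2 ^ k) g C₀ hg).congr fun l => ?_⟩
  rw [norm_smul, norm_vec, Real.norm_of_nonneg (by positivity), one_div_mul_eq_div]

/-- Near 0 the integrand behaves like t^{p-1}, at infinity like t^{p-1-q}. The two regimes are
dominated by the known integrands with exponents p and p + 1 - q, both in (0,1). -/
theorem integrable_rpow_mul_one_add_rpow {p q : ℝ} (hp : 0 < p) (hpq : p < q) (hq : q < 1) :
    Integrable (fun t : ℝ => t ^ (p - 1) * (1 + t) ^ (-q)) (volume.restrict (Ioi 0)) := by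
  have hp1 : p ∈ Ioo (0 : ℝ) 1 := ⟨hp, hpq.trans hq⟩
  have hp2 : p + 1 - q ∈ Ioo (0 : ℝ) 1 := ⟨by linarith, by linarith⟩
  have h1 := Real.integrableOn_rpowIntegrand₀₁_Ioi hp1 zero_le_one
  have h2 := Real.integrableOn_rpowIntegrand₀₁_Ioi hp2 zero_le_one
  refine ((h1.add h2).const_mul 2).mono' (by fun_prop) ?_
  filter_upwards [ae_restrict_mem measurableSet_Ioi] with t ht
  have ht' : 0 < t := ht
  have h0 : 0 < 1 + t := by positivity
  rw [Real.norm_of_nonneg (by positivity), Pi.add_apply,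
    Real.rpowIntegrand₀₁_eq_pow_div hp1 ht'.le zero_le_one,
    Real.rpowIntegrand₀₁_eq_pow_div hp2 ht'.le zero_le_one, mul_one, mul_one, add_comm t 1]
  rcases le_total t 1 with h | h
  · have h3 : (1 + t) ^ (-q) ≤ 1 :=
      Real.rpow_le_one_of_one_le_of_nonpos (by linarith) (by linarith)
    have h4 : 1 ≤ 2 / (1 + t) := by rw [le_div_iff₀ h0]; linarith
    calc t ^ (p - 1) * (1 + t) ^ (-q) ≤ t ^ (p - 1) * (2 / (1 + t)) := by
          gcongr; exact h3.trans h4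
      _ = 2 * (t ^ (p - 1) / (1 + t)) := by ring
      _ ≤ _ := by
          have : 0 ≤ t ^ (p + 1 - q - 1) / (1 + t) := by positivity
          linarith
  · have h3 : (1 + t) ^ (-q) ≤ 2 * t ^ (1 - q) / (1 + t) := by
      rw [le_div_iff₀ h0, ← Real.rpow_add_one h0.ne']
      calc (1 + t) ^ (-q + 1) ≤ (2 * t) ^ (1 - q) := by
            rw [neg_add_eq_sub]
            exact Real.rpow_le_rpow h0.le (by linarith) (by linarith)
        _ = 2 ^ (1 - q) * t ^ (1 - q) := Real.mul_rpow (by norm_num) ht'.le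
        _ ≤ 2 ^ (1 : ℝ) * t ^ (1 - q) := by
            gcongr
            · norm_num
            · linarith
        _ = _ := by rw [Real.rpow_one]
    calc t ^ (p - 1) * (1 + t) ^ (-q) ≤ t ^ (p - 1) * (2 * t ^ (1 - q) / (1 + t)) := by gcongr
      _ = 2 * (t ^ (p + 1 - q - 1) / (1 + t)) := by
          rw [show p + 1 - q - 1 = (p - 1) + (1 - q) by ring, Real.rpow_add ht']; ring
      _ ≤ _ := by
          have : 0 ≤ t ^ (p - 1) / (1 + t) := by positivity
          linarith

/-- There are two bounds for λ/(t+λ) at frequencies up to 2^k: a uniform one, and a bound by y =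
4^k/(1+t). Since min(1, y) ≤ y^q for 0 ≤ q ≤ 1, they combine into a decay rate of choice. -/
theorem IsBump.exists_mulBdd_resolvent_lowpass {φ : ℝ → ℝ} (hφ : IsBump φ) {q : ℝ} (hq : 0 ≤ q)
    (hq1 : q ≤ 1) : ∃ C : ℝ, 0 ≤ C ∧ ∀ (t : ℝ), 0 ≤ t → ∀ (k : ℕ) (g : Coef) (C₀ : ℝ),
      MulBdd g C₀ → MulBdd (fun l => ((jap l ^ 2 / (t + jap l ^ 2) : ℝ) : ℂ) *
        ((φ (nrm l / 2 ^ k) : ℂ) * g l)) (C * C₀ * (4 ^ k / (1 + t)) ^ q) := by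
  obtain ⟨C₁, hC₁, h₁⟩ := hφ.exists_mulBdd_lowpass 0
  obtain ⟨C₂, hC₂, h₂⟩ := hφ.exists_mulBdd_lowpass 1
  obtain ⟨R, hR, h₃⟩ := exists_mulBdd_resolvent
  refine ⟨(1 + R) * C₁ + R * (C₁ + C₂), by positivity, fun t ht k g C₀ hg => ?_⟩
  have hC₀ : 0 ≤ C₀ := FormBdd.nonneg hg
  have hpos : ∀ l, 0 < t + jap l ^ 2 := fun l => by have := jap_pos l; positivity
  have ht1 : 0 < 1 + t := by positivity
  have hL : MulBdd (fun l => (φ (nrm l / 2 ^ k) : ℂ) * g l) (C₁ * C₀) :=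
    (h₁ k g C₀ hg).congr fun l => by simp
  have hL' : MulBdd (fun l => (((nrm l / 2 ^ k) ^ 2 * φ (nrm l / 2 ^ k) : ℝ) : ℂ) * g l)
    (C₂ * C₀) := (h₂ k g C₀ hg).congr fun l => by simp
  -- Since ⟨l⟩² = 1 + 4^k (|l|/2^k)², this combines the low-pass multipliers with i = 0 and i = 1.
  have hJ : MulBdd (fun l => ((jap l ^ 2 : ℝ) : ℂ) * ((φ (nrm l / 2 ^ k) : ℂ) * g l))
      (C₁ * C₀ + 4 ^ k * (C₂ * C₀)) := by
    have h5 := FormBdd.const_mul hL' (-((4 : ℝ) ^ k : ℝ) : ℂ)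
    rw [norm_neg, Complex.norm_real, Real.norm_of_nonneg (by positivity)] at h5
    refine (FormBdd.sub hL h5).congr fun n m => ?_
    have e : jap (n - m) ^ 2 = 1 + 4 ^ k * (nrm (n - m) / 2 ^ k) ^ 2 := by
      rw [jap_sq, div_pow, ← pow_mul, mul_comm k 2, pow_mul]; norm_num; field_simp
    simp only [e]
    push_cast; ring
  -- Uniform bound, from λ/(t+λ) = 1 - t/(t+λ).
  have hB1 : MulBdd (fun l => ((jap l ^ 2 / (t + jap l ^ 2) : ℝ) : ℂ) *
      ((φ (nrm l / 2 ^ k) : ℂ) * g l)) ((1 + R) * C₁ * C₀) := by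
    have h5 := FormBdd.const_mul (h₃ t ht _ _ hL) (t : ℂ)
    rw [Complex.norm_real, Real.norm_of_nonneg ht] at h5
    have h6 : t * (R * (C₁ * C₀) * (1 + t)⁻¹) ≤ R * C₁ * C₀ := by
      have : t * (1 + t)⁻¹ ≤ 1 := by rw [← div_eq_mul_inv, div_le_one ht1]; linarith
      calc _ = R * C₁ * C₀ * (t * (1 + t)⁻¹) := by ring
        _ ≤ R * C₁ * C₀ * 1 := by gcongr
        _ = _ := mul_one _
    refine FormBdd.congr (FormBdd.mono (FormBdd.sub hL h5) (C' := (1 + R) * C₁ * C₀)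
      (by linarith)) fun n m => ?_
    have e : jap (n - m) ^ 2 / (t + jap (n - m) ^ 2) = 1 - t * (t + jap (n - m) ^ 2)⁻¹ := by
      have := (hpos (n - m)).ne'
      field_simp
      ring
    simp only [e]
    push_cast; ring
  -- Decaying bound: λ costs 4^k on low frequencies and the resolvent gains 1/(1+t).
  have hB2 : MulBdd (fun l => ((jap l ^ 2 / (t + jap l ^ 2) : ℝ) : ℂ) *
      ((φ (nrm l / 2 ^ k) : ℂ) * g l)) (R * (C₁ + C₂) * C₀ * (4 ^ k / (1 + t))) := by
    refine FormBdd.congr (FormBdd.mono (h₃ t ht _ _ hJ)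
      (C' := R * (C₁ + C₂) * C₀ * (4 ^ k / (1 + t))) ?_) fun n m => ?_
    · have : (1 : ℝ) ≤ 4 ^ k := one_le_pow₀ (by norm_num)
      rw [div_eq_mul_inv]
      have h7 : C₁ * C₀ ≤ 4 ^ k * (C₁ * C₀) := le_mul_of_one_le_left (by positivity) this
      calc _ ≤ R * (4 ^ k * (C₁ * C₀) + 4 ^ k * (C₂ * C₀)) * (1 + t)⁻¹ :=
            mul_le_mul_of_nonneg_right (mul_le_mul_of_nonneg_left
              (add_le_add_left h7 _) hR) (inv_nonneg.2 ht1.le)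
        _ = _ := by ring
    · simp only []
      rw [div_eq_mul_inv]
      push_cast; ring
  set y : ℝ := 4 ^ k / (1 + t)
  have hy : 0 < y := by positivity
  rcases le_total 1 y with h | h
  · refine FormBdd.mono hB1 ?_
    calc (1 + R) * C₁ * C₀ ≤ ((1 + R) * C₁ + R * (C₁ + C₂)) * C₀ := by
          gcongr; linarith [show 0 ≤ R * (C₁ + C₂) by positivity]
      _ = ((1 + R) * C₁ + R * (C₁ + C₂)) * C₀ * 1 := (mul_one _).symm
      _ ≤ _ := by gcongr; exact Real.one_le_rpow h hq
  · refine FormBdd.mono hB2 ?_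
    gcongr
    · linarith [show 0 ≤ (1 + R) * C₁ by positivity]
    · calc y = y ^ (1 : ℝ) := (Real.rpow_one y).symm
        _ ≤ y ^ q := Real.rpow_le_rpow_of_exponent_ge hy h hq1

/-- A Bernstein inequality with an ε-loss. The power λ^{a/2} of λ = ⟨l⟩² is a constant times the
integral of t^{a/2-1} λ/(t+λ). Convergence at infinity needs a decay exponent q = (a+ε)/2 above a/2,
whence the factor 4^{kq} = 2^{(a+ε)k}. -/
theorem IsBump.exists_mulBdd_rpow_lowpass {φ : ℝ → ℝ} (hφ : IsBump φ) {a ε : ℝ} (ha : 0 < a)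
    (hε : 0 < ε) (haε : a + ε < 2) : ∃ C : ℝ, 0 ≤ C ∧ ∀ (k : ℕ) (g : Coef) (C₀ : ℝ),
      MulBdd g C₀ → MulBdd (fun l => (φ (nrm l / 2 ^ k) : ℂ) * (((jap l ^ a : ℝ) : ℂ) * g l))
        (C * 2 ^ ((a + ε) * k) * C₀) := by
  set p := a / 2
  set q := (a + ε) / 2
  have hp : p ∈ Ioo (0 : ℝ) 1 := ⟨by positivity, by simp only [p]; linarith⟩
  have hpq : p < q := by simp only [p, q]; linarith
  have hq1 : q < 1 := by simp only [q]; linarith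
  obtain ⟨B, hB, h⟩ := hφ.exists_mulBdd_resolvent_lowpass (hp.1.trans hpq).le hq1.le
  set c := ∫ t in Ioi (0 : ℝ), Real.rpowIntegrand₀₁ p t 1
  have hc : 0 < c := Real.integral_rpowIntegrand₀₁_one_pos hp
  have hint := integrable_rpow_mul_one_add_rpow hp.1 hpq hq1
  set I := ∫ t in Ioi (0 : ℝ), t ^ (p - 1) * (1 + t) ^ (-q)
  have hI : 0 ≤ I := setIntegral_nonneg measurableSet_Ioi fun t ht => by
    have : (0 : ℝ) < t := ht
    positivity
  refine ⟨c⁻¹ * (B * I), by positivity, fun k g C₀ hg => ?_⟩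
  have e : ∀ l (t : ℝ), 0 < t → ((t ^ (p - 1) : ℝ) : ℂ) *
      (((jap l ^ 2 / (t + jap l ^ 2) : ℝ) : ℂ) * ((φ (nrm l / 2 ^ k) : ℂ) * g l)) =
      ((Real.rpowIntegrand₀₁ p t (jap l ^ 2) : ℝ) : ℂ) * ((φ (nrm l / 2 ^ k) : ℂ) * g l) := by
    intro l t ht
    rw [Real.rpowIntegrand₀₁_eq_pow_div hp ht.le (sq_nonneg _), ← mul_assoc, ← Complex.ofReal_mul,
      mul_div_assoc]
  have key : ∀ᵐ t ∂(volume.restrict (Ioi (0 : ℝ))), FormBdd (fun n m =>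
      ((Real.rpowIntegrand₀₁ p t (jap (n - m) ^ 2) : ℝ) : ℂ) *
        ((φ (nrm (n - m) / 2 ^ k) : ℂ) * g (n - m)))
      (t ^ (p - 1) * (1 + t) ^ (-q) * (B * C₀ * (4 ^ k) ^ q)) := by
    filter_upwards [ae_restrict_mem measurableSet_Ioi] with t ht
    have ht' : (0 : ℝ) < t := ht
    have h5 := FormBdd.const_mul (h t ht'.le k g C₀ hg) ((t ^ (p - 1) : ℝ) : ℂ)
    rw [Complex.norm_real, Real.norm_of_nonneg (by positivity)] at h5
    refine FormBdd.congr (h5.mono (le_of_eq ?_)) fun n m => (e _ t ht').symm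
    rw [Real.div_rpow (by positivity) (by positivity), Real.rpow_neg (by positivity)]
    ring
  have h6 := (FormBdd.integral key (hint.mul_const _) (fun n m =>
    (Real.integrableOn_rpowIntegrand₀₁_Ioi hp (sq_nonneg _)).ofReal.mul_const _)).const_mul
      ((c⁻¹ : ℝ) : ℂ)
  rw [integral_mul_const, Complex.norm_real, Real.norm_of_nonneg (by positivity)] at h6
  refine FormBdd.congr (h6.mono (le_of_eq ?_)) fun n m => ?_
  · have : ((4 : ℝ) ^ k) ^ q = 2 ^ ((a + ε) * k) := by
      rw [show (4 : ℝ) = 2 ^ (2 : ℝ) by norm_num, ← Real.rpow_natCast, ← Real.rpow_mul (by norm_num),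
        ← Real.rpow_mul (by norm_num)]
      congr 1
      simp only [q]; ring
    rw [this]; ring
  · simp only []
    have hj := jap_pos (n - m)
    have h8 : ∫ t in Ioi (0 : ℝ), Real.rpowIntegrand₀₁ p t (jap (n - m) ^ 2) =
        (jap (n - m) ^ 2) ^ p * c := Real.integral_rpowIntegrand₀₁_eq_rpow_mul_const hp (sq_nonneg _)
    rw [integral_mul_const, integral_complex_ofReal, h8]
    have : c⁻¹ * ((jap (n - m) ^ 2) ^ p * c) = jap (n - m) ^ a := by
      rw [← Real.rpow_natCast, ← Real.rpow_mul hj.le]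
      push_cast
      rw [show (2 : ℝ) * p = a by simp only [p]; ring]
      field_simp
    rw [← this]; push_cast; ring

/-! ### Littlewood–Paley projectors -/

section LittlewoodPaley

variable {φ : ℝ → ℝ}

theorem sum_dyadic (φ : ℝ → ℝ) (n : Freq) (N : ℕ) :
    ∑ j ∈ Finset.range (N + 1), dyadic φ j n = φ (nrm n / 2 ^ N) := by
  induction N with
  | zero => simp [dyadic]
  | succ N ih => rw [Finset.sum_range_succ, ih, dyadic]; ring

theorem IsBump.dyadic_eq_zero (hφ : IsBump φ) {n : Freq} {j : ℕ} (h : jap n < 2 ^ j) :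
    dyadic φ (j + 1) n = 0 := by
  have h1 : ∀ i, j ≤ i → φ (nrm n / 2 ^ i) = 1 := by
    intro i hi
    have h2 : (2 : ℝ) ^ j ≤ 2 ^ i := pow_le_pow_right₀ (by norm_num) hi
    have h3 := nrm_le_jap n
    have h4 := nrm_nonneg n
    refine hφ.eq_one _ ⟨?_, ?_⟩
    · have : 0 ≤ nrm n / 2 ^ i := by positivity
      linarith
    · rw [div_le_iff₀ (by positivity)]; linarith
  rw [dyadic, h1 _ (Nat.le_succ j), h1 _ le_rfl, sub_self]

theorem IsBump.hasSum_dyadic (hφ : IsBump φ) (n : Freq) : HasSum (fun j => dyadic φ j n) 1 := by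
  obtain ⟨N, hN⟩ := pow_unbounded_of_one_lt (jap n) (one_lt_two (α := ℝ))
  have h1 : φ (nrm n / 2 ^ N) = 1 := by
    have h3 := nrm_le_jap n
    have h4 := nrm_nonneg n
    refine hφ.eq_one _ ⟨?_, ?_⟩
    · have : 0 ≤ nrm n / 2 ^ N := by positivity
      linarith
    · rw [div_le_iff₀ (by positivity)]; linarith
  rw [← h1, ← sum_dyadic φ n N]
  refine hasSum_sum_of_ne_finset_zero fun j hj => ?_
  rw [Finset.mem_range, not_lt] at hj
  obtain ⟨i, rfl⟩ := Nat.exists_eq_add_of_le' hj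
  rw [← add_assoc]
  exact hφ.dyadic_eq_zero (hN.trans_le (pow_le_pow_right₀ (by norm_num) (Nat.le_add_left N i)))

/-- The dyadic functions telescope to 1, so the normalising denominator in `lp` equals 1. -/
theorem IsBump.lp_eq (hφ : IsBump φ) (j : ℕ) (n : Freq) : lp φ j n = dyadic φ j n := by
  rw [lp, (hφ.hasSum_dyadic n).tsum_eq, div_one]

theorem IsBump.abs_lp_le (hφ : IsBump φ) (j : ℕ) (n : Freq) : |lp φ j n| ≤ 1 := by
  rw [hφ.lp_eq]
  have h := fun x => hφ.nonneg x
  have h' := fun x => hφ.le_one x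
  cases j with
  | zero => rw [dyadic, abs_le]; constructor <;> linarith [h (nrm n), h' (nrm n)]
  | succ j =>
    rw [dyadic, abs_le]
    constructor <;> linarith [h (nrm n / 2 ^ (j + 1)), h' (nrm n / 2 ^ (j + 1)),
      h (nrm n / 2 ^ j), h' (nrm n / 2 ^ j)]

theorem IsBump.nrm_le_of_lp_ne (hφ : IsBump φ) {j : ℕ} {n : Freq} (h : lp φ j n ≠ 0) :
    nrm n ≤ 8 / 5 * 2 ^ j := by
  rw [hφ.lp_eq] at h
  by_contra hcon
  push Not at hcon
  have h1 : 8 / 5 < nrm n / 2 ^ j := by rwa [lt_div_iff₀ (by positivity)]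
  apply h
  cases j with
  | zero => rw [dyadic]; exact hφ.eq_zero (by simpa using h1)
  | succ j =>
    have h2 : 8 / 5 < nrm n / 2 ^ j := by
      rw [lt_div_iff₀ (by positivity)]
      rw [pow_succ] at hcon
      nlinarith [pow_pos (two_pos (α := ℝ)) j]
    rw [dyadic, hφ.eq_zero h1, hφ.eq_zero h2, sub_self]

theorem IsBump.le_nrm_of_lp_ne (hφ : IsBump φ) {j : ℕ} {n : Freq} (h : lp φ (j + 1) n ≠ 0) :
    5 / 8 * 2 ^ (j + 1) ≤ nrm n := by
  rw [hφ.lp_eq] at h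
  by_contra hcon
  push Not at hcon
  have h0 := nrm_nonneg n
  have hp := pow_pos (two_pos (α := ℝ)) j
  rw [pow_succ] at hcon
  have h1 : φ (nrm n / 2 ^ j) = 1 := by
    refine hφ.eq_one _ ⟨?_, ?_⟩
    · have : 0 ≤ nrm n / 2 ^ j := by positivity
      linarith
    · rw [div_le_iff₀ (by positivity)]; linarith
  have h2 : φ (nrm n / 2 ^ (j + 1)) = 1 := by
    refine hφ.eq_one _ ⟨?_, ?_⟩
    · have : 0 ≤ nrm n / 2 ^ (j + 1) := by positivity
      linarith
    · rw [div_le_iff₀ (by positivity), pow_succ]; linarith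
  exact h (by rw [dyadic, h1, h2, sub_self])

/-- The bracket in place of |n| makes the lower bound valid for the block j = 0 as well, which
contains the zero frequency. -/
theorem IsBump.le_jap_of_lp_ne (hφ : IsBump φ) {j : ℕ} {n : Freq} (h : lp φ j n ≠ 0) :
    1 / 2 * 2 ^ j ≤ jap n := by
  cases j with
  | zero => simpa using (show (1 / 2 : ℝ) ≤ 1 by norm_num).trans (one_le_jap n)
  | succ j =>
    have := hφ.le_nrm_of_lp_ne h
    have h2 := nrm_le_jap n
    have hp := pow_pos (two_pos (α := ℝ)) (j + 1)
    linarith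

/-- A block is a difference of two consecutive low-pass filters, and the coefficients of g are ⟨l⟩^a
times those of a bounded function. -/
theorem IsBump.exists_mulBdd_lp (hφ : IsBump φ) {a ε : ℝ} (ha : 0 < a)
    (hε : 0 < ε) (haε : a + ε < 2) : ∃ C : ℝ, 0 ≤ C ∧ ∀ (k : ℕ) (g : Sob (-a) ∞),
      MulBdd (fun l => (lp φ k l : ℂ) * g.coeff l) (C * 2 ^ ((a + ε) * k) * ‖g‖) := by
  obtain ⟨C, hC, h⟩ := hφ.exists_mulBdd_rpow_lowpass ha hε haε
  refine ⟨C + C, by positivity, fun k g => ?_⟩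
  have hL : ∀ k : ℕ, MulBdd (fun l => (φ (nrm l / 2 ^ k) : ℂ) * g.coeff l)
      (C * 2 ^ ((a + ε) * k) * ‖g‖) := fun k => (h k _ _ (Sob.mulBdd g)).congr fun l => by
    rw [← mul_assoc ((jap l ^ a : ℝ) : ℂ), jap_rpow_mul_neg, one_mul]
  cases k with
  | zero =>
    refine FormBdd.congr (FormBdd.mono (hL 0) (C' := (C + C) * 2 ^ ((a + ε) * (0 : ℕ)) * ‖g‖) ?_)
      fun n m => by simp only [hφ.lp_eq, dyadic]; simp
    gcongr
    linarith
  | succ k =>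
    refine FormBdd.congr (FormBdd.mono (FormBdd.sub (hL (k + 1)) (hL k))
      (C' := (C + C) * 2 ^ ((a + ε) * (k + 1 : ℕ)) * ‖g‖) ?_)
      fun n m => by simp only [hφ.lp_eq, dyadic]; push_cast; ring
    have : (2 : ℝ) ^ ((a + ε) * k) ≤ 2 ^ ((a + ε) * (k + 1 : ℕ)) := by
      apply Real.rpow_le_rpow_of_exponent_le (by norm_num)
      push_cast
      nlinarith
    calc _ ≤ C * 2 ^ ((a + ε) * (k + 1 : ℕ)) * ‖g‖ + C * 2 ^ ((a + ε) * (k + 1 : ℕ)) * ‖g‖ := by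
          gcongr
      _ = _ := by ring

open Classical in
/-- The symbol of `blocks`. -/
def blockSym (φ : ℝ → ℝ) (r : ℕ → ℕ → Prop) (n m : Freq) : ℝ :=
  ∑' jk : ℕ × ℕ, if r jk.1 jk.2 then lp φ jk.1 m * lp φ jk.2 (n - m) else 0

theorem blocks_eq (φ : ℝ → ℝ) (r : ℕ → ℕ → Prop) (f g : Coef) :
    blocks φ r f g = fun n => ∑' m, (blockSym φ r n m : ℂ) * (f m * g (n - m)) := rfl

theorem IsBump.finite_lp_ne (hφ : IsBump φ) (m : Freq) : {j | lp φ j m ≠ 0}.Finite := by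
  obtain ⟨N, hN⟩ := pow_unbounded_of_one_lt (2 * jap m) (one_lt_two (α := ℝ))
  refine (Set.finite_lt_nat N).subset fun j hj => ?_
  have := hφ.le_jap_of_lp_ne hj
  by_contra hcon
  have h3 : (2 : ℝ) ^ N ≤ 2 ^ j := pow_le_pow_right₀ (by norm_num) (not_lt.1 hcon)
  linarith

open Classical in
theorem IsBump.hasSum_blockSym (hφ : IsBump φ) (r : ℕ → ℕ → Prop) (n m : Freq) :
    HasSum (fun jk : ℕ × ℕ => if r jk.1 jk.2 then lp φ jk.1 m * lp φ jk.2 (n - m) else 0)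
      (blockSym φ r n m) := by
  refine Summable.hasSum (summable_of_hasFiniteSupport ?_)
  refine ((hφ.finite_lp_ne m).prod (hφ.finite_lp_ne (n - m))).subset fun jk h => ?_
  rw [Function.mem_support] at h
  have h2 : lp φ jk.1 m * lp φ jk.2 (n - m) ≠ 0 := fun h0 => h (by simp [h0])
  exact ⟨left_ne_zero_of_mul h2, right_ne_zero_of_mul h2⟩

open Classical in
/-- Summing the bounds of all pairs of dyadic blocks. -/
theorem IsBump.exists_blocks (hφ : IsBump φ) {a ε b c K : ℝ} (ha : 0 < a) (hε : 0 < ε)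
    (haε : a + ε < 2) (r : ℕ → ℕ → Prop) (α γ : ℕ → ℕ → ℝ)
    (hα : ∀ j k, 0 ≤ α j k) (hγ : ∀ j k, 0 ≤ γ j k)
    (h1 : ∀ j k m l, r j k → lp φ j m ≠ 0 → lp φ k l ≠ 0 →
      jap m ^ (-b) ≤ α j k ∧ jap (m + l) ^ (-c) ≤ γ j k)
    (h2 : ∀ j k, r j k → 2 ^ ((a + ε) * k) * α j k * γ j k ≤
      K * ((2 ^ (-ε)) ^ j * (2 ^ (-ε)) ^ k)) :
    ∃ B : Sob b 2 →L[ℂ] Sob (-a) ∞ →L[ℂ] Sob (-c) 2, ∀ f g,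
      (∀ n, Summable fun m => (blockSym φ r n m : ℂ) * (f.coeff m * g.coeff (n - m))) ∧
      (B f g).coeff = blocks φ r f.coeff g.coeff := by
  obtain ⟨C, hC, hlp⟩ := hφ.exists_mulBdd_lp ha hε haε
  -- The factors 2^{-εj} and 2^{-εk} supplied by `h2` make the sum over all pairs of blocks
  -- converge.
  have hgeo : Summable fun j : ℕ => ((2 : ℝ) ^ (-ε)) ^ j :=
    summable_geometric_of_lt_one (by positivity)
      (Real.rpow_lt_one_of_one_lt_of_neg (by norm_num) (by linarith))
  have hsum : Summable fun jk : ℕ × ℕ => ((2 : ℝ) ^ (-ε)) ^ jk.1 * (2 ^ (-ε)) ^ jk.2 :=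
    hgeo.mul_of_nonneg hgeo (fun _ => by positivity) (fun _ => by positivity)
  set S := ∑' jk : ℕ × ℕ, ((2 : ℝ) ^ (-ε)) ^ jk.1 * (2 ^ (-ε)) ^ jk.2
  refine exists_bilinear (fun n m => (blockSym φ r n m : ℂ)) (C * |K| * S) fun g => ?_
  set k : ℕ × ℕ → Freq → Freq → ℂ := fun jk n m =>
    (((if r jk.1 jk.2 then lp φ jk.1 m * lp φ jk.2 (n - m) else 0 : ℝ) : ℂ)) * g.coeff (n - m) *
      ((jap m ^ (-b) : ℝ) : ℂ) * ((jap n ^ (-c) : ℝ) : ℂ)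
  have hk : ∀ jk, FormBdd (k jk) (C * |K| * ‖g‖ * ((2 ^ (-ε)) ^ jk.1 * (2 ^ (-ε)) ^ jk.2)) := by
    rintro ⟨j, i⟩
    by_cases hr : r j i
    -- The weight bounds α and γ are available only for frequencies in the supports of the blocks,
    -- whereas `FormBdd.mul` asks for bounds at every frequency. The weights are therefore cut off
    -- where the bounds fail; the kernel vanishes there.
    · have h5 := FormBdd.mul (hlp i g)
        (p := fun m => if jap m ^ (-b) ≤ α j i then
          (lp φ j m : ℂ) * ((jap m ^ (-b) : ℝ) : ℂ) else 0)
        (q := fun n => if jap n ^ (-c) ≤ γ j i then ((jap n ^ (-c) : ℝ) : ℂ) else 0)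
        (hα j i) (hγ j i) (fun m => by
          split_ifs with h
          · rw [norm_mul, norm_jap_rpow, Complex.norm_real, Real.norm_eq_abs]
            calc _ ≤ 1 * α j i := by
                  gcongr
                  · exact Real.rpow_nonneg (jap_pos m).le _
                  · exact hφ.abs_lp_le j m
              _ = _ := one_mul _
          · simpa using hα j i) (fun n => by
          split_ifs with h
          · rwa [norm_jap_rpow]
          · simpa using hγ j i)
      refine FormBdd.congr (h5.mono ?_) fun n m => ?_
      · calc _ = C * ‖g‖ * (2 ^ ((a + ε) * i) * α j i * γ j i) := by ring
          _ ≤ C * ‖g‖ * (K * ((2 ^ (-ε)) ^ j * (2 ^ (-ε)) ^ i)) := by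
              gcongr ?_ * ?_
              exact h2 j i hr
          _ ≤ C * ‖g‖ * (|K| * ((2 ^ (-ε)) ^ j * (2 ^ (-ε)) ^ i)) := by
              gcongr
              exact le_abs_self K
          _ = _ := by ring
      · simp only [k, if_pos hr]
        by_cases hm : lp φ j m = 0
        · simp [hm]
        by_cases hl : lp φ i (n - m) = 0
        · simp [hl]
        have h6 := h1 j i m (n - m) hr hm hl
        rw [add_sub_cancel] at h6
        rw [if_pos h6.1, if_pos h6.2]
        push_cast; ring
    · intro s f h
      simp only [k, if_neg hr]
      simp only [Complex.ofReal_zero, zero_mul, Finset.sum_const_zero, norm_zero]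
      positivity
  have h7 := FormBdd.hasSum hk (hsum.mul_left _) (K := fun n m => (blockSym φ r n m : ℂ) *
    g.coeff (n - m) * ((jap m ^ (-b) : ℝ) : ℂ) * ((jap n ^ (-c) : ℝ) : ℂ)) fun n m =>
      (((Complex.hasSum_ofReal.2 (hφ.hasSum_blockSym r n m)).mul_right _).mul_right _).mul_right _
  rw [tsum_mul_left] at h7
  exact h7.mono (le_of_eq (by ring))

end LittlewoodPaley

/-! ### Paraproduct estimates -/

section paraproducts

variable {φ : ℝ → ℝ}

theorem two_rpow_neg_pow (x : ℝ) (j : ℕ) : ((2 : ℝ) ^ (-x)) ^ j = 2 ^ (-(x * j)) := by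
  rw [← Real.rpow_natCast, ← Real.rpow_mul (by norm_num)]; ring_nf

theorem jap_rpow_neg_le {n : Freq} {j i : ℕ} {c : ℝ} (hc : 0 ≤ c) (h : 2 ^ j ≤ 2 ^ i * jap n) :
    jap n ^ (-c) ≤ 2 ^ (i * c - c * j) := by
  have hj := jap_pos n
  have h1 : (2 : ℝ) ^ ((j : ℝ) - i) ≤ jap n := by
    rw [Real.rpow_sub (by norm_num), Real.rpow_natCast, Real.rpow_natCast,
      div_le_iff₀ (by positivity)]
    linarith
  calc jap n ^ (-c) ≤ ((2 : ℝ) ^ ((j : ℝ) - i)) ^ (-c) :=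
        Real.rpow_le_rpow_of_nonpos (by positivity) h1 (by linarith)
    _ = 2 ^ (i * c - c * j) := by
        rw [← Real.rpow_mul (by norm_num)]; ring_nf

theorem jap_rpow_neg_le_one (n : Freq) {b : ℝ} (hb : 0 ≤ b) : jap n ^ (-b) ≤ 1 :=
  Real.rpow_le_one_of_one_le_of_nonpos (one_le_jap n) (by linarith)

theorem nrm_add_ge (m l : Freq) : nrm l - nrm m ≤ nrm (m + l) := by
  have h : vec (m + l) = vec l + vec m := by ext i; simp [vec, add_comm]
  rw [← norm_vec, ← norm_vec, ← norm_vec, h]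
  have := norm_sub_norm_le (vec l) (-vec m)
  rwa [norm_neg, sub_neg_eq_add] at this

/-- Here |m| ≤ (8/5) 2^j ≤ 2^k/5 because j ≤ k - 3, and |l| ≥ (5/8) 2^k, so |m + l| exceeds 2^k/4:
the output of a paraproduct lives at the high frequency. -/
theorem IsBump.le_jap_add (hφ : IsBump φ) {j k : ℕ} {m l : Freq} (h : j + 2 < k)
    (hm : lp φ j m ≠ 0) (hl : lp φ k l ≠ 0) : 2 ^ k ≤ 2 ^ 2 * jap (m + l) := by
  obtain ⟨i, rfl⟩ := Nat.exists_eq_add_of_lt h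
  have h1 := hφ.nrm_le_of_lp_ne hm
  have h2 := hφ.le_nrm_of_lp_ne hl
  have h3 := nrm_add_ge m l
  have h4 := nrm_le_jap (m + l)
  have h5 : (2 : ℝ) ^ (j + 2 + i + 1) = 8 * 2 ^ j * 2 ^ i := by ring
  have h6 : (1 : ℝ) ≤ 2 ^ i := one_le_pow₀ (by norm_num)
  have h7 : (2 : ℝ) ^ j ≤ 2 ^ j * 2 ^ i := le_mul_of_one_le_right (by positivity) h6
  have h8 : (0 : ℝ) ≤ 2 ^ j * 2 ^ i := by positivity
  rw [h5] at h2 ⊢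
  linarith

variable {a ε b c : ℝ}

/-- The constraint j ≥ θk + c₀ turns the decay 2^{-bj} of the low-frequency factor into 2^{-bθk}, a
gain of bθ derivatives at the output frequency 2^k. Of the 3ε, one pays for the block bound and two
for the summation over j and k. -/
theorem IsBump.exists_paraLow₁ (hφ : IsBump φ) (ha : 0 < a) (hε : 0 < ε) (haε : a + ε < 2)
    (θ c₀ : ℝ) (hb : 0 ≤ b) (hc : 0 ≤ c) (h : a + 3 * ε ≤ c + b * θ) :
    ∃ B : Sob b 2 →L[ℂ] Sob (-a) ∞ →L[ℂ] Sob (-c) 2, ∀ f g,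
      (B f g).coeff = paraLow₁ φ θ c₀ f.coeff g.coeff := by
  obtain ⟨B, hB⟩ := hφ.exists_blocks (b := b) (c := c) (K := 2 ^ (b + 2 * c - b * c₀)) ha hε haε
    (fun j k => θ * k + c₀ ≤ j ∧ j + 2 < k)
    (fun j _ => 2 ^ (1 * b - b * j)) (fun _ k => 2 ^ (2 * c - c * k))
    (fun _ _ => by positivity) (fun _ _ => by positivity)
    (fun j k m l hr hm hl => ⟨by
      have := hφ.le_jap_of_lp_ne hm
      simpa using jap_rpow_neg_le (i := 1) hb (by linarith), by
      simpa using jap_rpow_neg_le hc (hφ.le_jap_add hr.2 hm hl)⟩)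
    (fun j k hr => by
      rw [two_rpow_neg_pow, two_rpow_neg_pow, ← Real.rpow_add (by norm_num),
        ← Real.rpow_add (by norm_num), ← Real.rpow_add (by norm_num),
        ← Real.rpow_add (by norm_num)]
      refine Real.rpow_le_rpow_of_exponent_le (by norm_num) ?_
      have h1 : (j : ℝ) ≤ k := by exact_mod_cast (by omega : j ≤ k)
      have hk : (0 : ℝ) ≤ k := Nat.cast_nonneg k
      nlinarith [mul_le_mul_of_nonneg_left hr.1 hb, mul_le_mul_of_nonneg_right h hk,
        mul_le_mul_of_nonneg_left h1 hε.le])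
  exact ⟨B, fun f g => (hB f g).2⟩

/-- The output frequency is of size 2^k, so the weight ⟨n⟩^{-c} alone pays for the roughness of g.
-/
theorem IsBump.exists_paraLow (hφ : IsBump φ) (ha : 0 < a) (hε : 0 < ε) (haε : a + ε < 2)
    (hb : 0 ≤ b) (hc : 0 ≤ c) (h : a + 3 * ε ≤ c) :
    ∃ B : Sob b 2 →L[ℂ] Sob (-a) ∞ →L[ℂ] Sob (-c) 2, ∀ f g,
      (∀ n, Summable fun m => (blockSym φ (fun j k => j + 2 < k) n m : ℂ) *
        (f.coeff m * g.coeff (n - m))) ∧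
      (B f g).coeff = paraLow φ f.coeff g.coeff := by
  refine hφ.exists_blocks (K := 2 ^ (2 * c)) ha hε haε
    (fun j k => j + 2 < k)
    (fun _ _ => 1) (fun _ k => 2 ^ (2 * c - c * k))
    (fun _ _ => by positivity) (fun _ _ => by positivity)
    (fun j k m l hr hm hl => ⟨jap_rpow_neg_le_one m hb, by
      simpa using jap_rpow_neg_le hc (hφ.le_jap_add hr hm hl)⟩)
    (fun j k hr => ?_)
  rw [two_rpow_neg_pow, two_rpow_neg_pow, ← Real.rpow_add (by norm_num), mul_one,
    ← Real.rpow_add (by norm_num), ← Real.rpow_add (by norm_num)]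
  refine Real.rpow_le_rpow_of_exponent_le (by norm_num) ?_
  have h1 : (j : ℝ) ≤ k := by exact_mod_cast (by omega : j ≤ k)
  have hk : (0 : ℝ) ≤ k := Nat.cast_nonneg k
  nlinarith [mul_le_mul_of_nonneg_right h hk, mul_le_mul_of_nonneg_left h1 hε.le]

/-- Both f and the output live at frequency 2^j, so their regularities b and c together pay for g.
-/
theorem IsBump.exists_paraHigh (hφ : IsBump φ) (ha : 0 < a) (hε : 0 < ε) (haε : a + ε < 2)
    (hb : 0 ≤ b) (hc : 0 ≤ c) (h : a + 3 * ε ≤ b + c) :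
    ∃ B : Sob b 2 →L[ℂ] Sob (-a) ∞ →L[ℂ] Sob (-c) 2, ∀ f g,
      (∀ n, Summable fun m => (blockSym φ (fun j k => k + 2 < j) n m : ℂ) *
        (f.coeff m * g.coeff (n - m))) ∧
      (B f g).coeff = paraHigh φ f.coeff g.coeff := by
  refine hφ.exists_blocks (K := 2 ^ (b + 2 * c)) ha hε haε
    (fun j k => k + 2 < j)
    (fun j _ => 2 ^ (1 * b - b * j)) (fun j _ => 2 ^ (2 * c - c * j))
    (fun _ _ => by positivity) (fun _ _ => by positivity)
    (fun j k m l hr hm hl => ⟨by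
      have := hφ.le_jap_of_lp_ne hm
      simpa using jap_rpow_neg_le (i := 1) hb (by linarith), by
      have := hφ.le_jap_add hr hl hm
      rw [add_comm l m] at this
      simpa using jap_rpow_neg_le hc this⟩)
    (fun j k hr => ?_)
  rw [two_rpow_neg_pow, two_rpow_neg_pow, ← Real.rpow_add (by norm_num),
    ← Real.rpow_add (by norm_num), ← Real.rpow_add (by norm_num), ← Real.rpow_add (by norm_num)]
  refine Real.rpow_le_rpow_of_exponent_le (by norm_num) ?_
  have h1 : (k : ℝ) ≤ j := by exact_mod_cast (by omega : k ≤ j)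
  have hk : (0 : ℝ) ≤ j := Nat.cast_nonneg j
  nlinarith [mul_le_mul_of_nonneg_right h hk, mul_le_mul_of_nonneg_left h1 hε.le,
    mul_le_mul_of_nonneg_left h1 ha.le]

/-- The output may sit at frequency O(1), hence the negative output regularity does not help: f
alone must compensate g. The constant K accounts for k ≤ j + 2. -/
theorem IsBump.exists_reson (hφ : IsBump φ) (ha : 0 < a) (hε : 0 < ε) (haε : a + ε < 2)
    (hc : 0 ≤ c) (h : a + 3 * ε ≤ b) :
    ∃ B : Sob b 2 →L[ℂ] Sob (-a) ∞ →L[ℂ] Sob (-c) 2, ∀ f g,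
      (∀ n, Summable fun m => (blockSym φ (fun j k => j ≤ k + 2 ∧ k ≤ j + 2) n m : ℂ) *
        (f.coeff m * g.coeff (n - m))) ∧
      (B f g).coeff = reson φ f.coeff g.coeff := by
  have hb : 0 ≤ b := by linarith
  refine hφ.exists_blocks (K := 2 ^ (b + 2 * (a + 2 * ε))) ha hε haε
    (fun j k => j ≤ k + 2 ∧ k ≤ j + 2)
    (fun j _ => 2 ^ (1 * b - b * j)) (fun _ _ => 1)
    (fun _ _ => by positivity) (fun _ _ => by positivity)
    (fun j k m l hr hm hl => ⟨by
      have := hφ.le_jap_of_lp_ne hm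
      simpa using jap_rpow_neg_le (i := 1) hb (by linarith), jap_rpow_neg_le_one _ hc⟩)
    (fun j k hr => ?_)
  rw [two_rpow_neg_pow, two_rpow_neg_pow, ← Real.rpow_add (by norm_num), mul_one,
    ← Real.rpow_add (by norm_num), ← Real.rpow_add (by norm_num)]
  refine Real.rpow_le_rpow_of_exponent_le (by norm_num) ?_
  have h1 : (k : ℝ) ≤ j + 2 := by exact_mod_cast hr.2
  have hk : (0 : ℝ) ≤ j := Nat.cast_nonneg j
  nlinarith [mul_le_mul_of_nonneg_right h hk, mul_le_mul_of_nonneg_left h1 hε.le,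
    mul_le_mul_of_nonneg_left h1 ha.le]

theorem IsBump.hasSum_blockSym_add (hφ : IsBump φ) (n m : Freq) :
    blockSym φ (fun j k => j + 2 < k) n m + blockSym φ (fun j k => j ≤ k + 2 ∧ k ≤ j + 2) n m +
      blockSym φ (fun j k => k + 2 < j) n m = 1 := by
  classical
  have h := ((hφ.hasSum_blockSym (fun j k => j + 2 < k) n m).add
    (hφ.hasSum_blockSym (fun j k => j ≤ k + 2 ∧ k ≤ j + 2) n m)).add
    (hφ.hasSum_blockSym (fun j k => k + 2 < j) n m)
  have hlp : ∀ l, HasSum (fun j => lp φ j l) 1 := fun l => by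
    simp only [hφ.lp_eq]; exact hφ.hasSum_dyadic l
  have h1 : HasSum (fun jk : ℕ × ℕ => lp φ jk.1 m * lp φ jk.2 (n - m)) (1 * 1) := by
    refine (hlp m).mul (hlp (n - m)) ?_
    refine summable_of_hasFiniteSupport ?_
    refine ((hφ.finite_lp_ne m).prod (hφ.finite_lp_ne (n - m))).subset fun jk h => ?_
    rw [Function.mem_support] at h
    exact ⟨left_ne_zero_of_mul h, right_ne_zero_of_mul h⟩
  rw [mul_one] at h1
  refine h.unique (h1.congr_fun fun jk => ?_)
  by_cases h1 : jk.1 + 2 < jk.2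
  · rw [if_pos h1, if_neg (by omega), if_neg (by omega)]; ring
  · by_cases h2 : jk.2 + 2 < jk.1
    · rw [if_neg h1, if_neg (by omega), if_pos h2]; ring
    · rw [if_neg h1, if_pos (by omega), if_neg h2]; ring

/-- Bony's decomposition: the three block symbols add up to 1, and each of the three sums converges
absolutely, so they may be merged into the full product. -/
theorem IsBump.exists_convΨ (hφ : IsBump φ) (ha : 0 < a) (hε : 0 < ε) (haε : a + ε < 2)
    (h : a + 3 * ε ≤ b) (h' : a + 3 * ε ≤ c) :
    ∃ B : Sob b 2 →L[ℂ] Sob (-a) ∞ →L[ℂ] Sob (-c) 2, ∀ f g,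
      (B f g).coeff = conv f.coeff g.coeff := by
  obtain ⟨B₁, h₁⟩ := hφ.exists_paraLow (b := b) ha hε haε (by linarith) (by linarith) h'
  obtain ⟨B₂, h₂⟩ := hφ.exists_reson (b := b) (c := c) ha hε haε (by linarith) h
  obtain ⟨B₃, h₃⟩ := hφ.exists_paraHigh (b := b) (c := c) ha hε haε (by linarith) (by linarith)
    (by linarith)
  refine ⟨B₁ + B₂ + B₃, fun f g => ?_⟩
  change (B₁ f g + B₂ f g + B₃ f g).coeff = _
  rw [Sob.coeff_add, Sob.coeff_add, (h₁ f g).2, (h₂ f g).2, (h₃ f g).2]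
  ext n
  simp only [paraLow, reson, paraHigh, blocks_eq, Pi.add_apply, conv]
  rw [← ((h₁ f g).1 n).tsum_add ((h₂ f g).1 n),
    ← (((h₁ f g).1 n).add ((h₂ f g).1 n)).tsum_add ((h₃ f g).1 n)]
  refine tsum_congr fun m => ?_
  have := hφ.hasSum_blockSym_add n m
  rw [← add_mul, ← add_mul, ← Complex.ofReal_add, ← Complex.ofReal_add, this, Complex.ofReal_one,
    one_mul]

end paraproducts

/-! ### Products of Sobolev functions -/

/-- Since ⟨n⟩² dominates each 1 + n_i², the weight ⟨n⟩^{-2s} is at most the product over the three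
coordinates of (1 + n_i²)^{-s/3}, and each one-dimensional sum converges because 2s/3 > 1. -/
theorem summable_jap_rpow {s : ℝ} (hs : 3 / 2 < s) : Summable fun n : Freq => (jap n ^ (-s)) ^ 2 := by
  have hb : 1 < 2 * s / 3 := by linarith
  -- At k = 0 the first term is 0 (`0` to a nonzero power); the shifted term equals 1 there and
  -- supplies the bound.
  set f : ℤ → ℝ := fun k => |(k : ℝ)| ^ (-(2 * s / 3)) + |((k + 1 : ℤ) : ℝ)| ^ (-(2 * s / 3))
  have hf : Summable f := (Real.summable_abs_int_rpow hb).add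
    ((Real.summable_abs_int_rpow hb).comp_injective (add_left_injective (1 : ℤ)))
  have hf0 : ∀ k, 0 ≤ f k := fun k => by positivity
  have h1 : ∀ k : ℤ, (1 + (k : ℝ) ^ 2) ^ (-(s / 3)) ≤ f k := by
    intro k
    by_cases hk : k = 0
    · subst hk; simp [f]; positivity
    · have hk' : (k : ℝ) ≠ 0 := by exact_mod_cast hk
      calc (1 + (k : ℝ) ^ 2) ^ (-(s / 3)) ≤ ((k : ℝ) ^ 2) ^ (-(s / 3)) :=
            Real.rpow_le_rpow_of_nonpos (by positivity) (by linarith) (by linarith)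
        _ = |(k : ℝ)| ^ (-(2 * s / 3)) := by
            rw [← sq_abs, ← Real.rpow_natCast, ← Real.rpow_mul (abs_nonneg _)]
            congr 1; push_cast; ring
        _ ≤ f k := le_add_of_nonneg_right (by positivity)
  have h2 : Summable fun x : ℤ × ℤ × ℤ => f x.1 * (f x.2.1 * f x.2.2) :=
    hf.mul_of_nonneg (hf.mul_of_nonneg hf hf0 hf0) hf0
      (fun x => mul_nonneg (hf0 _) (hf0 _))
  have hinj : Function.Injective fun n : Freq => (n 0, n 1, n 2) := by
    intro n m h
    simp only [Prod.mk.injEq] at h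
    ext i
    fin_cases i
    · exact h.1
    · exact h.2.1
    · exact h.2.2
  refine Summable.of_nonneg_of_le (fun n => sq_nonneg _) (fun n => ?_) (h2.comp_injective hinj)
  have hj := jap_pos n
  have hsq : ∀ i, 1 + (n i : ℝ) ^ 2 ≤ jap n ^ 2 := by
    intro i
    rw [jap_sq, nrm, Real.sq_sqrt (Finset.sum_nonneg fun _ _ => sq_nonneg _)]
    gcongr
    exact Finset.single_le_sum (f := fun i => (n i : ℝ) ^ 2) (fun _ _ => sq_nonneg _)
      (Finset.mem_univ i)
  have h3 : ∀ i, (jap n ^ 2) ^ (-(s / 3)) ≤ f (n i) := fun i =>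
    (Real.rpow_le_rpow_of_nonpos (by positivity) (hsq i) (by linarith)).trans (h1 _)
  calc (jap n ^ (-s)) ^ 2 = (jap n ^ 2) ^ (-(s / 3)) * ((jap n ^ 2) ^ (-(s / 3)) *
        (jap n ^ 2) ^ (-(s / 3))) := by
        rw [← Real.rpow_add (by positivity), ← Real.rpow_add (by positivity),
          ← Real.rpow_natCast, ← Real.rpow_mul hj.le, ← Real.rpow_natCast, ← Real.rpow_mul hj.le]
        congr 1; push_cast; ring
    _ ≤ _ := by
        simp only [Function.comp]
        gcongr <;> exact h3 _

theorem sum_mul_shift_le (g : SqSum) (s : Finset Freq) (H : Freq → ℝ) (e : Freq ≃ Freq) :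
    ∑ n ∈ s, ‖g (e n)‖ * H n ≤ ‖g‖ * √(∑ n ∈ s, H n ^ 2) := by
  refine (Real.sum_mul_le_sqrt_mul_sqrt s _ _).trans ?_
  gcongr
  rw [← Real.sqrt_sq (norm_nonneg g)]
  refine Real.sqrt_le_sqrt ?_
  have := g.sum_sq_le (s.map e.toEmbedding)
  rwa [Finset.sum_map] at this

/-- Whichever of the three frequencies carries the weight, that factor times its ℓ² companion is in
ℓ¹ by Cauchy–Schwarz, and Young's inequality ℓ¹ ∗ ℓ² ⊂ ℓ² handles the rest. -/
theorem formBdd_conv {w : Freq → ℝ} (hw : ∀ n, 0 ≤ w n) (hs : Summable fun n => w n ^ 2)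
    (g : SqSum) {K : Freq → Freq → ℂ}
    (hK : ∀ n m, ‖K n m‖ ≤ (w m + w (n - m) + w n) * ‖g (n - m)‖) :
    FormBdd K (3 * √(∑' n, w n ^ 2) * ‖g‖) := by
  intro s f h
  set A := √(∑' n, w n ^ 2)
  set F := √(∑ m ∈ s, ‖f m‖ ^ 2)
  set H := √(∑ n ∈ s, ‖h n‖ ^ 2)
  have hwA : ∀ t : Finset Freq, √(∑ m ∈ t, w m ^ 2) ≤ A := fun t =>
    Real.sqrt_le_sqrt (hs.sum_le_tsum t fun _ _ => sq_nonneg _)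
  have hwF : ∀ u : Coef, ∑ m ∈ s, w m * ‖u m‖ ≤ A * √(∑ m ∈ s, ‖u m‖ ^ 2) := fun u =>
    (Real.sum_mul_le_sqrt_mul_sqrt s _ _).trans (by gcongr; exact hwA s)
  have hsh : ∀ e : Freq ≃ Freq, ∑ n ∈ s, w (e n) * ‖g (e n)‖ ≤ A * ‖g‖ := by
    intro e
    refine (Real.sum_mul_le_sqrt_mul_sqrt s _ _).trans ?_
    gcongr
    · have := hwA (s.map e.toEmbedding)
      rwa [Finset.sum_map] at this
    · rw [← Real.sqrt_sq (norm_nonneg g)]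
      refine Real.sqrt_le_sqrt ?_
      have := g.sum_sq_le (s.map e.toEmbedding)
      rwa [Finset.sum_map] at this
  have t1 : ∑ n ∈ s, ∑ m ∈ s, w m * ‖g (n - m)‖ * ‖f m‖ * ‖h n‖ ≤ A * ‖g‖ * F * H := by
    rw [Finset.sum_comm]
    calc _ = ∑ m ∈ s, w m * ‖f m‖ * ∑ n ∈ s, ‖g (Equiv.subRight m n)‖ * ‖h n‖ := by
          refine Finset.sum_congr rfl fun m _ => ?_
          rw [Finset.mul_sum]
          exact Finset.sum_congr rfl fun n _ => by rw [Equiv.subRight_apply]; ring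
      _ ≤ ∑ m ∈ s, w m * ‖f m‖ * (‖g‖ * H) := by
          refine Finset.sum_le_sum fun m _ => ?_
          have := hw m
          gcongr
          exact sum_mul_shift_le g s _ _
      _ ≤ A * F * (‖g‖ * H) := by
          rw [← Finset.sum_mul]
          gcongr
          exact hwF f
      _ = _ := by ring
  have t3 : ∑ n ∈ s, ∑ m ∈ s, w n * ‖g (n - m)‖ * ‖f m‖ * ‖h n‖ ≤ A * ‖g‖ * F * H := by
    calc _ = ∑ n ∈ s, w n * ‖h n‖ * ∑ m ∈ s, ‖g (Equiv.subLeft n m)‖ * ‖f m‖ := by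
          refine Finset.sum_congr rfl fun n _ => ?_
          rw [Finset.mul_sum]
          exact Finset.sum_congr rfl fun m _ => by rw [Equiv.subLeft_apply]; ring
      _ ≤ ∑ n ∈ s, w n * ‖h n‖ * (‖g‖ * F) := by
          refine Finset.sum_le_sum fun n _ => ?_
          have := hw n
          gcongr
          exact sum_mul_shift_le g s _ _
      _ ≤ A * H * (‖g‖ * F) := by
          rw [← Finset.sum_mul]
          gcongr
          exact hwF h
      _ = _ := by ring
  -- The weight sits on the kernel: w g is in ℓ¹, and the square root of the kernel is shared
  -- between f and h, as in Schur's test.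
  have t2 : ∑ n ∈ s, ∑ m ∈ s, w (n - m) * ‖g (n - m)‖ * ‖f m‖ * ‖h n‖ ≤ A * ‖g‖ * F * H := by
    have hk0 : ∀ l, 0 ≤ w l * ‖g l‖ := fun l => mul_nonneg (hw l) (norm_nonneg _)
    rw [← Finset.sum_product']
    calc _ = ∑ x ∈ s ×ˢ s, (√(w (x.1 - x.2) * ‖g (x.1 - x.2)‖) * ‖f x.2‖) *
          (√(w (x.1 - x.2) * ‖g (x.1 - x.2)‖) * ‖h x.1‖) := by
          refine Finset.sum_congr rfl fun x _ => ?_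
          linear_combination (-‖f x.2‖ * ‖h x.1‖) * Real.mul_self_sqrt (hk0 (x.1 - x.2))
      _ ≤ _ := Real.sum_mul_le_sqrt_mul_sqrt _ _ _
      _ ≤ √(A * ‖g‖ * ∑ m ∈ s, ‖f m‖ ^ 2) * √(A * ‖g‖ * ∑ n ∈ s, ‖h n‖ ^ 2) := by
          simp only [mul_pow, Real.sq_sqrt (hk0 _)]
          gcongr
          · rw [Finset.sum_product, Finset.sum_comm, Finset.mul_sum]
            refine Finset.sum_le_sum fun m _ => ?_
            dsimp only
            rw [← Finset.sum_mul]
            gcongr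
            exact hsh (Equiv.subRight m)
          · rw [Finset.sum_product, Finset.mul_sum]
            refine Finset.sum_le_sum fun n _ => ?_
            dsimp only
            rw [← Finset.sum_mul]
            gcongr
            exact hsh (Equiv.subLeft n)
      _ = A * ‖g‖ * F * H := by
          have hA : 0 ≤ A * ‖g‖ := by positivity
          rw [Real.sqrt_mul hA, Real.sqrt_mul hA]
          linear_combination F * H * Real.mul_self_sqrt hA
  calc _ ≤ ∑ n ∈ s, ∑ m ∈ s, (w m * ‖g (n - m)‖ * ‖f m‖ * ‖h n‖ +
        w (n - m) * ‖g (n - m)‖ * ‖f m‖ * ‖h n‖ + w n * ‖g (n - m)‖ * ‖f m‖ * ‖h n‖) := by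
        refine (norm_sum_le _ _).trans (Finset.sum_le_sum fun n _ => ?_)
        refine (norm_sum_le _ _).trans (Finset.sum_le_sum fun m _ => ?_)
        rw [norm_mul, norm_mul]
        calc _ ≤ (w m + w (n - m) + w n) * ‖g (n - m)‖ * ‖f m‖ * ‖h n‖ := by
              gcongr; exact hK n m
          _ = _ := by ring
    _ ≤ A * ‖g‖ * F * H + A * ‖g‖ * F * H + A * ‖g‖ * F * H := by
        simp only [Finset.sum_add_distrib]
        gcongr
    _ = _ := by ring

/-- Negative powers decrease, so the product is at most the total power of the smallest of the three
numbers, which is one of the summands on the right. -/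
theorem rpow_neg_mul_le {x y z a b c : ℝ} (hx : 1 ≤ x) (hy : 1 ≤ y) (hz : 1 ≤ z) (ha : 0 ≤ a)
    (hb : 0 ≤ b) (hc : 0 ≤ c) : x ^ (-a) * y ^ (-b) * z ^ (-c) ≤
      x ^ (-(a + b + c)) + y ^ (-(a + b + c)) + z ^ (-(a + b + c)) := by
  obtain ⟨w, hw1, hwx, hwy, hwz, hw⟩ : ∃ w, 1 ≤ w ∧ w ≤ x ∧ w ≤ y ∧ w ≤ z ∧
      (w = x ∨ w = y ∨ w = z) := by
    rcases le_total x y with h1 | h1 <;> rcases le_total y z with h2 | h2 <;>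
      rcases le_total x z with h3 | h3
    · exact ⟨x, hx, le_rfl, h1, h3, .inl rfl⟩
    · exact ⟨x, hx, le_rfl, h1, h1.trans h2, .inl rfl⟩
    · exact ⟨x, hx, le_rfl, h1, h3, .inl rfl⟩
    · exact ⟨z, hz, h3, h2, le_rfl, .inr (.inr rfl)⟩
    · exact ⟨y, hy, h1, le_rfl, h2, .inr (.inl rfl)⟩
    · exact ⟨y, hy, h1, le_rfl, h2, .inr (.inl rfl)⟩
    · exact ⟨z, hz, h2.trans h1, h2, le_rfl, .inr (.inr rfl)⟩
    · exact ⟨z, hz, h3, h2, le_rfl, .inr (.inr rfl)⟩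
  have hw0 : 0 < w := by linarith
  have h1 : x ^ (-a) * y ^ (-b) * z ^ (-c) ≤ w ^ (-(a + b + c)) := by
    rw [show -(a + b + c) = -a + -b + -c by ring, Real.rpow_add hw0, Real.rpow_add hw0]
    gcongr ?_ * ?_ * ?_
    · exact Real.rpow_le_rpow_of_nonpos hw0 hwx (by linarith)
    · exact Real.rpow_le_rpow_of_nonpos hw0 hwy (by linarith)
    · exact Real.rpow_le_rpow_of_nonpos hw0 hwz (by linarith)
  have hpx : 0 ≤ x ^ (-(a + b + c)) := Real.rpow_nonneg (by linarith) _
  have hpy : 0 ≤ y ^ (-(a + b + c)) := Real.rpow_nonneg (by linarith) _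
  have hpz : 0 ≤ z ^ (-(a + b + c)) := Real.rpow_nonneg (by linarith) _
  rcases hw with rfl | rfl | rfl <;> linarith

/-- `H^b · H^a ⊆ H^{-c}` for `a, b, c ≥ 0` with `a + b + c > 3/2`. -/
theorem exists_conv {a b c : ℝ} (ha : 0 ≤ a) (hb : 0 ≤ b) (hc : 0 ≤ c) (h : 3 / 2 < b + a + c) :
    ∃ B : Sob b 2 →L[ℂ] Sob a 2 →L[ℂ] Sob (-c) 2, ∀ f g,
      (B f g).coeff = conv f.coeff g.coeff := by
  obtain ⟨B, hB⟩ := exists_bilinear (p := 2) (a := a) (b := b) (c := -c) (fun _ _ => 1)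
    (3 * √(∑' n, (jap n ^ (-(b + a + c))) ^ 2)) fun g => by
      have := formBdd_conv (w := fun n => jap n ^ (-(b + a + c)))
        (fun n => Real.rpow_nonneg (jap_pos n).le _) (summable_jap_rpow h) (Sob.repr a g)
        (K := fun n m => 1 * g.coeff (n - m) * ((jap m ^ (-b) : ℝ) : ℂ) *
          ((jap n ^ (-c) : ℝ) : ℂ)) fun n m => by
          rw [one_mul, Sob.coeff_eq_repr, norm_mul, norm_mul, norm_mul, norm_jap_rpow,
            norm_jap_rpow, norm_jap_rpow]
          calc _ = (jap m ^ (-b) * jap (n - m) ^ (-a) * jap n ^ (-c)) *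
                ‖Sob.repr a g (n - m)‖ := by ring
            _ ≤ _ := by
                gcongr
                exact rpow_neg_mul_le (one_le_jap _) (one_le_jap _) (one_le_jap _) hb ha hc
      rwa [(Sob.repr a).norm_map] at this
  refine ⟨B, fun f g => ?_⟩
  rw [(hB f g).2]
  ext n
  simp only [one_mul, conv]

theorem conv_comm (f g : Coef) : conv f g = conv g f := by
  ext n
  rw [conv, ← (Equiv.subLeft n).tsum_eq]
  simp only [Equiv.subLeft_apply, sub_sub_cancel, conv, mul_comm]

/-- Multiplication by a Bessel potential of an element of `W^{a,∞}`. -/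
theorem exists_conv_bessel {a b c β : ℝ} (h : 0 < β + a) (hb : 0 ≤ b) (hc : 0 ≤ c) :
    ∃ B : Sob b 2 →L[ℂ] Sob a ∞ →L[ℂ] Sob (-c) 2, ∀ f g,
      (B f g).coeff = conv f.coeff (bessel β g.coeff) := by
  obtain ⟨C, hC, hmul⟩ := exists_mulBdd_jap_neg h
  obtain ⟨B, hB⟩ := exists_bilinear (p := ∞) (a := a) (b := b) (c := -c)
    (fun n m => ((jap (n - m) ^ (-β) : ℝ) : ℂ)) C fun g => by
      have h1 := FormBdd.mul (hmul _ _ (Sob.mulBdd g)) (p := fun m => ((jap m ^ (-b) : ℝ) : ℂ))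
        (q := fun n => ((jap n ^ (-c) : ℝ) : ℂ)) zero_le_one zero_le_one
        (fun m => by rw [norm_jap_rpow]; exact jap_rpow_neg_le_one m hb)
        (fun n => by rw [norm_jap_rpow]; exact jap_rpow_neg_le_one n hc)
      rw [mul_one, mul_one] at h1
      refine h1.congr fun n m => ?_
      beta_reduce
      rw [← mul_assoc, ← jap_rpow_add, show -(β + a) + a = -β by ring]
  refine ⟨B, fun f g => ?_⟩
  rw [(hB f g).2]
  ext n
  simp only [conv, bessel]
  exact tsum_congr fun m => by ring

/-- The inclusion of `L^∞` in L² is multiplication of the constant function 1, whose only nonzero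
coefficient is at frequency 0. -/
theorem exists_embed (a : ℝ) : ∃ M : Sob a ∞ →L[ℂ] Sob a 2, ∀ g, (M g).coeff = g.coeff := by
  classical
  obtain ⟨B, hB⟩ := exists_bilinear (p := ∞) (a := a) (b := 0) (c := a)
    (fun _ m => if m = 0 then 1 else 0) 1 fun g => by
      have h1 := FormBdd.mul (Sob.mulBdd g) (p := fun m => if m = 0 then 1 else 0)
        (q := fun _ => 1) zero_le_one zero_le_one
        (fun m => by split_ifs <;> simp) (fun n => by simp)
      rw [mul_one, mul_one, ← one_mul ‖g‖] at h1
      refine h1.congr fun n m => ?_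
      by_cases hm : m = 0
      · simp [hm, mul_comm]
      · simp [hm]
  obtain ⟨v, hv, -⟩ := SqSum.exists_of_sum_le (fun m : Freq => if m = 0 then (1 : ℂ) else 0)
    zero_le_one (fun s => by
      have : ∀ m : Freq, ‖(if m = 0 then (1 : ℂ) else 0)‖ ^ 2 = if m = 0 then (1 : ℝ) else 0 :=
        fun m => by split_ifs <;> simp
      simp only [this, Finset.sum_ite_eq']
      split_ifs <;> simp)
  obtain ⟨f, hf, -⟩ := Sob.exists_of_repr (s := 0) (fun m : Freq => if m = 0 then (1 : ℂ) else 0) v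
    (fun n => by rw [hv]; simp)
  refine ⟨B f, fun g => ?_⟩
  rw [(hB f g).2, hf]
  ext n
  rw [tsum_eq_single 0 (by intro m hm; simp [hm])]
  simp

/-- The inclusion of `H^s` in `H^{s'}`, for `s' ≤ s`. -/
theorem exists_inclusion {s s' : ℝ} (h : s' ≤ s) :
    ∃ M : Sob s 2 →L[ℂ] Sob s' 2, ∀ f, (M f).coeff = f.coeff := by
  obtain ⟨M, hM, -⟩ := exists_multiplier (s := s) (s' := s') zero_le_one (fun _ => 1) fun n => by
    rw [norm_one, one_mul]
    exact Real.rpow_le_one_of_one_le_of_nonpos (one_le_jap n) (by linarith)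
  exact ⟨M, fun f => by ext n; rw [hM, one_mul]⟩

theorem exists_bessel {s s' β : ℝ} (h : s' ≤ s + β) :
    ∃ M : Sob s 2 →L[ℂ] Sob s' 2, ∀ f, (M f).coeff = bessel β f.coeff := by
  obtain ⟨M, hM, -⟩ := exists_multiplier (s := s) (s' := s') zero_le_one
    (fun n => ((jap n ^ (-β) : ℝ) : ℂ)) fun n => by
      rw [norm_jap_rpow, ← Real.rpow_add (jap_pos n)]
      exact Real.rpow_le_one_of_one_le_of_nonpos (one_le_jap n) (by linarith)
  exact ⟨M, fun f => by ext n; rw [hM, bessel]⟩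

/-! ### Lipschitz maps on bounded sets -/

set_option linter.unusedSectionVars false

section lipschitz

variable {A B C D H : Type*} [NormedAddCommGroup A] [NormedAddCommGroup B] [NormedAddCommGroup C]
  [NormedAddCommGroup D] [NormedAddCommGroup H] [NormedSpace ℂ A] [NormedSpace ℂ B]
  [NormedSpace ℂ C] [NormedSpace ℂ D] [NormedSpace ℂ H]

/-- Lipschitz on bounded sets. -/
def LocLip (f : A → B) : Prop :=
  ∀ M : ℝ, ∃ L : ℝ, 0 ≤ L ∧ ∀ x y, ‖x‖ ≤ M → ‖y‖ ≤ M → ‖f x - f y‖ ≤ L * ‖x - y‖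

/-- Lipschitz in both variables, with a constant of affine growth in the second one. -/
def AffLip (F : A → H → B) : Prop :=
  ∀ M : ℝ, ∃ L : ℝ, 0 ≤ L ∧ ∀ x y r s, ‖x‖ ≤ M → ‖y‖ ≤ M →
    ‖F x r - F y s‖ ≤ L * (1 + ‖r‖) * ‖x - y‖ + L * ‖r - s‖

theorem LocLip.bound {f : A → B} (hf : LocLip f) (M : ℝ) :
    ∃ L : ℝ, 0 ≤ L ∧ ∀ x, ‖x‖ ≤ M → ‖f x‖ ≤ L := by
  obtain ⟨L, hL, h⟩ := hf (max M 0)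
  refine ⟨L * max M 0 + ‖f 0‖, by positivity, fun x hx => ?_⟩
  have h1 := h x 0 (hx.trans (le_max_left _ _)) (by simp)
  rw [sub_zero] at h1
  have h2 : ‖f x‖ ≤ ‖f x - f 0‖ + ‖f 0‖ := by
    simpa using norm_add_le (f x - f 0) (f 0)
  have h3 : L * ‖x‖ ≤ L * max M 0 := by gcongr; exact hx.trans (le_max_left _ _)
  linarith

theorem AffLip.bound {F : A → H → B} (hF : AffLip F) (M : ℝ) :
    ∃ L : ℝ, 0 ≤ L ∧ ∀ x r, ‖x‖ ≤ M → ‖F x r‖ ≤ L * (1 + ‖r‖) := by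
  obtain ⟨L, hL, h⟩ := hF (max M 0)
  refine ⟨L * max M 0 + L + ‖F 0 0‖, by positivity, fun x r hx => ?_⟩
  have hx' := hx.trans (le_max_left M 0)
  have h1 := h x 0 r 0 hx' (by simp)
  rw [sub_zero, sub_zero] at h1
  have h2 : ‖F x r‖ ≤ ‖F x r - F 0 0‖ + ‖F 0 0‖ := by
    simpa using norm_add_le (F x r - F 0 0) (F 0 0)
  have h3 : L * (1 + ‖r‖) * ‖x‖ ≤ L * (1 + ‖r‖) * max M 0 := by gcongr
  have h4 : 0 ≤ ‖F 0 0‖ * ‖r‖ := by positivity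
  linarith

theorem LocLip.continuous {f : A → B} (hf : LocLip f) : Continuous f := by
  rw [continuous_iff_continuousAt]
  intro x
  obtain ⟨L, hL, h⟩ := hf (‖x‖ + 1)
  rw [ContinuousAt, tendsto_iff_norm_sub_tendsto_zero]
  have h1 : Tendsto (fun y => L * ‖y - x‖) (𝓝 x) (𝓝 0) := by
    have : Continuous fun y => L * ‖y - x‖ := by fun_prop
    simpa using this.tendsto x
  refine squeeze_zero' (Eventually.of_forall fun _ => norm_nonneg _) ?_ h1
  filter_upwards [Metric.ball_mem_nhds x one_pos] with y hy
  refine h y x ?_ (by linarith)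
  rw [mem_ball_iff_norm] at hy
  have := norm_add_le (y - x) x
  rw [sub_add_cancel] at this
  linarith

theorem AffLip.continuous {F : A → H → B} (hF : AffLip F) :
    Continuous fun p : A × H => F p.1 p.2 := by
  rw [continuous_iff_continuousAt]
  rintro ⟨x, r⟩
  obtain ⟨L, hL, h⟩ := hF (‖x‖ + 1)
  rw [ContinuousAt, tendsto_iff_norm_sub_tendsto_zero]
  have h1 : Tendsto (fun p : A × H => L * (1 + ‖p.2‖) * ‖p.1 - x‖ + L * ‖p.2 - r‖) (𝓝 (x, r))
      (𝓝 0) := by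
    have : Continuous fun p : A × H => L * (1 + ‖p.2‖) * ‖p.1 - x‖ + L * ‖p.2 - r‖ := by fun_prop
    simpa using this.tendsto (x, r)
  refine squeeze_zero' (Eventually.of_forall fun _ => norm_nonneg _) ?_ h1
  have hball : {p : A × H | ‖p.1 - x‖ < 1} ∈ 𝓝 (x, r) := by
    apply IsOpen.mem_nhds
    · exact isOpen_lt (by fun_prop) continuous_const
    · simp
  filter_upwards [hball] with p hp
  refine h p.1 x p.2 r ?_ (by linarith)
  have := norm_add_le (p.1 - x) x
  rw [sub_add_cancel] at this
  have hp' : ‖p.1 - x‖ < 1 := hp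
  linarith

theorem LocLip.clm (L : A →L[ℂ] B) : LocLip (fun x => L x) := fun _ =>
  ⟨‖L‖, norm_nonneg _, fun x y _ _ => by rw [← map_sub]; exact L.le_opNorm _⟩

theorem LocLip.clm_comp {f : A → B} (hf : LocLip f) (T : B →L[ℂ] C) : LocLip fun x => T (f x) := by
  intro M
  obtain ⟨L, hL, h⟩ := hf M
  refine ⟨‖T‖ * L, by positivity, fun x y hx hy => ?_⟩
  rw [← map_sub, mul_assoc]
  exact (T.le_opNorm _).trans (by gcongr; exact h x y hx hy)

theorem LocLip.add {f g : A → B} (hf : LocLip f) (hg : LocLip g) :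
    LocLip fun x => f x + g x := by
  intro M
  obtain ⟨L, hL, h⟩ := hf M
  obtain ⟨L', hL', h'⟩ := hg M
  refine ⟨L + L', by positivity, fun x y hx hy => ?_⟩
  rw [add_sub_add_comm, add_mul]
  exact (norm_add_le _ _).trans (add_le_add (h x y hx hy) (h' x y hx hy))

theorem LocLip.neg {f : A → B} (hf : LocLip f) : LocLip fun x => -f x := by
  intro M
  obtain ⟨L, hL, h⟩ := hf M
  refine ⟨L, hL, fun x y hx hy => ?_⟩
  rw [← neg_sub', norm_neg]
  exact h x y hx hy

theorem LocLip.bilin (T : B →L[ℂ] C →L[ℂ] D) {f : A → B} {g : A → C} (hf : LocLip f)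
    (hg : LocLip g) : LocLip fun x => T (f x) (g x) := by
  intro M
  obtain ⟨L, hL, h⟩ := hf M
  obtain ⟨L', hL', h'⟩ := hg M
  obtain ⟨P, hP, hp⟩ := hf.bound M
  obtain ⟨Q, hQ, hq⟩ := hg.bound M
  refine ⟨‖T‖ * (L * Q + P * L'), by positivity, fun x y hx hy => ?_⟩
  have e : T (f x) (g x) - T (f y) (g y) = T (f x - f y) (g x) + T (f y) (g x - g y) := by
    simp only [map_sub, sub_apply]; abel
  rw [e]
  calc _ ≤ ‖T‖ * ‖f x - f y‖ * ‖g x‖ + ‖T‖ * ‖f y‖ * ‖g x - g y‖ :=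
        (norm_add_le _ _).trans (add_le_add (T.le_opNorm₂ _ _) (T.le_opNorm₂ _ _))
    _ ≤ ‖T‖ * (L * ‖x - y‖) * Q + ‖T‖ * P * (L' * ‖x - y‖) := by
        gcongr
        · exact h x y hx hy
        · exact hq x hx
        · exact hp y hy
        · exact h' x y hx hy
    _ = _ := by ring

theorem LocLip.affLip {f : A → B} (hf : LocLip f) : AffLip fun x (_ : H) => f x := by
  intro M
  obtain ⟨L, hL, h⟩ := hf M
  refine ⟨L, hL, fun x y r s hx hy => (h x y hx hy).trans ?_⟩
  have h1 : 0 ≤ L * ‖r‖ * ‖x - y‖ := by positivity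
  have h2 : 0 ≤ L * ‖r - s‖ := by positivity
  linarith

theorem AffLip.snd (T : H →L[ℂ] B) : AffLip fun (_ : A) (r : H) => T r := fun _ =>
  ⟨‖T‖, norm_nonneg _, fun x y r s _ _ => by
    rw [← map_sub]
    refine (T.le_opNorm _).trans (le_add_of_nonneg_left (by positivity))⟩

theorem AffLip.add {F G : A → H → B} (hF : AffLip F) (hG : AffLip G) :
    AffLip fun x r => F x r + G x r := by
  intro M
  obtain ⟨L, hL, h⟩ := hF M
  obtain ⟨L', hL', h'⟩ := hG M
  refine ⟨L + L', by positivity, fun x y r s hx hy => ?_⟩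
  rw [add_sub_add_comm]
  refine (norm_add_le _ _).trans ((add_le_add (h x y r s hx hy) (h' x y r s hx hy)).trans_eq ?_)
  ring

theorem AffLip.clm_comp {F : A → H → B} (hF : AffLip F) (T : B →L[ℂ] C) :
    AffLip fun x r => T (F x r) := by
  intro M
  obtain ⟨L, hL, h⟩ := hF M
  refine ⟨‖T‖ * L, by positivity, fun x y r s hx hy => ?_⟩
  rw [← map_sub]
  refine (T.le_opNorm _).trans ((mul_le_mul_of_nonneg_left (h x y r s hx hy)
    (norm_nonneg T)).trans_eq ?_)
  ring

theorem AffLip.neg {F : A → H → B} (hF : AffLip F) : AffLip fun x r => -F x r := by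
  intro M
  obtain ⟨L, hL, h⟩ := hF M
  refine ⟨L, hL, fun x y r s hx hy => ?_⟩
  rw [← neg_sub', norm_neg]
  exact h x y r s hx hy

/-- Only one factor may depend on r; otherwise the growth in r would be quadratic and L³ in time
would not suffice. In the system ℜ enters every product at most once. -/
theorem AffLip.bilin (T : B →L[ℂ] C →L[ℂ] D) {F : A → H → B} {g : A → C} (hF : AffLip F)
    (hg : LocLip g) : AffLip fun x r => T (F x r) (g x) := by
  intro M
  obtain ⟨L, hL, h⟩ := hF M
  obtain ⟨L', hL', h'⟩ := hg M
  obtain ⟨P, hP, hp⟩ := hF.bound M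
  obtain ⟨Q, hQ, hq⟩ := hg.bound M
  refine ⟨‖T‖ * (L * Q + P * L'), by positivity, fun x y r s hx hy => ?_⟩
  have e : T (F x r) (g x) - T (F y s) (g y) =
      T (F x r - F y s) (g y) + T (F x r) (g x - g y) := by
    simp only [map_sub, sub_apply]; abel
  rw [e]
  calc _ ≤ ‖T‖ * ‖F x r - F y s‖ * ‖g y‖ + ‖T‖ * ‖F x r‖ * ‖g x - g y‖ :=
        (norm_add_le _ _).trans (add_le_add (T.le_opNorm₂ _ _) (T.le_opNorm₂ _ _))
    _ ≤ ‖T‖ * (L * (1 + ‖r‖) * ‖x - y‖ + L * ‖r - s‖) * Q +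
        ‖T‖ * (P * (1 + ‖r‖)) * (L' * ‖x - y‖) := by
        gcongr
        · exact h x y r s hx hy
        · exact hq y hy
        · exact hp x r hx
        · exact h' x y hx hy
    _ ≤ _ := by
        have : 0 ≤ ‖T‖ * (P * L') * ‖r - s‖ := by positivity
        linarith

theorem AffLip.prodMk {F : A → H → B} {G : A → H → C} (hF : AffLip F) (hG : AffLip G) :
    AffLip fun x r => (F x r, G x r) := by
  intro M
  obtain ⟨L, hL, h⟩ := hF M
  obtain ⟨L', hL', h'⟩ := hG M
  refine ⟨L + L', by positivity, fun x y r s hx hy => ?_⟩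
  rw [Prod.mk_sub_mk, Prod.norm_mk]
  have h1 := h x y r s hx hy
  have h2 := h' x y r s hx hy
  have h3 : 0 ≤ L * (1 + ‖r‖) * ‖x - y‖ + L * ‖r - s‖ := by positivity
  have h4 : 0 ≤ L' * (1 + ‖r‖) * ‖x - y‖ + L' * ‖r - s‖ := by positivity
  exact max_le (by linarith) (by linarith)

end lipschitz

/-! ### Estimates in Lebesgue spaces of functions of time -/

section lebesgue

variable {α : Type*} [MeasurableSpace α] {μ : Measure α} {B H H' : Type*} [NormedAddCommGroup B]
  [NormedAddCommGroup H] [NormedAddCommGroup H']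

theorem memLp_of_affine_bound [IsFiniteMeasure μ] {q : ℝ≥0∞} {f : α → B}
    (hf : AEStronglyMeasurable f μ) {r : α → H} {s : α → H'} (hr : MemLp r q μ) (hs : MemLp s q μ)
    (a b c : ℝ) (h : ∀ᵐ t ∂μ, ‖f t‖ ≤ a + b * ‖r t‖ + c * ‖s t‖) : MemLp f q μ :=
  (((memLp_const a).add (hr.norm.const_mul b)).add (hs.norm.const_mul c)).mono' hf h

/-- Minkowski's inequality; total mass at most 1 makes the constant a a bound for its own L^q norm.
-/
theorem eLpNorm_le_of_affine_bound (hμ : μ univ ≤ 1) {q : ℝ≥0∞} (hq : 1 ≤ q) {f : α → B}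
    {r : α → H} {s : α → H'} (hr : MemLp r q μ) (hs : MemLp s q μ)
    {a b c : ℝ} (ha : 0 ≤ a) (hb : 0 ≤ b) (hc : 0 ≤ c)
    (h : ∀ᵐ t ∂μ, ‖f t‖ ≤ a + b * ‖r t‖ + c * ‖s t‖) :
    (eLpNorm f q μ).toReal ≤ a + b * (eLpNorm r q μ).toReal + c * (eLpNorm s q μ).toReal := by
  have h1 : eLpNorm f q μ ≤ eLpNorm (fun t => (a + b * ‖r t‖) + c * ‖s t‖) q μ :=
    eLpNorm_mono_ae_real h
  have h2 : eLpNorm (fun t => (a + b * ‖r t‖) + c * ‖s t‖) q μ ≤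
      (ENNReal.ofReal a + ENNReal.ofReal b * eLpNorm r q μ) + ENNReal.ofReal c * eLpNorm s q μ := by
    have hmr : AEStronglyMeasurable (fun t => b * ‖r t‖) μ := (hr.norm.const_mul b).1
    have hms : AEStronglyMeasurable (fun t => c * ‖s t‖) μ := (hs.norm.const_mul c).1
    refine (eLpNorm_add_le (aestronglyMeasurable_const.add hmr) hms hq).trans ?_
    refine add_le_add ((eLpNorm_add_le aestronglyMeasurable_const hmr hq).trans
      (add_le_add ?_ ?_)) ?_
    · refine (eLpNorm_le_of_ae_bound (C := a) (ae_of_all _ fun _ => by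
        rw [Real.norm_of_nonneg ha])).trans ?_
      exact (mul_le_mul_left (ENNReal.rpow_le_one hμ (by positivity)) _).trans_eq (one_mul _)
    · refine (eLpNorm_const_smul_le (c := b) (f := fun t => ‖r t‖)).trans_eq ?_
      rw [eLpNorm_norm, Real.enorm_eq_ofReal hb]
    · refine (eLpNorm_const_smul_le (c := c) (f := fun t => ‖s t‖)).trans_eq ?_
      rw [eLpNorm_norm, Real.enorm_eq_ofReal hc]
  refine (ENNReal.toReal_mono ?_ (h1.trans h2)).trans_eq ?_
  · finiteness [hr.2.ne, hs.2.ne]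
  · rw [ENNReal.toReal_add (by finiteness [hr.2.ne]) (by finiteness [hs.2.ne]),
      ENNReal.toReal_add (by finiteness) (by finiteness [hr.2.ne]), ENNReal.toReal_mul,
      ENNReal.toReal_mul, ENNReal.toReal_ofReal ha, ENNReal.toReal_ofReal hb,
      ENNReal.toReal_ofReal hc]

/-- Hölder with exponents 3 and 3/2 yields μ(A)^{2/3} ≤ τ² ≤ τ. The size τ³ of the set is chosen so
that this gain and the one from `L^∞` to L³ are both bounded by the same τ. -/
theorem setIntegral_norm_le_eLpNorm {A : Set α} {τ : ℝ} (hτ : 0 ≤ τ) (hτ1 : τ ≤ 1)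
    (hA : μ A ≤ ENNReal.ofReal (τ ^ 3)) {r : α → H} (hr : MemLp r 3 μ) :
    ∫ t in A, ‖r t‖ ∂μ ≤ τ * (eLpNorm r 3 μ).toReal := by
  have hr' : MemLp r 3 (μ.restrict A) := hr.restrict A
  rw [integral_norm_eq_lintegral_enorm hr'.1, ← eLpNorm_one_eq_lintegral_enorm,
    ← ENNReal.toReal_ofReal hτ, ← ENNReal.toReal_mul]
  refine ENNReal.toReal_mono (by finiteness [hr.2.ne]) ?_
  refine (eLpNorm_le_eLpNorm_mul_rpow_measure_univ (p := 1) (q := 3) (by norm_num) hr'.1).trans ?_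
  rw [mul_comm]
  gcongr
  · rw [Measure.restrict_apply_univ]
    refine (ENNReal.rpow_le_rpow hA (by norm_num)).trans ?_
    rw [ENNReal.ofReal_rpow_of_nonneg (by positivity) (by norm_num)]
    refine ENNReal.ofReal_le_ofReal ?_
    rw [← Real.rpow_natCast, ← Real.rpow_mul hτ]
    have : ((3 : ℕ) : ℝ) * (1 / (1 : ℝ≥0∞).toReal - 1 / (3 : ℝ≥0∞).toReal) = (2 : ℕ) := by norm_num
    rw [this, Real.rpow_natCast]
    nlinarith
  · exact Measure.restrict_le_self

theorem eLpNorm_three_le_of_bound {A : Set α} (hAm : MeasurableSet A) {τ Q : ℝ} (hτ : 0 ≤ τ)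
    (hQ : 0 ≤ Q) (hA : μ A ≤ ENNReal.ofReal (τ ^ 3)) {f : α → B}
    (h : ∀ᵐ t ∂μ, ‖f t‖ ≤ A.indicator (fun _ => Q) t) :
    (eLpNorm f 3 μ).toReal ≤ τ * Q := by
  rw [← ENNReal.toReal_ofReal (show 0 ≤ τ * Q by positivity)]
  refine ENNReal.toReal_mono ENNReal.ofReal_ne_top ((eLpNorm_mono_ae_real h).trans ?_)
  rw [eLpNorm_indicator_const hAm (by norm_num) (by norm_num), ENNReal.ofReal_mul hτ, mul_comm,
    Real.enorm_eq_ofReal hQ]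
  gcongr
  refine (ENNReal.rpow_le_rpow hA (by norm_num)).trans_eq ?_
  rw [ENNReal.ofReal_rpow_of_nonneg (by positivity) (by norm_num), ← Real.rpow_natCast,
    ← Real.rpow_mul hτ]
  norm_num

end lebesgue

/-! ### An abstract Duhamel system with a paracontrolled operator -/

/-- A continuous curve on `[0,T]`, extended to the line by its end values. -/
def extend {B : Type*} [TopologicalSpace B] {T : ℝ} (hT : 0 ≤ T) (u : C(Icc (0 : ℝ) T, B)) (t : ℝ) :
    B := u (projIcc 0 T hT t)

theorem continuous_extend {B : Type*} [TopologicalSpace B] {T : ℝ} (hT : 0 ≤ T)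
    (u : C(Icc (0 : ℝ) T, B)) : Continuous (extend hT u) :=
  u.continuous.comp continuous_projIcc

theorem extend_of_mem {B : Type*} [TopologicalSpace B] {T : ℝ} (hT : 0 ≤ T)
    (u : C(Icc (0 : ℝ) T, B)) {t : ℝ} (ht : t ∈ Icc (0 : ℝ) T) : extend hT u t = u ⟨t, ht⟩ := by
  rw [extend, projIcc_of_mem hT ht]

theorem ae_mem_Icc (T : ℝ) : ∀ᵐ t ∂timeMeasure T, t ∈ Icc (0 : ℝ) T :=
  ae_restrict_mem measurableSet_Icc

theorem timeMeasure_univ_le {T : ℝ} (hT : T ≤ 1) : timeMeasure T univ ≤ 1 := by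
  rw [Measure.restrict_apply_univ, Real.volume_Icc, sub_zero]
  exact ENNReal.ofReal_le_one.2 hT

/-- Causality of operators from `L^{3/2}` to `L^∞`. -/
def Causal {K H : Type*} [NormedAddCommGroup K] [NormedSpace ℂ K] [NormedAddCommGroup H]
    [NormedSpace ℂ H] {T : ℝ}
    (J : Lp K (3 / 2) (timeMeasure T) →L[ℂ] Lp H ∞ (timeMeasure T)) : Prop :=
  ∀ (τ : ℝ) (w : Lp K (3 / 2) (timeMeasure T)), (∀ᵐ t ∂timeMeasure T, t ≤ τ → w t = 0) →
    ∀ᵐ t ∂timeMeasure T, t ≤ τ → J w t = 0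

set_option linter.unusedSectionVars false

section duhamel

variable {E E' : Type*} [NormedAddCommGroup E] [NormedSpace ℂ E] [NormedAddCommGroup E']
  [NormedSpace ℂ E'] {D : ℝ → E' →L[ℂ] E} {C T : ℝ}

/-- The Duhamel integral `∫_0^t D(t-s) f(s) ds`, for `t ∈ [0,T]`. -/
def duhInt (D : ℝ → E' →L[ℂ] E) (T : ℝ) (f : ℝ → E') (t : ℝ) : E :=
  ∫ s, (Iic t).indicator (fun s => D (t - s) (f s)) s ∂timeMeasure T

theorem aestronglyMeasurable_duh (hD : Continuous fun p : ℝ × E' => D p.1 p.2) {f : ℝ → E'}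
    (hf : AEStronglyMeasurable f (timeMeasure T)) (t : ℝ) :
    AEStronglyMeasurable ((Iic t).indicator fun s => D (t - s) (f s)) (timeMeasure T) := by
  refine AEStronglyMeasurable.indicator ?_ measurableSet_Iic
  exact hD.comp_aestronglyMeasurable
    ((Continuous.aestronglyMeasurable (by fun_prop : Continuous fun s : ℝ => t - s)).prodMk hf)

theorem norm_duh_indicator_le (hC : 0 ≤ C) (hDC : ∀ t, ‖D t‖ ≤ C) (f : ℝ → E') (t s : ℝ) :
    ‖(Iic t).indicator (fun s => D (t - s) (f s)) s‖ ≤ C * ‖f s‖ := by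
  by_cases h : s ∈ Iic t
  · rw [indicator_of_mem h]
    exact (D (t - s)).le_of_opNorm_le (hDC _) _
  · rw [indicator_of_notMem h, norm_zero]; positivity

theorem integrable_duh (hC : 0 ≤ C) (hDC : ∀ t, ‖D t‖ ≤ C)
    (hD : Continuous fun p : ℝ × E' => D p.1 p.2) {f : ℝ → E'}
    (hf : Integrable f (timeMeasure T)) (t : ℝ) :
    Integrable ((Iic t).indicator fun s => D (t - s) (f s)) (timeMeasure T) :=
  (hf.norm.const_mul C).mono' (aestronglyMeasurable_duh hD hf.1 t)
    (ae_of_all _ (norm_duh_indicator_le hC hDC f t))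

/-- Dominated convergence: the cut-off at s ≤ t is discontinuous in t only where s equals t, a null
set of s. -/
theorem continuous_duhInt (hC : 0 ≤ C) (hDC : ∀ t, ‖D t‖ ≤ C)
    (hD : Continuous fun p : ℝ × E' => D p.1 p.2) {f : ℝ → E'}
    (hf : Integrable f (timeMeasure T)) : Continuous (duhInt D T f) := by
  rw [continuous_iff_continuousAt]
  intro t₀
  refine continuousAt_of_dominated (bound := fun s => C * ‖f s‖)
    (Eventually.of_forall fun t => aestronglyMeasurable_duh hD hf.1 t)
    (Eventually.of_forall fun t => ae_of_all _ (norm_duh_indicator_le hC hDC f t))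
    (hf.norm.const_mul C) ?_
  -- Away from s = t₀ the indicator is locally constant in t.
  have hne : ∀ᵐ s ∂timeMeasure T, s ≠ t₀ := by
    refine ae_restrict_of_ae ?_
    exact measure_eq_zero_iff_ae_notMem.1 (measure_singleton (μ := volume) t₀)
  filter_upwards [hne] with s hs
  have hcont : ContinuousAt (fun t => D (t - s) (f s)) t₀ :=
    (hD.comp (by fun_prop : Continuous fun t : ℝ => (t - s, f s))).continuousAt
  rcases lt_or_gt_of_ne hs with h | h
  · refine hcont.congr ?_
    filter_upwards [Ioi_mem_nhds h] with t ht
    rw [indicator_of_mem (mem_Iic.2 (mem_Ioi.1 ht).le)]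
  · refine (continuousAt_const (y := (0 : E))).congr ?_
    filter_upwards [Iio_mem_nhds h] with t ht
    rw [indicator_of_notMem (fun h' => absurd (mem_Iic.1 h') (not_le.2 ht))]

theorem norm_duhInt_sub_le (hC : 0 ≤ C) (hDC : ∀ t, ‖D t‖ ≤ C)
    (hD : Continuous fun p : ℝ × E' => D p.1 p.2) {f f' : ℝ → E'}
    (hf : Integrable f (timeMeasure T)) (hf' : Integrable f' (timeMeasure T)) {t b : ℝ}
    (ht : t ≤ b) :
    ‖duhInt D T f t - duhInt D T f' t‖ ≤ C * ∫ s in Iic b, ‖f s - f' s‖ ∂timeMeasure T := by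
  rw [duhInt, duhInt, ← integral_sub (integrable_duh hC hDC hD hf t)
    (integrable_duh hC hDC hD hf' t), ← integral_const_mul, ← integral_indicator measurableSet_Iic]
  refine norm_integral_le_of_norm_le (((hf.sub hf').norm.const_mul C).indicator measurableSet_Iic)
    (ae_of_all _ fun s => ?_)
  by_cases h : s ∈ Iic t
  · rw [indicator_of_mem h, indicator_of_mem h, indicator_of_mem (show s ∈ Iic b from le_trans h ht),
      ← map_sub]
    exact (D (t - s)).le_of_opNorm_le (hDC _) _
  · rw [indicator_of_notMem h, indicator_of_notMem h, sub_zero, norm_zero]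
    exact indicator_nonneg (fun _ _ => by positivity) _

end duhamel

/-- The data of an abstract system
`x = l + ∫ D(t-s) F(x,g)(r) ds`, `r = ρ(x,g) - J(V(x,g)(r))`. -/
structure Model (E E' G H K : Type*) [NormedAddCommGroup E] [NormedSpace ℂ E]
    [NormedAddCommGroup E'] [NormedSpace ℂ E'] [NormedAddCommGroup G] [NormedSpace ℂ G]
    [NormedAddCommGroup H] [NormedSpace ℂ H] [NormedAddCommGroup K] [NormedSpace ℂ K] where
  D : ℝ → E' →L[ℂ] E
  F : E × G → H → E'
  V : E × G → H → K
  ρ : E × G → H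
  C : ℝ
  C_nonneg : 0 ≤ C
  norm_D_le : ∀ t, ‖D t‖ ≤ C
  cont_D : Continuous fun p : ℝ × E' => D p.1 p.2
  lip_F : AffLip F
  lip_V : AffLip V
  lip_ρ : LocLip ρ

namespace Model

variable {E E' G H K : Type*} [NormedAddCommGroup E] [NormedSpace ℂ E]
    [NormedAddCommGroup E'] [NormedSpace ℂ E'] [NormedAddCommGroup G] [NormedSpace ℂ G]
    [NormedAddCommGroup H] [NormedSpace ℂ H] [NormedAddCommGroup K] [NormedSpace ℂ K]
    (m : Model E E' G H K) {T : ℝ} (hT : 0 ≤ T)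

section

variable (p p' : C(Icc (0 : ℝ) T, E × G)) (r r' : Lp H 3 (timeMeasure T))
  (J J' : Lp K (3 / 2) (timeMeasure T) →L[ℂ] Lp H ∞ (timeMeasure T))

theorem norm_extend_le {B : Type*} [NormedAddCommGroup B] (u : C(Icc (0 : ℝ) T, B)) (t : ℝ) :
    ‖extend hT u t‖ ≤ ‖u‖ := u.norm_coe_le_norm _

/-- Affine growth in r makes the composition as integrable in time as r, since the curve p is
bounded. -/
theorem memLp_affLip {B : Type*} [NormedAddCommGroup B] [NormedSpace ℂ B] {F : E × G → H → B}
    (hF : AffLip F) {q : ℝ≥0∞} (hq : q ≤ 3) :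
    MemLp (fun t => F (extend hT p t) (r t)) q (timeMeasure T) := by
  obtain ⟨L, hL, h⟩ := hF.bound ‖p‖
  have hr : MemLp r q (timeMeasure T) := (Lp.memLp r).mono_exponent hq
  refine memLp_of_affine_bound ?_ hr hr L L 0 (ae_of_all _ fun t => ?_)
  · exact hF.continuous.comp_aestronglyMeasurable
      ((continuous_extend hT p).aestronglyMeasurable.prodMk (Lp.aestronglyMeasurable r))
  · refine (h _ (r t) (norm_extend_le hT p t)).trans_eq ?_
    ring

theorem three_halves_le : (3 / 2 : ℝ≥0∞) ≤ 3 := by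
  refine ENNReal.div_le_of_le_mul ?_
  norm_num

/-- The forcing term. -/
def force (t : ℝ) : E' := m.F (extend hT p t) (r t)

theorem integrable_force : Integrable (m.force hT p r) (timeMeasure T) :=
  memLp_one_iff_integrable.1 (memLp_affLip hT p r m.lip_F (by norm_num))

/-- The integral term. -/
def flow : C(Icc (0 : ℝ) T, E) where
  toFun t := duhInt m.D T (m.force hT p r) t
  continuous_toFun := (continuous_duhInt m.C_nonneg m.norm_D_le m.cont_D
    (m.integrable_force hT p r)).comp continuous_subtype_val

/-- The argument of the operator `J`. -/
def arg : Lp K (3 / 2) (timeMeasure T) :=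
  (memLp_affLip hT p r m.lip_V three_halves_le).toLp _

theorem arg_ae : m.arg hT p r =ᵐ[timeMeasure T] fun t => m.V (extend hT p t) (r t) :=
  MemLp.coeFn_toLp _

theorem memLp_out :
    MemLp (fun t => m.ρ (extend hT p t) - J (m.arg hT p r) t) 3 (timeMeasure T) := by
  refine MemLp.sub ?_ ((Lp.memLp (J (m.arg hT p r))).mono_exponent le_top)
  have h : AffLip fun x (_ : H) => m.ρ x := m.lip_ρ.affLip
  exact memLp_affLip hT p r h le_rfl

/-- The right-hand side of the equation for `r`. -/
def out : Lp H 3 (timeMeasure T) := (m.memLp_out hT p r J).toLp _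

theorem out_ae : m.out hT p r J =ᵐ[timeMeasure T]
    fun t => m.ρ (extend hT p t) - J (m.arg hT p r) t := MemLp.coeFn_toLp _

end

theorem _root_.HartreeSdNLW.eLpNorm_three_halves_le {α B : Type*} [MeasurableSpace α] {μ : Measure α}
    [NormedAddCommGroup B] (hμ : μ univ ≤ 1) {r : α → B} (hr : MemLp r 3 μ) :
    (eLpNorm r (3 / 2) μ).toReal ≤ (eLpNorm r 3 μ).toReal := by
  refine ENNReal.toReal_mono hr.2.ne ?_
  refine (eLpNorm_le_eLpNorm_mul_rpow_measure_univ three_halves_le hr.1).trans ?_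
  refine (mul_le_mul_right (ENNReal.rpow_le_one hμ ?_) _).trans_eq (mul_one _)
  rw [ENNReal.toReal_div]
  norm_num

theorem _root_.HartreeSdNLW.Lp_infty_ae_norm_le {α B : Type*} [MeasurableSpace α] {μ : Measure α}
    [NormedAddCommGroup B] (f : Lp B ∞ μ) : ∀ᵐ t ∂μ, ‖f t‖ ≤ ‖f‖ := by
  filter_upwards [ae_le_eLpNormEssSup (f := f) (μ := μ)] with t ht
  rw [Lp.norm_def, eLpNorm_exponent_top, ← toReal_enorm]
  exact ENNReal.toReal_mono (by simpa using Lp.eLpNorm_ne_top f) ht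

/-- A causal operator, up to time `b`, only sees its argument up to time `b`. -/
theorem _root_.HartreeSdNLW.Causal.ae_norm_le
    {J : Lp K (3 / 2) (timeMeasure T) →L[ℂ] Lp H ∞ (timeMeasure T)} (hJ : Causal J)
    (w : Lp K (3 / 2) (timeMeasure T)) (b : ℝ) :
    ∀ᵐ t ∂timeMeasure T, t ≤ b →
      ‖J w t‖ ≤ ‖J‖ * (eLpNorm w (3 / 2) ((timeMeasure T).restrict (Iic b))).toReal := by
  have hw : MemLp ((Iic b).indicator w) (3 / 2) (timeMeasure T) :=
    (Lp.memLp w).indicator measurableSet_Iic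
  have h1 := hJ b (w - hw.toLp _) (by
    filter_upwards [Lp.coeFn_sub w (hw.toLp _), hw.coeFn_toLp] with t h1 h2 ht
    rw [h1, Pi.sub_apply, h2, indicator_of_mem (show t ∈ Iic b from ht), sub_self])
  have h2 := Lp.coeFn_sub (J w) (J (hw.toLp _))
  rw [← map_sub] at h2
  have h3 := Lp_infty_ae_norm_le (J (hw.toLp _))
  have h4 : ‖hw.toLp _‖ = (eLpNorm w (3 / 2) ((timeMeasure T).restrict (Iic b))).toReal := by
    rw [Lp.norm_toLp, eLpNorm_indicator_eq_eLpNorm_restrict measurableSet_Iic]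
  filter_upwards [h1, h2, h3] with t h1 h2 h3 ht
  have e : J w t = J (hw.toLp _) t := by
    have := h1 ht
    rw [h2, Pi.sub_apply, sub_eq_zero] at this
    exact this
  rw [e, ← h4]
  exact h3.trans (J.le_opNorm _)

section

variable {p p' : C(Icc (0 : ℝ) T, E × G)} {r r' : Lp H 3 (timeMeasure T)} {a b τ : ℝ}

theorem restrict_Iic_Icc_le (hτb : b - a ≤ τ ^ 3) :
    (timeMeasure T).restrict (Iic b) (Icc a b) ≤ ENNReal.ofReal (τ ^ 3) := by
  refine (Measure.restrict_apply_le _ _).trans ((Measure.restrict_apply_le _ _).trans ?_)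
  rw [Real.volume_Icc]
  exact ENNReal.ofReal_le_ofReal hτb

theorem restrict_Iic_univ_le (hT1 : T ≤ 1) : (timeMeasure T).restrict (Iic b) univ ≤ 1 := by
  rw [Measure.restrict_apply_univ]
  exact (measure_mono (subset_univ _)).trans (timeMeasure_univ_le hT1)

theorem toReal_eLpNorm_restrict_le {B : Type*} [NormedAddCommGroup B] {q : ℝ≥0∞} {μ : Measure ℝ}
    (f : Lp B q μ) (A : Set ℝ) : (eLpNorm f q (μ.restrict A)).toReal ≤ ‖f‖ := by
  rw [Lp.norm_def]
  exact ENNReal.toReal_mono (Lp.eLpNorm_ne_top f) (eLpNorm_restrict_le _ _ _ _)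

/-- Used for the forcing with q = 3 and for the argument of J with q = 3/2. The hypothesis `hqle`
compares the L^q and L³ norms up to time b. -/
theorem eLpNorm_affLip_sub_le {B : Type*} [NormedAddCommGroup B] [NormedSpace ℂ B]
    {F : E × G → H → B} {q : ℝ≥0∞} (hq : 1 ≤ q) (hq3 : q ≤ 3)
    (hT1 : T ≤ 1) {L R δ δr : ℝ} (hL : 0 ≤ L) (hδ : 0 ≤ δ)
    (h : ∀ x y r s, ‖x‖ ≤ R → ‖y‖ ≤ R →
      ‖F x r - F y s‖ ≤ L * (1 + ‖r‖) * ‖x - y‖ + L * ‖r - s‖)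
    (hp : ‖p‖ ≤ R) (hp' : ‖p'‖ ≤ R)
    (hqle : ∀ f : ℝ → H, MemLp f 3 ((timeMeasure T).restrict (Iic b)) →
      (eLpNorm f q ((timeMeasure T).restrict (Iic b))).toReal ≤
      (eLpNorm f 3 ((timeMeasure T).restrict (Iic b))).toReal)
    (hr : ‖r‖ ≤ R) (hpp : ∀ t : Icc (0 : ℝ) T, (t : ℝ) ≤ b → ‖p t - p' t‖ ≤ δ)
    (hrr : (eLpNorm (fun t => r t - r' t) 3 ((timeMeasure T).restrict (Iic b))).toReal ≤ δr) :
    (eLpNorm (fun t => F (extend hT p t) (r t) - F (extend hT p' t) (r' t)) q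
      ((timeMeasure T).restrict (Iic b))).toReal ≤ L * (1 + R) * δ + L * δr := by
  have hr3 : MemLp r 3 ((timeMeasure T).restrict (Iic b)) := (Lp.memLp r).restrict _
  have hrr3 : MemLp (fun t => r t - r' t) 3 ((timeMeasure T).restrict (Iic b)) :=
    ((Lp.memLp r).sub (Lp.memLp r')).restrict _
  have key := eLpNorm_le_of_affine_bound (restrict_Iic_univ_le (b := b) hT1) hq
    (f := fun t => F (extend hT p t) (r t) - F (extend hT p' t) (r' t))
    (hr3.mono_exponent hq3) (hrr3.mono_exponent hq3) (a := L * δ) (b := L * δ) (c := L)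
    (by positivity) (by positivity) hL (by
      filter_upwards [ae_restrict_of_ae (ae_mem_Icc T), ae_restrict_mem measurableSet_Iic]
        with t h1 h2
      refine (h _ _ _ _ ((norm_extend_le hT p t).trans hp)
        ((norm_extend_le hT p' t).trans hp')).trans ?_
      have := hpp ⟨t, h1⟩ h2
      rw [extend_of_mem hT p h1, extend_of_mem hT p' h1]
      have h5 : L * (1 + ‖r t‖) * ‖p ⟨t, h1⟩ - p' ⟨t, h1⟩‖ ≤ L * (1 + ‖r t‖) * δ := by gcongr
      linarith)
  refine key.trans ?_
  have h1 := (hqle _ hr3).trans ((toReal_eLpNorm_restrict_le r _).trans hr)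
  have h2 := (hqle _ hrr3).trans hrr
  have h3 : L * δ * (eLpNorm r q ((timeMeasure T).restrict (Iic b))).toReal ≤ L * δ * R := by gcongr
  have h4 := mul_le_mul_of_nonneg_left h2 hL
  linarith

/-- The basic difference estimate: for solutions which agree before time `a`, the change up to
time `b` is small if `b - a` is. -/
theorem exists_diff {R : ℝ} (hR : 0 ≤ R) : ∃ N : ℝ, 0 ≤ N ∧ ∀ {T : ℝ} (hT : 0 ≤ T) (_ : T ≤ 1)
    {a b τ : ℝ} (_ : 0 ≤ τ) (_ : τ ≤ 1) (_ : b - a ≤ τ ^ 3)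
    {p p' : C(Icc (0 : ℝ) T, E × G)} {r r' : Lp H 3 (timeMeasure T)}
    {J J' : Lp K (3 / 2) (timeMeasure T) →L[ℂ] Lp H ∞ (timeMeasure T)}
    (_ : Causal J) (_ : Causal J') (_ : ‖p‖ ≤ R) (_ : ‖p'‖ ≤ R) (_ : ‖r‖ ≤ R)
    (_ : ‖J'‖ ≤ R)
    (_ : ∀ t : Icc (0 : ℝ) T, (t : ℝ) < a → p t = p' t)
    (_ : ∀ᵐ t ∂timeMeasure T, t < a → r t = r' t)
    {δ δr : ℝ} (_ : 0 ≤ δ) (_ : 0 ≤ δr) (_ : ∀ t : Icc (0 : ℝ) T, (t : ℝ) ≤ b → ‖p t - p' t‖ ≤ δ)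
    (_ : (eLpNorm (fun t => r t - r' t) 3 ((timeMeasure T).restrict (Iic b))).toReal ≤ δr),
    (∀ t : Icc (0 : ℝ) T, (t : ℝ) ≤ b →
      ‖m.flow hT p r t - m.flow hT p' r' t‖ ≤ N * τ * (δ + δr)) ∧
    (eLpNorm (fun t => m.out hT p r J t - m.out hT p' r' J' t) 3
      ((timeMeasure T).restrict (Icc a b))).toReal ≤ N * τ * (δ + δr + ‖J - J'‖) := by
  obtain ⟨LF, hLF, hF⟩ := m.lip_F R
  obtain ⟨LV, hLV, hV⟩ := m.lip_V R
  obtain ⟨BV, hBV, hbV⟩ := m.lip_V.bound R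
  obtain ⟨Lρ, hLρ, hρ⟩ := m.lip_ρ R
  have hC := m.C_nonneg
  refine ⟨m.C * LF * (1 + R) + Lρ + BV * (1 + R) + R * LV * (1 + R), by positivity, ?_⟩
  intro T hT hT1 a b τ hτ hτ1 hba p p' r r' J J' hJ hJ' hp hp' hr hJ'R hpa hra δ δr hδ hδr hpp hrr
  have hR1 : 1 ≤ 1 + R := by linarith
  constructor
  · intro t ht
    have h1 := norm_duhInt_sub_le m.C_nonneg m.norm_D_le m.cont_D (m.integrable_force hT p r)
      (m.integrable_force hT p' r') ht
    refine h1.trans ?_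
    -- Before time a the two forcings coincide, so the Duhamel difference is an integral over [a,b]
    -- only; this is the source of the factor τ.
    have hae : ∀ᵐ s ∂(timeMeasure T).restrict (Iic b), s ∉ Icc a b →
        ‖m.force hT p r s - m.force hT p' r' s‖ = 0 := by
      filter_upwards [ae_restrict_of_ae (ae_mem_Icc T), ae_restrict_of_ae hra,
        ae_restrict_mem measurableSet_Iic] with s h1 h2 h3 h4
      have hsa : s < a := not_le.1 fun h => h4 ⟨h, h3⟩
      rw [force, force, extend_of_mem hT p h1, extend_of_mem hT p' h1, hpa ⟨s, h1⟩ hsa, h2 hsa,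
        sub_self, norm_zero]
    rw [← setIntegral_eq_integral_of_ae_compl_eq_zero hae]
    have h2 := setIntegral_norm_le_eLpNorm hτ hτ1 (restrict_Iic_Icc_le (T := T) hba)
      (((memLp_affLip hT p r m.lip_F le_rfl).sub (memLp_affLip hT p' r' m.lip_F le_rfl)).restrict _)
    have h3 := eLpNorm_affLip_sub_le hT (F := m.F) (q := 3) (by norm_num) le_rfl hT1 hLF hδ hF
      hp hp' (fun f _ => le_rfl) hr hpp hrr
    calc _ ≤ m.C * (τ * (LF * (1 + R) * δ + LF * δr)) := by
          refine mul_le_mul_of_nonneg_left (h2.trans ?_) hC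
          exact mul_le_mul_of_nonneg_left h3 hτ
      _ ≤ m.C * (τ * (LF * (1 + R) * δ + LF * (1 + R) * δr)) := by
          gcongr
          exact le_mul_of_one_le_right hLF hR1
      _ = m.C * LF * (1 + R) * τ * (δ + δr) := by ring
      _ ≤ _ := by
          gcongr
          have : 0 ≤ Lρ + BV * (1 + R) + R * LV * (1 + R) := by positivity
          linarith
  · have h32 : (1 : ℝ≥0∞) ≤ 3 / 2 := Fact.out
    have hv : ‖m.arg hT p r‖ ≤ BV * (1 + R) := by
      rw [arg, Lp.norm_toLp]
      have hr3 := Lp.memLp r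
      refine (eLpNorm_le_of_affine_bound (timeMeasure_univ_le hT1) h32
        (hr3.mono_exponent three_halves_le) (hr3.mono_exponent three_halves_le)
        hBV hBV le_rfl (ae_of_all _ fun t => ?_)).trans
        (b := BV + BV * (eLpNorm r (3 / 2) (timeMeasure T)).toReal + 0 * _) le_rfl |>.trans ?_
      · refine (hbV _ (r t) ((norm_extend_le hT p t).trans hp)).trans_eq ?_
        ring
      · have := (eLpNorm_three_halves_le (timeMeasure_univ_le hT1) hr3).trans hr
        have := mul_le_mul_of_nonneg_left this hBV
        linarith
    have hvv : (eLpNorm (m.arg hT p r - m.arg hT p' r' : Lp K (3 / 2) (timeMeasure T)) (3 / 2)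
        ((timeMeasure T).restrict (Iic b))).toReal ≤ LV * (1 + R) * δ + LV * δr := by
      refine le_trans (le_of_eq ?_) (eLpNorm_affLip_sub_le hT (F := m.V) h32 three_halves_le hT1
        hLV hδ hV hp hp' (fun f hf => eLpNorm_three_halves_le (restrict_Iic_univ_le hT1) hf)
        hr hpp hrr)
      congr 1
      refine eLpNorm_congr_ae (ae_restrict_of_ae ?_)
      filter_upwards [Lp.coeFn_sub (m.arg hT p r) (m.arg hT p' r'), m.arg_ae hT p r,
        m.arg_ae hT p' r'] with t h1 h2 h3
      rw [h1, Pi.sub_apply, h2, h3]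
    set Q := Lρ * δ + ‖J - J'‖ * (BV * (1 + R)) + R * (LV * (1 + R) * δ + LV * δr) with hQ
    have hQ0 : 0 ≤ Q := by positivity
    have hb : ∀ᵐ t ∂(timeMeasure T).restrict (Icc a b),
        ‖m.out hT p r J t - m.out hT p' r' J' t‖ ≤ (univ : Set ℝ).indicator (fun _ => Q) t := by
      have e1 := Lp.coeFn_sub (J (m.arg hT p r)) (J' (m.arg hT p' r'))
      -- The change of operator is measured on a bounded argument. The change of argument is
      -- measured by J' alone, to which causality applies, so that only the difference up to time b
      -- counts.
      have e2 : J (m.arg hT p r) - J' (m.arg hT p' r') =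
          (J - J') (m.arg hT p r) + J' (m.arg hT p r - m.arg hT p' r') := by
        rw [sub_apply, map_sub]; abel
      rw [e2] at e1
      filter_upwards [ae_restrict_of_ae (ae_mem_Icc T), ae_restrict_mem measurableSet_Icc,
        ae_restrict_of_ae e1, ae_restrict_of_ae (m.out_ae hT p r J),
        ae_restrict_of_ae (m.out_ae hT p' r' J'),
        ae_restrict_of_ae (Lp.coeFn_add ((J - J') (m.arg hT p r))
          (J' (m.arg hT p r - m.arg hT p' r'))),
        ae_restrict_of_ae (Lp_infty_ae_norm_le ((J - J') (m.arg hT p r))),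
        ae_restrict_of_ae (hJ'.ae_norm_le (m.arg hT p r - m.arg hT p' r') b)]
        with t h1 h2 h3 h4 h5 h6 h7 h8
      rw [indicator_of_mem (mem_univ t), h4, h5, sub_sub_sub_comm]
      have e3 : J (m.arg hT p r) t - J' (m.arg hT p' r') t =
          (J - J') (m.arg hT p r) t + J' (m.arg hT p r - m.arg hT p' r') t := by
        rw [← Pi.sub_apply, ← h3, h6, Pi.add_apply]
      rw [e3]
      have b1 := hρ _ _ ((norm_extend_le hT p t).trans hp) ((norm_extend_le hT p' t).trans hp')
      have b2 := hpp ⟨t, h1⟩ h2.2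
      rw [extend_of_mem hT p h1, extend_of_mem hT p' h1] at b1 ⊢
      have b3 := h7.trans (((J - J').le_opNorm _).trans
        (mul_le_mul_of_nonneg_left hv (norm_nonneg _)))
      have b4 := (h8 h2.2).trans (mul_le_mul hJ'R hvv ENNReal.toReal_nonneg hR)
      refine (norm_sub_le _ _).trans ((add_le_add b1 (norm_add_le _ _)).trans ?_)
      have b5 := mul_le_mul_of_nonneg_left b2 hLρ
      linarith
    -- The bound Q is uniform in time; its L³ norm over a window of length at most τ³ is at most τQ.
    have hκ : (timeMeasure T).restrict (Icc a b) univ ≤ ENNReal.ofReal (τ ^ 3) := by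
      rw [Measure.restrict_apply_univ]
      refine (Measure.restrict_apply_le _ _).trans ?_
      rw [Real.volume_Icc]
      exact ENNReal.ofReal_le_ofReal hba
    refine (eLpNorm_three_le_of_bound MeasurableSet.univ hτ hQ0 hκ hb).trans ?_
    have hj := norm_nonneg (J - J')
    rw [mul_comm _ τ, mul_assoc]
    refine mul_le_mul_of_nonneg_left ?_ hτ
    have h1 : 0 ≤ R * LV * R * δr := by positivity
    have h2 : 0 ≤ (m.C * LF * (1 + R)) * (δ + δr + ‖J - J'‖) := by positivity
    have h3 : 0 ≤ Lρ * (δr + ‖J - J'‖) := by positivity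
    have h4 : 0 ≤ BV * (1 + R) * (δ + δr) := by positivity
    have h5 : 0 ≤ R * LV * (1 + R) * ‖J - J'‖ := by positivity
    rw [hQ]
    linarith

end

end Model

/-- A contraction depending on a parameter in a Lipschitz way: the fixed point depends on the
parameter in a Lipschitz way, and lies in every closed invariant set through the origin. -/
theorem exists_fixedPoint_family {𝔇 Z : Type*} [NormedAddCommGroup 𝔇] [NormedAddCommGroup Z]
    [CompleteSpace Z] {S : Set 𝔇} {B : Set Z} (hB : IsClosed B) (h0 : (0 : Z) ∈ B)
    {Φ : 𝔇 → Z → Z} {K : ℝ} (hmap : ∀ d ∈ S, ∀ z ∈ B, Φ d z ∈ B)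
    (hlip : ∀ d ∈ S, ∀ d' ∈ S, ∀ z ∈ B, ∀ z' ∈ B,
      ‖Φ d z - Φ d' z'‖ ≤ K * ‖d - d'‖ + 1 / 2 * ‖z - z'‖) :
    ∃ sol : 𝔇 → Z, (∀ d ∈ S, Φ d (sol d) = sol d) ∧
      (∀ d ∈ S, ∀ d' ∈ S, ‖sol d - sol d'‖ ≤ 2 * K * ‖d - d'‖) ∧
      ∀ d ∈ S, ∀ A : Set Z, IsClosed A → (0 : Z) ∈ A → (∀ z ∈ A, Φ d z ∈ A) → sol d ∈ A := by
  -- The fixed point is recorded together with the convergence of the iterates from 0, through which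
  -- closed invariant sets are inherited.
  have key : ∀ d : 𝔇, ∃ z : Z, d ∈ S → z ∈ B ∧ Φ d z = z ∧
      Tendsto (fun n => (Φ d)^[n] 0) atTop (𝓝 z) := by
    intro d
    by_cases hd : d ∈ S
    · have hm : MapsTo (Φ d) B B := hmap d hd
      have hc : ContractingWith (1 / 2 : ℝ≥0) (hm.restrict (Φ d) B B) := by
        refine ⟨by norm_num, LipschitzWith.of_dist_le_mul fun x y => ?_⟩
        have := hlip d hd d hd x x.2 y y.2
        rw [sub_self, norm_zero, mul_zero, zero_add] at this
        rw [Subtype.dist_eq, Subtype.dist_eq, dist_eq_norm, dist_eq_norm]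
        simpa using this
      obtain ⟨y, hy, hfix, hlim, -⟩ :=
        ContractingWith.exists_fixedPoint' hB.isComplete hm hc h0 (edist_ne_top _ _)
      exact ⟨y, fun _ => ⟨hy, hfix, hlim⟩⟩
    · exact ⟨0, fun h => absurd h hd⟩
  choose sol hsol using key
  refine ⟨sol, fun d hd => (hsol d hd).2.1, fun d hd d' hd' => ?_, fun d hd A hA h0A hinv => ?_⟩
  · have := hlip d hd d' hd' _ (hsol d hd).1 _ (hsol d' hd').1
    rw [(hsol d hd).2.1, (hsol d' hd').2.1] at this
    linarith
  · refine hA.mem_of_tendsto (hsol d hd).2.2 (Eventually.of_forall fun n => ?_)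
    induction n with
    | zero => exact h0A
    | succ n ih => rw [Function.iterate_succ_apply']; exact hinv _ ih

set_option linter.unusedSectionVars false

/-! ### Contraction and unconditional uniqueness for the abstract system -/

namespace Model

variable {E E' G H K : Type*} [NormedAddCommGroup E] [NormedSpace ℂ E]
    [NormedAddCommGroup E'] [NormedSpace ℂ E'] [NormedAddCommGroup G] [NormedSpace ℂ G]
    [NormedAddCommGroup H] [NormedSpace ℂ H] [NormedAddCommGroup K] [NormedSpace ℂ K]
    (m : Model E E' G H K) {T : ℝ} (hT : 0 ≤ T)

variable (E G H K) in
/-- Data of the abstract system: the free evolution, the coefficients and the operator. -/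
abbrev Data (T : ℝ) : Type _ := C(Icc (0 : ℝ) T, E) × C(Icc (0 : ℝ) T, G) ×
  (Lp K (3 / 2) (timeMeasure T) →L[ℂ] Lp H ∞ (timeMeasure T))

/-- The fixed point map. -/
def step (d : Data E G H K T) (z : C(Icc (0 : ℝ) T, E) × Lp H 3 (timeMeasure T)) :
    C(Icc (0 : ℝ) T, E) × Lp H 3 (timeMeasure T) :=
  (d.1 + m.flow hT (z.1.prodMk d.2.1) z.2, m.out hT (z.1.prodMk d.2.1) z.2 d.2.2)

theorem norm_prodMk_le {A B : Type*} [NormedAddCommGroup A] [NormedAddCommGroup B]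
    {x : C(Icc (0 : ℝ) T, A)} {g : C(Icc (0 : ℝ) T, B)} {R : ℝ} (hR : 0 ≤ R) (hx : ‖x‖ ≤ R)
    (hg : ‖g‖ ≤ R) : ‖x.prodMk g‖ ≤ R :=
  (ContinuousMap.norm_le _ hR).2 fun t =>
    max_le ((x.norm_coe_le_norm t).trans hx) ((g.norm_coe_le_norm t).trans hg)

theorem restrict_Iic_self : (timeMeasure T).restrict (Iic T) = timeMeasure T := by
  rw [Measure.restrict_restrict measurableSet_Iic, inter_eq_right.2 fun t ht => ht.2]

theorem restrict_Icc_self : (timeMeasure T).restrict (Icc 0 T) = timeMeasure T := by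
  rw [Measure.restrict_restrict measurableSet_Icc, inter_self]

theorem norm_eq_eLpNorm_sub {μ : Measure ℝ} (r r' : Lp H 3 μ) :
    ‖r - r'‖ = (eLpNorm (fun t => r t - r' t) 3 μ).toReal := by
  rw [Lp.norm_def]
  exact congrArg ENNReal.toReal (eLpNorm_congr_ae (Lp.coeFn_sub r r'))

/-- The case a = 0, b = T of `exists_diff`, where agreement before time a is an empty condition. -/
theorem exists_step_sub_le {R : ℝ} (hR : 0 ≤ R) : ∃ N : ℝ, 0 ≤ N ∧ ∀ {T : ℝ} (hT : 0 ≤ T)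
    (_ : T ≤ 1) {τ : ℝ} (_ : 0 ≤ τ) (_ : τ ≤ 1) (_ : T ≤ τ ^ 3)
    {d d' : Data E G H K T} (_ : Causal d.2.2) (_ : Causal d'.2.2) (_ : ‖d.2‖ ≤ R) (_ : ‖d'.2‖ ≤ R)
    {z z' : C(Icc (0 : ℝ) T, E) × Lp H 3 (timeMeasure T)} (_ : ‖z‖ ≤ R) (_ : ‖z'‖ ≤ R),
    ‖m.flow hT (z.1.prodMk d.2.1) z.2 - m.flow hT (z'.1.prodMk d'.2.1) z'.2‖ ≤
        N * τ * (‖d.2 - d'.2‖ + ‖z - z'‖) ∧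
      ‖m.out hT (z.1.prodMk d.2.1) z.2 d.2.2 - m.out hT (z'.1.prodMk d'.2.1) z'.2 d'.2.2‖ ≤
        N * τ * (‖d.2 - d'.2‖ + ‖z - z'‖) := by
  obtain ⟨N, hN, h⟩ := m.exists_diff hR
  refine ⟨2 * N, by positivity, ?_⟩
  intro T hT hT1 τ hτ hτ1 hTτ d d' hJ hJ' hd hd' z z' hz hz'
  have e1 : ‖z.1 - z'.1‖ ≤ ‖z - z'‖ := norm_fst_le (z - z')
  have e2 : ‖z.2 - z'.2‖ ≤ ‖z - z'‖ := norm_snd_le (z - z')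
  have e3 : ‖d.2.1 - d'.2.1‖ ≤ ‖d.2 - d'.2‖ := norm_fst_le (d.2 - d'.2)
  have e4 : ‖d.2.2 - d'.2.2‖ ≤ ‖d.2 - d'.2‖ := norm_snd_le (d.2 - d'.2)
  have e5 : 0 ≤ ‖z - z'‖ := norm_nonneg _
  have e6 : 0 ≤ ‖d.2 - d'.2‖ := norm_nonneg _
  have key := h hT hT1 (a := 0) (b := T) hτ hτ1 (by simpa using hTτ) (p := z.1.prodMk d.2.1)
    (p' := z'.1.prodMk d'.2.1) (r := z.2) (r' := z'.2) hJ hJ'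
    (norm_prodMk_le hR ((norm_fst_le z).trans hz) ((norm_fst_le d.2).trans hd))
    (norm_prodMk_le hR ((norm_fst_le z').trans hz') ((norm_fst_le d'.2).trans hd'))
    ((norm_snd_le z).trans hz) ((norm_snd_le d'.2).trans hd')
    (fun t ht => absurd t.2.1 (not_le.2 ht))
    (by filter_upwards [ae_mem_Icc T] with t h1 h2 using absurd h1.1 (not_le.2 h2))
    (δ := ‖d.2 - d'.2‖ + ‖z - z'‖) (δr := ‖z - z'‖) (by positivity) (by positivity)
    (fun t _ => by
      refine max_le ?_ ?_
      · have := (z.1 - z'.1).norm_coe_le_norm t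
        exact (this.trans e1).trans (by linarith)
      · have := (d.2.1 - d'.2.1).norm_coe_le_norm t
        exact (this.trans e3).trans (by linarith))
    (by rw [restrict_Iic_self, ← norm_eq_eLpNorm_sub]; exact e2)
  have hNτ : 0 ≤ N * τ := by positivity
  constructor
  · refine (ContinuousMap.norm_le _ (by positivity)).2 fun t => (key.1 t t.2.2).trans ?_
    have := mul_nonneg hNτ e6
    linarith
  · rw [norm_eq_eLpNorm_sub]
    have := key.2
    rw [restrict_Icc_self] at this
    refine this.trans ?_
    have := mul_le_mul_of_nonneg_left e4 hNτ
    linarith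

/-- With `norm_out_zero_le`, this bounds the image of the origin; it is small on short intervals, as
the invariance of a ball requires. -/
theorem norm_flow_zero_le {τ : ℝ} (hTτ : T ≤ τ) :
    ‖m.flow hT 0 0‖ ≤ m.C * ‖m.F 0 0‖ * τ := by
  have hC := m.C_nonneg
  have hτ := hT.trans hTτ
  refine (ContinuousMap.norm_le _ (by positivity)).2 fun t => ?_
  have h1 := norm_duhInt_sub_le m.C_nonneg m.norm_D_le m.cont_D (m.integrable_force hT 0 0)
    (integrable_zero _ _ _) t.2.2
  have h2 : duhInt m.D T (0 : ℝ → E') t = 0 := by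
    simp [duhInt]
  have h3 : ∫ s in Iic T, ‖m.force hT 0 0 s - (0 : ℝ → E') s‖ ∂timeMeasure T ≤ τ * ‖m.F 0 0‖ := by
    rw [restrict_Iic_self]
    have : ∫ s, ‖m.force hT 0 0 s - (0 : ℝ → E') s‖ ∂timeMeasure T = ∫ s, ‖m.F 0 0‖ ∂timeMeasure T := by
      refine integral_congr_ae ?_
      filter_upwards [Lp.coeFn_zero H 3 (timeMeasure T)] with s hs
      rw [force, hs, Pi.zero_apply, Pi.zero_apply, sub_zero]
      rfl
    rw [this, integral_const, Measure.real, Measure.restrict_apply_univ, Real.volume_Icc, sub_zero,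
      ENNReal.toReal_ofReal hT, smul_eq_mul]
    gcongr
  rw [h2, sub_zero] at h1
  refine h1.trans ((mul_le_mul_of_nonneg_left h3 hC).trans_eq (by ring))

theorem norm_out_zero_le {τ : ℝ} (hτ : 0 ≤ τ) (hTτ : T ≤ τ ^ 3) :
    ‖m.out hT 0 0 0‖ ≤ ‖m.ρ 0‖ * τ := by
  rw [Lp.norm_def, mul_comm]
  refine eLpNorm_three_le_of_bound MeasurableSet.univ hτ (norm_nonneg _) ?_ ?_
  · rw [Measure.restrict_apply_univ, Real.volume_Icc, sub_zero]
    exact ENNReal.ofReal_le_ofReal hTτ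
  · filter_upwards [m.out_ae hT 0 0 0, Lp.coeFn_zero H ∞ (timeMeasure T)] with t h1 h2
    rw [h1, zero_apply, h2, indicator_of_mem (mem_univ t), Pi.zero_apply, sub_zero]
    exact le_rfl

/-- Local well-posedness of the abstract system. -/
theorem exists_solution [CompleteSpace E] [CompleteSpace H] {M : ℝ} (hM : 0 ≤ M) :
    ∃ T₀ : ℝ, 0 < T₀ ∧ T₀ ≤ 1 ∧ ∃ L : ℝ, ∀ {T : ℝ} (hT : 0 ≤ T) (_ : T ≤ T₀),
    ∃ sol : Data E G H K T → C(Icc (0 : ℝ) T, E) × Lp H 3 (timeMeasure T),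
      (∀ d, Causal d.2.2 → ‖d‖ ≤ M → m.step hT d (sol d) = sol d) ∧
      (∀ d, Causal d.2.2 → ‖d‖ ≤ M → ∀ d', Causal d'.2.2 → ‖d'‖ ≤ M →
        ‖sol d - sol d'‖ ≤ L * ‖d - d'‖) ∧
      ∀ d, Causal d.2.2 → ‖d‖ ≤ M → ∀ A : Set (C(Icc (0 : ℝ) T, E) × Lp H 3 (timeMeasure T)),
        IsClosed A → 0 ∈ A → (∀ z ∈ A, m.step hT d z ∈ A) → sol d ∈ A := by
  have hR : 0 ≤ M + 1 := by linarith
  obtain ⟨N, hN, h⟩ := m.exists_step_sub_le hR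
  have hC := m.C_nonneg
  -- With τ = Q⁻¹, the summand 2N makes the step a 1/2-contraction, the first three summands keep
  -- the nonlinear part of the step below 1 on the ball of radius M + 1, and the final 1 ensures τ ≤
  -- 1.
  set Q := 2 * N * (M + 1) + m.C * ‖m.F 0 0‖ + ‖m.ρ 0‖ + 2 * N + 1 with hQ
  have hQ1 : 1 ≤ Q := by
    have : 0 ≤ 2 * N * (M + 1) + m.C * ‖m.F 0 0‖ + ‖m.ρ 0‖ + 2 * N := by positivity
    linarith
  set τ := Q⁻¹ with hτ'
  have hτ : 0 < τ := by positivity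
  have hτ1 : τ ≤ 1 := inv_le_one_of_one_le₀ hQ1
  have hQτ : τ * Q = 1 := inv_mul_cancel₀ (by positivity)
  have hN2 : N * τ ≤ 1 / 2 := by
    have : 0 ≤ τ * (2 * N * (M + 1) + m.C * ‖m.F 0 0‖ + ‖m.ρ 0‖ + 1) := by positivity
    rw [hQ] at hQτ
    linarith
  refine ⟨τ ^ 3, by positivity, pow_le_one₀ hτ.le hτ1, 2 * (1 + N * τ), ?_⟩
  intro T hT hTτ
  have hTτ1 : T ≤ τ := hTτ.trans (by
    have := pow_le_pow_of_le_one hτ.le hτ1 (show 1 ≤ 3 by norm_num); simpa using this)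
  have hT1 := hTτ1.trans hτ1
  -- The free evolution contributes at most M and the nonlinear part at most 1, hence the radius M +
  -- 1.
  have hmap : ∀ d ∈ {d : Data E G H K T | Causal d.2.2 ∧ ‖d‖ ≤ M},
      ∀ z ∈ Metric.closedBall (0 : C(Icc (0 : ℝ) T, E) × Lp H 3 (timeMeasure T)) (M + 1),
      m.step hT d z ∈ Metric.closedBall 0 (M + 1) := by
    rintro d ⟨hJ, hd⟩ z hz
    rw [mem_closedBall_zero_iff] at hz ⊢
    have hd2 : ‖d.2‖ ≤ M + 1 := ((norm_snd_le d).trans hd).trans (by linarith)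
    -- The step is compared with its value at zero data and zero state, and the difference estimate
    -- requires the zero operator to be causal.
    have hJ0 : Causal (0 : Data E G H K T).2.2 := by
      intro τ w _
      filter_upwards [Lp.coeFn_zero H ∞ (timeMeasure T)] with t ht _
      exact ht
    obtain ⟨a1, a2⟩ := h hT hT1 hτ.le hτ1 hTτ hJ hJ0 hd2 (d' := 0) (by simpa using hR) hz
      (z' := 0) (by simpa using hR)
    simp only [Prod.snd_zero, sub_zero] at a1 a2
    change ‖m.flow hT (z.1.prodMk d.2.1) z.2 - m.flow hT 0 0‖ ≤ _ at a1
    change ‖m.out hT (z.1.prodMk d.2.1) z.2 d.2.2 - m.out hT 0 0 0‖ ≤ _ at a2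
    have hNτ0 : 0 ≤ N * τ := by positivity
    have a3 : N * τ * (‖d.2‖ + ‖z‖) ≤ N * τ * (2 * (M + 1)) :=
      mul_le_mul_of_nonneg_left (by linarith) hNτ0
    have a4 : 0 ≤ τ * (2 * N + 1) := by positivity
    have a5 : 0 ≤ m.C * ‖m.F 0 0‖ * τ := by positivity
    have a6 : 0 ≤ ‖m.ρ 0‖ * τ := by positivity
    have a7 : N * τ * (2 * (M + 1)) + m.C * ‖m.F 0 0‖ * τ + ‖m.ρ 0‖ * τ ≤ 1 := by
      rw [hQ] at hQτ
      linarith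
    have b1 := norm_flow_zero_le m hT hTτ1
    have b2 := norm_out_zero_le m hT hτ.le hTτ
    have c1 : ‖m.flow hT (z.1.prodMk d.2.1) z.2‖ ≤ 1 := by
      have := norm_sub_norm_le (m.flow hT (z.1.prodMk d.2.1) z.2) (m.flow hT 0 0)
      linarith
    have c2 : ‖m.out hT (z.1.prodMk d.2.1) z.2 d.2.2‖ ≤ 1 := by
      have := norm_sub_norm_le (m.out hT (z.1.prodMk d.2.1) z.2 d.2.2) (m.out hT 0 0 0)
      linarith
    refine max_le ((norm_add_le _ _).trans ?_) (c2.trans (by linarith))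
    exact add_le_add ((norm_fst_le d).trans hd) c1
  have hlip : ∀ d ∈ {d : Data E G H K T | Causal d.2.2 ∧ ‖d‖ ≤ M},
      ∀ d' ∈ {d : Data E G H K T | Causal d.2.2 ∧ ‖d‖ ≤ M},
      ∀ z ∈ Metric.closedBall (0 : C(Icc (0 : ℝ) T, E) × Lp H 3 (timeMeasure T)) (M + 1),
      ∀ z' ∈ Metric.closedBall (0 : C(Icc (0 : ℝ) T, E) × Lp H 3 (timeMeasure T)) (M + 1),
      ‖m.step hT d z - m.step hT d' z'‖ ≤ (1 + N * τ) * ‖d - d'‖ + 1 / 2 * ‖z - z'‖ := by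
    rintro d ⟨hJ, hd⟩ d' ⟨hJ', hd'⟩ z hz z' hz'
    rw [mem_closedBall_zero_iff] at hz hz'
    obtain ⟨a1, a2⟩ := h hT hT1 hτ.le hτ1 hTτ hJ hJ'
      (((norm_snd_le d).trans hd).trans (by linarith))
      (((norm_snd_le d').trans hd').trans (by linarith)) hz hz'
    have e3 : ‖d.1 - d'.1‖ ≤ ‖d - d'‖ := norm_fst_le (d - d')
    have e4 : ‖d.2 - d'.2‖ ≤ ‖d - d'‖ := norm_snd_le (d - d')
    have e5 : N * τ * ‖d.2 - d'.2‖ ≤ N * τ * ‖d - d'‖ := by gcongr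
    have e6 : N * τ * ‖z - z'‖ ≤ 1 / 2 * ‖z - z'‖ := by gcongr
    have e7 := norm_nonneg (d - d')
    refine max_le ?_ ?_
    · change ‖d.1 + _ - (d'.1 + _)‖ ≤ _
      rw [add_sub_add_comm]
      refine (norm_add_le _ _).trans ?_
      linarith
    · refine a2.trans ?_
      linarith
  obtain ⟨sol, h1, h2, h3⟩ := exists_fixedPoint_family Metric.isClosed_closedBall
    (Metric.mem_closedBall_self hR) hmap hlip
  exact ⟨sol, fun d hJ hd => h1 d ⟨hJ, hd⟩,
    fun d hJ hd d' hJ' hd' => h2 d ⟨hJ, hd⟩ d' ⟨hJ', hd'⟩, fun d hJ hd => h3 d ⟨hJ, hd⟩⟩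

/-- Unconditional uniqueness for the abstract system. -/
theorem step_unique (hT1 : T ≤ 1) {d : Data E G H K T} (hJ : Causal d.2.2)
    {z z' : C(Icc (0 : ℝ) T, E) × Lp H 3 (timeMeasure T)} (hz : m.step hT d z = z)
    (hz' : m.step hT d z' = z') : z = z' := by
  set R := max ‖d‖ (max ‖z‖ ‖z'‖) with hRdef
  have hdR : ‖d‖ ≤ R := le_max_left _ _
  have hzR : ‖z‖ ≤ R := (le_max_left _ _).trans (le_max_right _ _)
  have hzR' : ‖z'‖ ≤ R := (le_max_right _ _).trans (le_max_right _ _)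
  have hR : 0 ≤ R := (norm_nonneg d).trans hdR
  obtain ⟨N, hN, h⟩ := m.exists_diff hR
  -- Then Nτ ≤ 1/4, so that the two difference inequalities add up to δ + δr ≤ (δ + δr)/2.
  set τ := (4 * N + 1)⁻¹ with hτ'
  have hτ : 0 < τ := by positivity
  have hτ1 : τ ≤ 1 := inv_le_one_of_one_le₀ (by linarith)
  have hNτ : N * τ ≤ 1 / 4 := by
    have : τ * (4 * N + 1) = 1 := inv_mul_cancel₀ (by positivity)
    linarith
  have hd2 : ‖d.2‖ ≤ R := (norm_snd_le d).trans hdR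
  have hx : ∀ t, z.1 t = d.1 t + m.flow hT (z.1.prodMk d.2.1) z.2 t := fun t => by
    conv_lhs => rw [← hz]
    rfl
  have hx' : ∀ t, z'.1 t = d.1 t + m.flow hT (z'.1.prodMk d.2.1) z'.2 t := fun t => by
    conv_lhs => rw [← hz']
    rfl
  have hr : m.out hT (z.1.prodMk d.2.1) z.2 d.2.2 = z.2 := congrArg Prod.snd hz
  have hr' : m.out hT (z'.1.prodMk d.2.1) z'.2 d.2.2 = z'.2 := congrArg Prod.snd hz'
  -- Agreement is propagated over windows of the fixed length τ³. The length does not shrink because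
  -- N depends only on the a priori bound R for both solutions.
  have key : ∀ n : ℕ, (∀ t : Icc (0 : ℝ) T, (t : ℝ) < n * τ ^ 3 → z.1 t = z'.1 t) ∧
      ∀ᵐ t ∂timeMeasure T, t < n * τ ^ 3 → z.2 t = z'.2 t := by
    intro n
    induction n with
    | zero =>
      refine ⟨fun t ht => absurd t.2.1 (not_le.2 (by simpa using ht)), ?_⟩
      filter_upwards [ae_mem_Icc T] with t h1 h2
      exact absurd h1.1 (not_le.2 (by simpa using h2))
    | succ n ih =>
      set a := (n : ℝ) * τ ^ 3 with ha
      set b := ((n + 1 : ℕ) : ℝ) * τ ^ 3 with hb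
      have ha0 : 0 ≤ a := by positivity
      have hb0 : 0 ≤ b := by positivity
      have hba : b - a ≤ τ ^ 3 := by rw [ha, hb]; push_cast; linarith
      have hcpt : IsCompact {t : Icc (0 : ℝ) T | (t : ℝ) ≤ b} :=
        (isClosed_le continuous_subtype_val continuous_const).isCompact
      -- The supremum of the difference up to time b is attained at t₀, so the pointwise estimate
      -- there closes on δ itself.
      obtain ⟨t₀, ht₀, hmax⟩ := hcpt.exists_isMaxOn ⟨⟨0, le_rfl, hT⟩, hb0⟩
        (f := fun t => ‖z.1 t - z'.1 t‖) (by fun_prop)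
      set δ := ‖z.1 t₀ - z'.1 t₀‖ with hδ
      set ν := (timeMeasure T).restrict (Iic b) with hν
      set δr := (eLpNorm (fun t => z.2 t - z'.2 t) 3 ν).toReal with hδr
      have hmem : MemLp (fun t => z.2 t - z'.2 t) 3 ν :=
        ((Lp.memLp z.2).sub (Lp.memLp z'.2)).restrict _
      obtain ⟨k1, k2⟩ := h hT hT1 (a := a) (b := b) hτ.le hτ1 hba (p := z.1.prodMk d.2.1)
        (p' := z'.1.prodMk d.2.1) (r := z.2) (r' := z'.2) hJ hJ
        (norm_prodMk_le hR ((norm_fst_le z).trans hzR) ((norm_fst_le d.2).trans hd2))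
        (norm_prodMk_le hR ((norm_fst_le z').trans hzR') ((norm_fst_le d.2).trans hd2))
        ((norm_snd_le z).trans hzR) ((norm_snd_le d.2).trans hd2)
        (fun t ht => by
          change (z.1 t, d.2.1 t) = (z'.1 t, d.2.1 t)
          rw [ih.1 t ht]) ih.2
        (δ := δ) (δr := δr) (norm_nonneg _) ENNReal.toReal_nonneg
        (fun t ht => by
          change ‖(z.1 t, d.2.1 t) - (z'.1 t, d.2.1 t)‖ ≤ δ
          rw [Prod.mk_sub_mk, sub_self, Prod.norm_mk, norm_zero, max_eq_left (norm_nonneg _)]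
          exact hmax ht) le_rfl
      have k1' : δ ≤ N * τ * (δ + δr) := by
        have := k1 t₀ ht₀
        rwa [← add_sub_add_left_eq_sub _ _ (d.1 t₀), ← hx, ← hx'] at this
      have k2' : δr ≤ N * τ * (δ + δr) := by
        rw [hr, hr', sub_self, norm_zero, add_zero] at k2
        refine le_trans (le_of_eq ?_) k2
        -- By induction the difference vanishes before a, so its norm up to time b equals its norm
        -- over [a,b].
        have e1 : (timeMeasure T).restrict (Icc a b) = ν.restrict (Icc a b) := by
          rw [hν, Measure.restrict_restrict (s := Icc a b) (t := Iic b) measurableSet_Icc,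
            inter_eq_left.2 (show Icc a b ⊆ Iic b from fun t ht => ht.2)]
        rw [hδr, e1, ← eLpNorm_indicator_eq_eLpNorm_restrict measurableSet_Icc]
        congr 1
        refine eLpNorm_congr_ae ?_
        filter_upwards [ae_restrict_of_ae ih.2, ae_restrict_mem measurableSet_Iic] with t h1 h2
        by_cases h3 : t ∈ Icc a b
        · rw [indicator_of_mem h3]
        · rw [indicator_of_notMem h3, h1 (not_le.1 fun h => h3 ⟨h, h2⟩), sub_self]
      have hδ0 : 0 ≤ δ := norm_nonneg _
      have hδr0 : 0 ≤ δr := ENNReal.toReal_nonneg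
      have hfin : N * τ * (δ + δr) ≤ 1 / 4 * (δ + δr) := by gcongr
      have hδz : δ = 0 := by linarith
      have hδrz : δr = 0 := by linarith
      constructor
      · intro t ht
        have h1 : ‖z.1 t - z'.1 t‖ ≤ δ := hmax (show t ∈ {t : Icc (0 : ℝ) T | (t : ℝ) ≤ b} from ht.le)
        rw [hδz] at h1
        exact sub_eq_zero.1 (norm_le_zero_iff.1 h1)
      · have h1 : eLpNorm (fun t => z.2 t - z'.2 t) 3 ν = 0 := by
          rcases (ENNReal.toReal_eq_zero_iff _).1 hδrz with h | h
          · exact h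
          · exact absurd h hmem.2.ne
        rw [eLpNorm_eq_zero_iff hmem.1 (by norm_num), hν, Filter.EventuallyEq,
          ae_restrict_iff' measurableSet_Iic] at h1
        filter_upwards [h1] with t h1 ht
        exact sub_eq_zero.1 (h1 ht.le)
  obtain ⟨n, hn⟩ := exists_nat_gt (T / τ ^ 3)
  rw [div_lt_iff₀ (by positivity)] at hn
  refine Prod.ext (ContinuousMap.ext fun t => (key n).1 t (t.2.2.trans_lt hn)) (Lp.ext ?_)
  filter_upwards [(key n).2, ae_mem_Icc T] with t h1 h2
  exact h1 (h2.2.trans_lt hn)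

end Model

set_option linter.unusedSectionVars false

/-! ### Real subspaces -/

/-- A set cut out by real-linear continuous equations. -/
def IsRealSet {E : Type*} [NormedAddCommGroup E] [NormedSpace ℂ E] (S : Set E) : Prop :=
  ∃ (ι : Type) (Λ : ι → E →L[ℝ] ℂ), S = {e | ∀ i, Λ i e = 0}

namespace IsRealSet

variable {E E' : Type*} [NormedAddCommGroup E] [NormedSpace ℂ E] [NormedAddCommGroup E']
  [NormedSpace ℂ E'] {S : Set E} {S' : Set E'}

theorem isClosed (hS : IsRealSet S) : IsClosed S := by
  obtain ⟨ι, Λ, rfl⟩ := hS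
  rw [ofPred_forall]
  exact isClosed_iInter fun i => isClosed_eq (Λ i).continuous continuous_const

theorem zero_mem (hS : IsRealSet S) : (0 : E) ∈ S := by
  obtain ⟨ι, Λ, rfl⟩ := hS
  exact fun i => map_zero _

theorem add_mem (hS : IsRealSet S) {x y : E} (hx : x ∈ S) (hy : y ∈ S) : x + y ∈ S := by
  obtain ⟨ι, Λ, rfl⟩ := hS
  exact fun i => by rw [map_add, hx i, hy i, add_zero]

theorem sub_mem (hS : IsRealSet S) {x y : E} (hx : x ∈ S) (hy : y ∈ S) : x - y ∈ S := by
  obtain ⟨ι, Λ, rfl⟩ := hS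
  exact fun i => by rw [map_sub, hx i, hy i, sub_zero]

theorem prod (hS : IsRealSet S) (hS' : IsRealSet S') : IsRealSet (S ×ˢ S') := by
  obtain ⟨ι, Λ, rfl⟩ := hS
  obtain ⟨ι', Λ', rfl⟩ := hS'
  refine ⟨ι ⊕ ι', Sum.elim (fun i => (Λ i).comp (ContinuousLinearMap.fst ℝ E E'))
    (fun i => (Λ' i).comp (ContinuousLinearMap.snd ℝ E E')), ?_⟩
  ext ⟨x, y⟩
  simp only [mem_prod, mem_ofPred_eq, Sum.forall, Sum.elim_inl, Sum.elim_inr,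
    ContinuousLinearMap.comp_apply, ContinuousLinearMap.coe_fst', ContinuousLinearMap.coe_snd']

theorem integral_mem [CompleteSpace E] (hS : IsRealSet S) {α : Type*} [MeasurableSpace α]
    {μ : Measure α} {f : α → E} (hf : Integrable f μ) (h : ∀ᵐ a ∂μ, f a ∈ S) :
    ∫ a, f a ∂μ ∈ S := by
  obtain ⟨ι, Λ, rfl⟩ := hS
  intro i
  rw [← ContinuousLinearMap.integral_comp_comm _ hf]
  refine integral_eq_zero_of_ae ?_
  filter_upwards [h] with a ha using ha i

end IsRealSet

/-- Almost everywhere membership in a closed set is a closed condition in `L^q`. -/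
theorem isClosed_setOf_ae_mem {α H : Type*} [MeasurableSpace α] {μ : Measure α}
    [NormedAddCommGroup H] {q : ℝ≥0∞} [Fact (1 ≤ q)] {S : Set H} (hS : IsClosed S) :
    IsClosed {r : Lp H q μ | ∀ᵐ t ∂μ, r t ∈ S} := by
  refine isClosed_of_closure_subset fun r hr => ?_
  obtain ⟨u, hu, hlim⟩ := mem_closure_iff_seq_limit.1 hr
  obtain ⟨ns, -, hns⟩ := (tendstoInMeasure_of_tendsto_Lp hlim).exists_seq_tendsto_ae
  filter_upwards [hns, ae_all_iff.2 hu] with t h1 h2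
  exact hS.mem_of_tendsto h1 (Eventually.of_forall fun n => h2 _)

/-- Transfers properties valid a.e. on [0,T] to the filter of times tending to 0+ off null sets,
which expresses the initial condition for ℜ. -/
theorem eventually_nhdsGT_inf_ae {T : ℝ} (hT : 0 < T) {P : ℝ → Prop}
    (h : ∀ᵐ t ∂timeMeasure T, P t) {b : ℝ} (hb : 0 < b) :
    ∀ᶠ t in 𝓝[>] 0 ⊓ ae volume, P t ∧ t ∈ Icc (0 : ℝ) T ∧ t ≤ b := by
  have h1 : ∀ᵐ t : ℝ, t ∈ Icc (0 : ℝ) T → P t := (ae_restrict_iff' measurableSet_Icc).1 h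
  have h2 : ∀ᶠ t in 𝓝[>] (0 : ℝ), t ∈ Icc (0 : ℝ) T ∧ t ≤ b := by
    filter_upwards [Ioc_mem_nhdsGT hT, Ioc_mem_nhdsGT hb] with t h1 h2
    exact ⟨⟨h1.1.le, h1.2⟩, h2.2⟩
  filter_upwards [h1.filter_mono inf_le_right, h2.filter_mono inf_le_left] with t h3 h4
  exact ⟨h3 h4.1, h4⟩

/-- The output of a causal operator vanishes at the initial time. -/
theorem Causal.tendsto_zero {K H : Type*} [NormedAddCommGroup K] [NormedSpace ℂ K]
    [NormedAddCommGroup H] [NormedSpace ℂ H] {T : ℝ} (hT : 0 < T)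
    {J : Lp K (3 / 2) (timeMeasure T) →L[ℂ] Lp H ∞ (timeMeasure T)} (hJ : Causal J)
    (w : Lp K (3 / 2) (timeMeasure T)) :
    Tendsto (fun t => ‖J w t‖) (𝓝[>] 0 ⊓ ae volume) (𝓝 0) := by
  rw [Metric.tendsto_nhds]
  intro e he
  set e' := e / (2 * (‖J‖ + 1)) with he'
  have hJ0 : 0 < ‖J‖ + 1 := by positivity
  -- Absolute continuity of the `L^{3/2}` norm: w has small norm on [0,δ], and by causality so does
  -- the output there, in the supremum norm.
  obtain ⟨δ, hδ, h⟩ := (Lp.memLp w).eLpNorm_indicator_le Fact.out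
    (by norm_num [ENNReal.div_eq_top]) (show 0 < e' by positivity)
  have h1 := h (Iic δ) measurableSet_Iic (by
    rw [Measure.restrict_apply measurableSet_Iic]
    refine (measure_mono (t := Icc 0 δ) fun t ht => ⟨ht.2.1, ht.1⟩).trans ?_
    rw [Real.volume_Icc, sub_zero])
  rw [eLpNorm_indicator_eq_eLpNorm_restrict measurableSet_Iic] at h1
  have h2 : (eLpNorm w (3 / 2) ((timeMeasure T).restrict (Iic δ))).toReal ≤ e' := by
    rw [← ENNReal.toReal_ofReal (show 0 ≤ e' by positivity)]
    exact ENNReal.toReal_mono ENNReal.ofReal_ne_top h1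
  filter_upwards [eventually_nhdsGT_inf_ae hT (hJ.ae_norm_le w δ) hδ] with t ht
  rw [Real.dist_eq, sub_zero, abs_of_nonneg (norm_nonneg _)]
  refine (ht.1 ht.2.2).trans_lt ?_
  have h3 : ‖J‖ * e' < (‖J‖ + 1) * e' := by
    have : 0 < e' := by positivity
    linarith
  have h4 : (‖J‖ + 1) * e' = e / 2 := by rw [he']; field_simp
  have h5 := mul_le_mul_of_nonneg_left h2 (norm_nonneg J)
  linarith

/-! ### Invariant sets of states, and the vanishing of r at the initial time -/

namespace Model

variable {E E' G H K : Type*} [NormedAddCommGroup E] [NormedSpace ℂ E]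
    [NormedAddCommGroup E'] [NormedSpace ℂ E'] [NormedAddCommGroup G] [NormedSpace ℂ G]
    [NormedAddCommGroup H] [NormedSpace ℂ H] [NormedAddCommGroup K] [NormedSpace ℂ K]
    (m : Model E E' G H K) {T : ℝ} (hT : 0 ≤ T)

/-- States with values in given sets. -/
def valuedIn (T : ℝ) (SE : Set E) (SH : Set H) :
    Set (C(Icc (0 : ℝ) T, E) × Lp H 3 (timeMeasure T)) :=
  {z | (∀ t, z.1 t ∈ SE) ∧ ∀ᵐ t ∂timeMeasure T, z.2 t ∈ SH}

theorem isClosed_valuedIn {SE : Set E} {SH : Set H} (hE : IsClosed SE) (hH : IsClosed SH) :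
    IsClosed (valuedIn T SE SH) := by
  refine IsClosed.inter ?_ ((isClosed_setOf_ae_mem hH).preimage continuous_snd)
  have : {z : C(Icc (0 : ℝ) T, E) × Lp H 3 (timeMeasure T) | ∀ t, z.1 t ∈ SE} =
      ⋂ t, {z | z.1 t ∈ SE} := by ext; simp
  change IsClosed {z : C(Icc (0 : ℝ) T, E) × Lp H 3 (timeMeasure T) | ∀ t, z.1 t ∈ SE}
  rw [this]
  exact isClosed_iInter fun t =>
    hE.preimage ((continuous_eval_const t).comp continuous_fst)

theorem zero_mem_valuedIn {SE : Set E} {SH : Set H} (hE : IsRealSet SE) (hH : IsRealSet SH) :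
    0 ∈ valuedIn T SE SH := by
  refine ⟨fun _ => hE.zero_mem, ?_⟩
  filter_upwards [Lp.coeFn_zero H 3 (timeMeasure T)] with t ht
  change (0 : Lp H 3 (timeMeasure T)) t ∈ _
  rw [ht]
  exact hH.zero_mem

theorem step_mem_valuedIn [CompleteSpace E] {SE : Set E} {SE' : Set E'} {SG : Set G} {SH : Set H}
    {SK : Set K} (hSE : IsRealSet SE) (hSH : IsRealSet SH)
    (hD : ∀ t, ∀ e ∈ SE', m.D t e ∈ SE)
    (hF : ∀ x ∈ SE, ∀ g ∈ SG, ∀ r ∈ SH, m.F (x, g) r ∈ SE')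
    (hV : ∀ x ∈ SE, ∀ g ∈ SG, ∀ r ∈ SH, m.V (x, g) r ∈ SK)
    (hρ : ∀ x ∈ SE, ∀ g ∈ SG, m.ρ (x, g) ∈ SH) {d : Data E G H K T}
    (hl : ∀ t, d.1 t ∈ SE) (hg : ∀ t, d.2.1 t ∈ SG)
    (hJ : ∀ w : Lp K (3 / 2) (timeMeasure T), (∀ᵐ t ∂timeMeasure T, w t ∈ SK) →
      ∀ᵐ t ∂timeMeasure T, d.2.2 w t ∈ SH)
    {z : C(Icc (0 : ℝ) T, E) × Lp H 3 (timeMeasure T)} (hz : z ∈ valuedIn T SE SH) :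
    m.step hT d z ∈ valuedIn T SE SH := by
  obtain ⟨hz1, hz2⟩ := hz
  constructor
  · intro t
    refine hSE.add_mem (hl t) (hSE.integral_mem
      (integrable_duh m.C_nonneg m.norm_D_le m.cont_D (m.integrable_force hT _ _) _) ?_)
    filter_upwards [hz2] with s hs
    by_cases h : s ∈ Iic (t : ℝ)
    · rw [indicator_of_mem h]
      exact hD _ _ (hF _ (hz1 _) _ (hg _) _ hs)
    · rw [indicator_of_notMem h]
      exact hSE.zero_mem
  · have h1 := hJ (m.arg hT (z.1.prodMk d.2.1) z.2) (by
      filter_upwards [m.arg_ae hT (z.1.prodMk d.2.1) z.2, hz2] with t h1 h2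
      rw [h1]
      exact hV _ (hz1 _) _ (hg _) _ h2)
    filter_upwards [m.out_ae hT (z.1.prodMk d.2.1) z.2 d.2.2, h1] with t h2 h3
    change m.out hT (z.1.prodMk d.2.1) z.2 d.2.2 t ∈ SH
    rw [h2]
    exact hSH.sub_mem (hρ _ (hz1 _) _ (hg _)) h3

/-- For a solution with `ρ = 0` at the initial time, the component `r` vanishes there. -/
theorem tendsto_of_step_eq (hT' : 0 < T) {d : Data E G H K T} (hJ : Causal d.2.2)
    {z : C(Icc (0 : ℝ) T, E) × Lp H 3 (timeMeasure T)} (hz : m.step hT d z = z)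
    (h0 : m.ρ (z.1 ⟨0, le_rfl, hT⟩, d.2.1 ⟨0, le_rfl, hT⟩) = 0) :
    Tendsto (fun t => ‖z.2 t‖) (𝓝[>] 0 ⊓ ae volume) (𝓝 0) := by
  have hz2 : m.out hT (z.1.prodMk d.2.1) z.2 d.2.2 = z.2 := congrArg Prod.snd hz
  have h1 := m.out_ae hT (z.1.prodMk d.2.1) z.2 d.2.2
  rw [hz2] at h1
  have h2 : Tendsto (fun t => ‖m.ρ (extend hT (z.1.prodMk d.2.1) t)‖ +
      ‖d.2.2 (m.arg hT (z.1.prodMk d.2.1) z.2) t‖) (𝓝[>] 0 ⊓ ae volume) (𝓝 0) := by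
    suffices h : Tendsto (fun t => ‖m.ρ (extend hT (z.1.prodMk d.2.1) t)‖)
        (𝓝[>] 0 ⊓ ae volume) (𝓝 0) by
      simpa using h.add (hJ.tendsto_zero hT' (m.arg hT (z.1.prodMk d.2.1) z.2))
    have h3 : Continuous fun t => ‖m.ρ (extend hT (z.1.prodMk d.2.1) t)‖ :=
      (m.lip_ρ.continuous.comp (continuous_extend hT _)).norm
    have h4 := h3.tendsto 0
    rw [extend_of_mem hT _ (show (0 : ℝ) ∈ Icc 0 T from ⟨le_rfl, hT⟩)] at h4
    change Tendsto _ _ (𝓝 ‖m.ρ (z.1 ⟨0, le_rfl, hT⟩, d.2.1 ⟨0, le_rfl, hT⟩)‖) at h4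
    rw [h0, norm_zero] at h4
    exact h4.mono_left (inf_le_left.trans nhdsWithin_le_nhds)
  refine squeeze_zero' (Eventually.of_forall fun _ => norm_nonneg _) ?_ h2
  filter_upwards [eventually_nhdsGT_inf_ae hT' h1 one_pos] with t ht
  rw [ht.1]
  exact norm_sub_le _ _

end Model

/-! ### The damped wave propagators on Sobolev spaces -/

/-- A uniformly bounded family of Fourier multipliers with continuous symbols is strongly
continuous. -/
theorem exists_multiplier_family {s s' C : ℝ} (hC : 0 ≤ C) (μ : ℝ → Coef)
    (h : ∀ t n, ‖μ t n‖ * jap n ^ (s' - s) ≤ C) (hμ : ∀ n, Continuous fun t => μ t n) :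
    ∃ M : ℝ → Sob s 2 →L[ℂ] Sob s' 2, (∀ t f n, (M t f).coeff n = μ t n * f.coeff n) ∧
      (∀ t, ‖M t‖ ≤ C) ∧ Continuous fun p : ℝ × Sob s 2 => M p.1 p.2 := by
  choose M hM hMC using fun t => exists_multiplier hC (μ t) (h t)
  refine ⟨M, hM, hMC, ?_⟩
  -- Strong continuity by dominated convergence in the sum over frequencies; operator-norm
  -- continuity is not available from pointwise continuity of the symbols.
  have strong : ∀ (t₀ : ℝ) (f : Sob s 2), Tendsto (fun t => ‖M t f - M t₀ f‖) (𝓝 t₀) (𝓝 0) := by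
    intro t₀ f
    have hr : ∀ t n, ‖Sob.repr s' (M t f - M t₀ f) n‖ =
        ‖μ t n - μ t₀ n‖ * jap n ^ (s' - s) * ‖Sob.repr s f n‖ := by
      intro t n
      have hj : jap n ^ s' = jap n ^ (s' - s) * jap n ^ s := by
        rw [← Real.rpow_add (jap_pos n), sub_add_cancel]
      rw [Sob.repr_apply, Sob.coeff_sub, Pi.sub_apply, hM, hM, ← sub_mul, norm_mul, norm_mul,
        Sob.repr_apply, norm_mul, norm_jap_rpow, norm_jap_rpow, hj]
      ring
    have hsq : ∀ t, ‖M t f - M t₀ f‖ ^ 2 =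
        ∑' n, (‖μ t n - μ t₀ n‖ * jap n ^ (s' - s) * ‖Sob.repr s f n‖) ^ 2 := by
      intro t
      rw [← (Sob.repr s').norm_map, SqSum.norm_sq_eq]
      exact tsum_congr fun n => by rw [hr]
    have hlim : Tendsto (fun t => ‖M t f - M t₀ f‖ ^ 2) (𝓝 t₀) (𝓝 0) := by
      simp only [hsq]
      rw [← tsum_zero (α := ℝ) (β := Freq)]
      refine tendsto_tsum_of_dominated_convergence
        (bound := fun n => (2 * C) ^ 2 * ‖Sob.repr s f n‖ ^ 2)
        ((SqSum.summable_sq _).mul_left _) (fun n => ?_) (Eventually.of_forall fun t n => ?_)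
      · have hc : Continuous fun t => (‖μ t n - μ t₀ n‖ * jap n ^ (s' - s) *
            ‖Sob.repr s f n‖) ^ 2 := by
          have := hμ n
          fun_prop
        simpa using hc.tendsto t₀
      · have hp : 0 ≤ jap n ^ (s' - s) := Real.rpow_nonneg (jap_pos n).le _
        rw [Real.norm_of_nonneg (by positivity), ← mul_pow]
        have h1 := mul_le_mul_of_nonneg_right (norm_sub_le (μ t n) (μ t₀ n)) hp
        refine pow_le_pow_left₀ (by positivity)
          (mul_le_mul_of_nonneg_right ?_ (norm_nonneg _)) _
        linarith [h t n, h t₀ n]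
    have := hlim.sqrt
    simpa using this
  rw [continuous_iff_continuousAt]
  rintro ⟨t₀, f₀⟩
  rw [ContinuousAt, tendsto_iff_norm_sub_tendsto_zero]
  have h1 : Tendsto (fun p : ℝ × Sob s 2 => C * ‖p.2 - f₀‖ + ‖M p.1 f₀ - M t₀ f₀‖) (𝓝 (t₀, f₀))
      (𝓝 0) := by
    have e1 : Tendsto (fun p : ℝ × Sob s 2 => C * ‖p.2 - f₀‖) (𝓝 (t₀, f₀)) (𝓝 0) := by
      have : Continuous fun p : ℝ × Sob s 2 => C * ‖p.2 - f₀‖ := by fun_prop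
      simpa using this.tendsto (t₀, f₀)
    simpa using e1.add ((strong t₀ f₀).comp (continuous_fst.tendsto (t₀, f₀)))
  refine squeeze_zero (fun _ => norm_nonneg _) (fun p => ?_) h1
  -- Joint continuity follows from strong continuity at the fixed f₀ and the uniform bound for the
  -- change of f.
  have e : M p.1 p.2 - M t₀ f₀ = M p.1 (p.2 - f₀) + (M p.1 f₀ - M t₀ f₀) := by
    rw [map_sub]; abel
  dsimp only
  rw [e]
  exact (norm_add_le _ _).trans (add_le_add ((M p.1).le_of_opNorm_le (hMC _) _) le_rfl)

theorem jbb_pos (n : Freq) : 0 < jbb n := Real.sqrt_pos.2 (by positivity)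

theorem jbb_sq (n : Freq) : jbb n ^ 2 = 3 / 4 + nrm n ^ 2 := Real.sq_sqrt (by positivity)

/-- The constant 3/4 keeps ⟦n⟧ away from 0 at the zero mode, so dividing by ⟦n⟧ gains a full
derivative uniformly in n. -/
theorem jap_le_two_mul_jbb (n : Freq) : jap n ≤ 2 * jbb n := by
  refine le_of_sq_le_sq ?_ (by have := jbb_pos n; positivity)
  rw [mul_pow, jbb_sq, jap_sq]
  nlinarith [sq_nonneg (nrm n)]

/-- The derivative of `waveSym`. -/
def waveSym' (n : Freq) (t : ℝ) : ℝ :=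
  Real.exp (-t / 2) * (Real.cos (t * jbb n) - Real.sin (t * jbb n) / (2 * jbb n))

theorem hasDerivAt_waveSym (n : Freq) (t : ℝ) : HasDerivAt (waveSym n) (waveSym' n t) t := by
  have hj := (jbb_pos n).ne'
  have h1 : HasDerivAt (fun t : ℝ => Real.exp (-t / 2)) (Real.exp (-t / 2) * (-1 / 2)) t :=
    (((hasDerivAt_id t).neg.div_const 2).exp).congr_deriv rfl
  have h2 : HasDerivAt (fun t : ℝ => Real.sin (t * jbb n) / jbb n)
      (Real.cos (t * jbb n) * (1 * jbb n) / jbb n) t :=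
    ((((hasDerivAt_id t).mul_const (jbb n)).sin).div_const _)
  refine (h1.mul h2).congr_deriv ?_
  rw [waveSym']
  field_simp
  ring

theorem deriv_waveSym (n : Freq) (t : ℝ) : deriv (waveSym n) t = waveSym' n t :=
  (hasDerivAt_waveSym n t).deriv

/-- The damped oscillator w'' + w' + ⟨n⟩² w = 0, because ⟨n⟩² = 1/4 + ⟦n⟧². -/
theorem hasDerivAt_waveSym' (n : Freq) (t : ℝ) :
    HasDerivAt (waveSym' n) (-waveSym' n t - jap n ^ 2 * waveSym n t) t := by
  have hj := (jbb_pos n).ne'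
  have h1 : HasDerivAt (fun t : ℝ => Real.exp (-t / 2)) (Real.exp (-t / 2) * (-1 / 2)) t :=
    (((hasDerivAt_id t).neg.div_const 2).exp).congr_deriv rfl
  have h2 : HasDerivAt (fun t : ℝ => Real.sin (t * jbb n) / (2 * jbb n))
      (Real.cos (t * jbb n) * (1 * jbb n) / (2 * jbb n)) t :=
    ((((hasDerivAt_id t).mul_const (jbb n)).sin).div_const _)
  have h3 : HasDerivAt (fun t : ℝ => Real.cos (t * jbb n))
      (-Real.sin (t * jbb n) * (1 * jbb n)) t := ((hasDerivAt_id t).mul_const (jbb n)).cos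
  refine (h1.mul (h3.sub h2)).congr_deriv ?_
  have h4 : jap n ^ 2 = 1 / 4 + jbb n ^ 2 := by rw [jbb_sq, jap_sq]; ring
  rw [waveSym', waveSym, h4, Pi.sub_apply]
  field_simp
  ring

theorem continuous_waveSym (n : Freq) : Continuous (waveSym n) :=
  continuous_iff_continuousAt.2 fun t => (hasDerivAt_waveSym n t).continuousAt

theorem continuous_waveSym' (n : Freq) : Continuous (waveSym' n) :=
  continuous_iff_continuousAt.2 fun t => (hasDerivAt_waveSym' n t).continuousAt

theorem waveSym_zero (n : Freq) : waveSym n 0 = 0 := by simp [waveSym]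

theorem waveSym'_zero (n : Freq) : waveSym' n 0 = 1 := by simp [waveSym']

theorem abs_waveSym_mul_jap_le (n : Freq) {t : ℝ} (ht : 0 ≤ t) : |waveSym n t| * jap n ≤ 2 := by
  have hj := jbb_pos n
  have h1 : Real.exp (-t / 2) ≤ 1 := Real.exp_le_one_iff.2 (by linarith)
  rw [waveSym, abs_mul, abs_div, abs_of_pos hj, abs_of_pos (Real.exp_pos _)]
  calc _ ≤ 1 * (1 / jbb n) * (2 * jbb n) := by
        have h0 := (jap_pos n).le
        have h2 := Real.abs_sin_le_one (t * jbb n)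
        have h3 := jap_le_two_mul_jbb n
        gcongr
    _ = 2 := by field_simp

theorem abs_waveSym'_le (n : Freq) {t : ℝ} (ht : 0 ≤ t) : |waveSym' n t| ≤ 2 := by
  have hj := jbb_pos n
  have hj1 : 1 ≤ 2 * jbb n := (one_le_jap n).trans (jap_le_two_mul_jbb n)
  have h1 : Real.exp (-t / 2) ≤ 1 := Real.exp_le_one_iff.2 (by linarith)
  rw [waveSym', abs_mul, abs_of_pos (Real.exp_pos _)]
  have h2 : |Real.cos (t * jbb n) - Real.sin (t * jbb n) / (2 * jbb n)| ≤ 1 + 1 := by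
    refine (abs_sub _ _).trans (add_le_add (Real.abs_cos_le_one _) ?_)
    rw [abs_div, abs_of_pos (show 0 < 2 * jbb n by positivity)]
    exact div_le_one_of_le₀ ((Real.abs_sin_le_one _).trans hj1) (by positivity)
  calc _ ≤ 1 * ((1 : ℝ) + 1) := mul_le_mul h1 h2 (abs_nonneg _) zero_le_one
    _ = 2 := by norm_num

/-- The symbols are frozen at `max t 0`, since e^{-t/2} is unbounded for negative times. The Duhamel
integral only sees t - s ≥ 0, and uniform bounds for all real t suit the abstract model. -/
theorem exists_waveProp (s : ℝ) : ∃ D : ℝ → Sob (s - 1) 2 →L[ℂ] Sob s 2 × Sob (s - 1) 2,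
    (∀ t f n, (D t f).1.coeff n = (waveSym n (max t 0) : ℂ) * f.coeff n) ∧
    (∀ t f n, (D t f).2.coeff n = (waveSym' n (max t 0) : ℂ) * f.coeff n) ∧
    (∀ t, ‖D t‖ ≤ 2) ∧ Continuous fun p : ℝ × Sob (s - 1) 2 => D p.1 p.2 := by
  obtain ⟨A, hA, hA2, hAc⟩ := exists_multiplier_family (s := s - 1) (s' := s) (C := 2) (by norm_num)
    (fun t n => (waveSym n (max t 0) : ℂ)) (fun t n => by
      rw [sub_sub_cancel, Real.rpow_one, Complex.norm_real]
      exact abs_waveSym_mul_jap_le n (le_max_right _ _))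
    (fun n => Complex.continuous_ofReal.comp
      ((continuous_waveSym n).comp (continuous_id.max continuous_const)))
  obtain ⟨B, hB, hB2, hBc⟩ := exists_multiplier_family (s := s - 1) (s' := s - 1) (C := 2)
    (by norm_num) (fun t n => (waveSym' n (max t 0) : ℂ)) (fun t n => by
      rw [sub_self, Real.rpow_zero, mul_one, Complex.norm_real]
      exact abs_waveSym'_le n (le_max_right _ _))
    (fun n => Complex.continuous_ofReal.comp
      ((continuous_waveSym' n).comp (continuous_id.max continuous_const)))
  refine ⟨fun t => (A t).prod (B t), hA, hB, fun t => ?_, hAc.prodMk hBc⟩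
  refine ContinuousLinearMap.opNorm_le_bound _ (by norm_num) fun f => ?_
  exact max_le ((A t).le_of_opNorm_le (hA2 t) f) ((B t).le_of_opNorm_le (hB2 t) f)

/-- The second component is the time derivative of the first: in differentiating w' f + w (f + g)
with w'' = -w' - ⟨n⟩² w, the terms ±w' f cancel. The bound 6 is 4 + 2, from the two entries of the
first row. -/
theorem exists_freeProp (s : ℝ) : ∃ D : ℝ → (Sob s 2 × Sob (s - 1) 2) →L[ℂ] Sob s 2 × Sob (s - 1) 2,
    (∀ t f n, (D t f).1.coeff n = (waveSym' n (max t 0) : ℂ) * f.1.coeff n +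
      (waveSym n (max t 0) : ℂ) * (f.1.coeff n + f.2.coeff n)) ∧
    (∀ t f n, (D t f).2.coeff n = -((jap n ^ 2 * waveSym n (max t 0) : ℝ) : ℂ) * f.1.coeff n +
      (waveSym' n (max t 0) : ℂ) * f.2.coeff n) ∧
    (∀ t, ‖D t‖ ≤ 6) ∧
    Continuous fun p : ℝ × (Sob s 2 × Sob (s - 1) 2) => D p.1 p.2 := by
  have c1 : ∀ n, Continuous fun t : ℝ => waveSym n (max t 0) := fun n =>
    (continuous_waveSym n).comp (continuous_id.max continuous_const)
  have c2 : ∀ n, Continuous fun t : ℝ => waveSym' n (max t 0) := fun n =>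
    (continuous_waveSym' n).comp (continuous_id.max continuous_const)
  have b1 : ∀ n t, |waveSym n (max t 0)| * jap n ≤ 2 := fun n t =>
    abs_waveSym_mul_jap_le n (le_max_right _ _)
  have b2 : ∀ n t, |waveSym' n (max t 0)| ≤ 2 := fun n t => abs_waveSym'_le n (le_max_right _ _)
  obtain ⟨A, hA, hA2, hAc⟩ := exists_multiplier_family (s := s) (s' := s) (C := 4) (by norm_num)
    (fun t n => ((waveSym' n (max t 0) + waveSym n (max t 0) : ℝ) : ℂ)) (fun t n => by
      rw [sub_self, Real.rpow_zero, mul_one, Complex.norm_real, Real.norm_eq_abs]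
      have h1 := abs_add_le (waveSym' n (max t 0)) (waveSym n (max t 0))
      have h2 := le_mul_of_one_le_right (abs_nonneg (waveSym n (max t 0))) (one_le_jap n)
      linarith [b1 n t, b2 n t])
    (fun n => Complex.continuous_ofReal.comp ((c2 n).add (c1 n)))
  obtain ⟨A', hA', hA2', hAc'⟩ := exists_multiplier_family (s := s - 1) (s' := s) (C := 2)
    (by norm_num)
    (fun t n => (waveSym n (max t 0) : ℂ)) (fun t n => by
      rw [sub_sub_cancel, Real.rpow_one, Complex.norm_real]
      exact b1 n t)
    (fun n => Complex.continuous_ofReal.comp (c1 n))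
  obtain ⟨B, hB, hB2, hBc⟩ := exists_multiplier_family (s := s) (s' := s - 1) (C := 2)
    (by norm_num)
    (fun t n => -((jap n ^ 2 * waveSym n (max t 0) : ℝ) : ℂ)) (fun t n => by
      have hj := jap_pos n
      rw [norm_neg, Complex.norm_real, Real.norm_eq_abs, abs_mul, abs_of_pos (by positivity),
        show s - 1 - s = -1 by ring, Real.rpow_neg_one]
      refine le_trans (le_of_eq ?_) (b1 n t)
      field_simp)
    (fun n => (Complex.continuous_ofReal.comp ((c1 n).const_mul _)).neg)
  obtain ⟨B', hB', hB2', hBc'⟩ := exists_multiplier_family (s := s - 1) (s' := s - 1) (C := 2)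
    (by norm_num) (fun t n => (waveSym' n (max t 0) : ℂ)) (fun t n => by
      rw [sub_self, Real.rpow_zero, mul_one, Complex.norm_real]
      exact b2 n t)
    (fun n => Complex.continuous_ofReal.comp (c2 n))
  refine ⟨fun t => ((A t).coprod (A' t)).prod ((B t).coprod (B' t)), ?_, ?_, ?_, ?_⟩
  · intro t f n
    change (A t f.1 + A' t f.2).coeff n = _
    rw [Sob.coeff_add, Pi.add_apply, hA, hA']
    push_cast
    ring
  · intro t f n
    change (B t f.1 + B' t f.2).coeff n = _
    rw [Sob.coeff_add, Pi.add_apply, hB, hB']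
  · intro t
    refine ContinuousLinearMap.opNorm_le_bound _ (by norm_num) fun f => ?_
    have f1 := norm_fst_le f
    have f2 := norm_snd_le f
    have g1 := (A t).le_of_opNorm_le (hA2 t) f.1
    have g2 := (A' t).le_of_opNorm_le (hA2' t) f.2
    have g3 := (B t).le_of_opNorm_le (hB2 t) f.1
    have g4 := (B' t).le_of_opNorm_le (hB2' t) f.2
    refine max_le ((norm_add_le (A t f.1) (A' t f.2)).trans ?_)
      ((norm_add_le (B t f.1) (B' t f.2)).trans ?_) <;> linarith [norm_nonneg f]
  · refine Continuous.prodMk ?_ ?_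
    · exact (hAc.comp (by fun_prop : Continuous fun p : ℝ × (Sob s 2 × Sob (s - 1) 2) =>
        (p.1, p.2.1))).add (hAc'.comp (by fun_prop :
        Continuous fun p : ℝ × (Sob s 2 × Sob (s - 1) 2) => (p.1, p.2.2)))
    · exact (hBc.comp (by fun_prop : Continuous fun p : ℝ × (Sob s 2 × Sob (s - 1) 2) =>
        (p.1, p.2.1))).add (hBc'.comp (by fun_prop :
        Continuous fun p : ℝ × (Sob s 2 × Sob (s - 1) 2) => (p.1, p.2.2)))

/-- The wave propagator `f ↦ (𝒟(t) f, ∂_t 𝒟(t) f)`. -/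
def waveProp (s : ℝ) : ℝ → Sob (s - 1) 2 →L[ℂ] Sob s 2 × Sob (s - 1) 2 := (exists_waveProp s).choose

theorem waveProp_fst (s t : ℝ) (f : Sob (s - 1) 2) (n : Freq) :
    (waveProp s t f).1.coeff n = (waveSym n (max t 0) : ℂ) * f.coeff n :=
  (exists_waveProp s).choose_spec.1 t f n

theorem waveProp_snd (s t : ℝ) (f : Sob (s - 1) 2) (n : Freq) :
    (waveProp s t f).2.coeff n = (waveSym' n (max t 0) : ℂ) * f.coeff n :=
  (exists_waveProp s).choose_spec.2.1 t f n

theorem norm_waveProp_le (s t : ℝ) : ‖waveProp s t‖ ≤ 2 :=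
  (exists_waveProp s).choose_spec.2.2.1 t

theorem continuous_waveProp (s : ℝ) :
    Continuous fun p : ℝ × Sob (s - 1) 2 => waveProp s p.1 p.2 :=
  (exists_waveProp s).choose_spec.2.2.2

/-- The free evolution `(f, g) ↦ (S(t)(f, g), ∂_t S(t)(f, g))`. -/
def freeProp (s : ℝ) : ℝ → (Sob s 2 × Sob (s - 1) 2) →L[ℂ] Sob s 2 × Sob (s - 1) 2 :=
  (exists_freeProp s).choose

theorem freeProp_fst (s t : ℝ) (f : Sob s 2 × Sob (s - 1) 2) (n : Freq) :
    (freeProp s t f).1.coeff n = (waveSym' n (max t 0) : ℂ) * f.1.coeff n +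
      (waveSym n (max t 0) : ℂ) * (f.1.coeff n + f.2.coeff n) :=
  (exists_freeProp s).choose_spec.1 t f n

theorem freeProp_snd (s t : ℝ) (f : Sob s 2 × Sob (s - 1) 2) (n : Freq) :
    (freeProp s t f).2.coeff n = -((jap n ^ 2 * waveSym n (max t 0) : ℝ) : ℂ) * f.1.coeff n +
      (waveSym' n (max t 0) : ℂ) * f.2.coeff n :=
  (exists_freeProp s).choose_spec.2.1 t f n

theorem norm_freeProp_le (s t : ℝ) : ‖freeProp s t‖ ≤ 6 :=
  (exists_freeProp s).choose_spec.2.2.1 t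

theorem continuous_freeProp (s : ℝ) :
    Continuous fun p : ℝ × (Sob s 2 × Sob (s - 1) 2) => freeProp s p.1 p.2 :=
  (exists_freeProp s).choose_spec.2.2.2

/-! ### Curves solving the linear wave equation -/

theorem clm_duhInt {E E' B : Type*} [NormedAddCommGroup E] [NormedSpace ℂ E] [CompleteSpace E]
    [NormedAddCommGroup E'] [NormedSpace ℂ E'] [NormedAddCommGroup B] [NormedSpace ℂ B]
    [CompleteSpace B] {D : ℝ → E' →L[ℂ] E} {C T : ℝ} (hC : 0 ≤ C) (hDC : ∀ t, ‖D t‖ ≤ C)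
    (hD : Continuous fun p : ℝ × E' => D p.1 p.2) {f : ℝ → E'}
    (hf : Integrable f (timeMeasure T)) (P : E →L[ℂ] B) (t : ℝ) :
    P (duhInt D T f t) = ∫ s, (Iic t).indicator (fun s => P (D (t - s) (f s))) s ∂timeMeasure T := by
  rw [duhInt, ← P.integral_comp_comm (integrable_duh hC hDC hD hf t)]
  refine integral_congr_ae (ae_of_all _ fun s => ?_)
  dsimp only
  by_cases h : s ∈ Iic t
  · rw [indicator_of_mem h, indicator_of_mem h]
  · rw [indicator_of_notMem h, indicator_of_notMem h, map_zero]

theorem integral_indicator_Iic {B : Type*} [NormedAddCommGroup B] [NormedSpace ℝ B] {T t : ℝ}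
    (ht : t ∈ Icc (0 : ℝ) T) (g : ℝ → B) :
    ∫ s, (Iic t).indicator g s ∂timeMeasure T = ∫ s in (0 : ℝ)..t, g s := by
  rw [integral_indicator measurableSet_Iic, Measure.restrict_restrict measurableSet_Iic,
    intervalIntegral.integral_of_le ht.1, ← integral_Icc_eq_integral_Ioc]
  congr 2
  ext s
  exact ⟨fun h => ⟨h.2.1, h.1⟩, fun h => ⟨h.2, h.1, h.2.trans ht.2⟩⟩

section coeff

variable {s T : ℝ} {h : ℝ → Sob (s - 1) 2}

theorem coeff_duhInt_fst (hh : Integrable h (timeMeasure T)) {t : ℝ} (ht : t ∈ Icc (0 : ℝ) T)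
    (n : Freq) : (duhInt (waveProp s) T h t).1.coeff n =
      ∫ r in (0 : ℝ)..t, (waveSym n (t - r) : ℂ) * (h r).coeff n := by
  have h1 := clm_duhInt (C := 2) (by norm_num) (norm_waveProp_le s) (continuous_waveProp s) hh
    ((Sob.coeffL s n).comp (ContinuousLinearMap.fst ℂ _ _)) t
  refine h1.trans ?_
  rw [integral_indicator_Iic ht]
  refine intervalIntegral.integral_congr fun r hr => ?_
  rw [uIcc_of_le ht.1] at hr
  change (waveProp s (t - r) (h r)).1.coeff n = _
  rw [waveProp_fst, max_eq_left (sub_nonneg.2 hr.2)]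

theorem coeff_duhInt_snd (hh : Integrable h (timeMeasure T)) {t : ℝ} (n : Freq) :
    (duhInt (waveProp s) T h t).2.coeff n =
      ∫ r, (Iic t).indicator (fun r => (waveSym' n (t - r) : ℂ) * (h r).coeff n) r
        ∂timeMeasure T := by
  have h1 := clm_duhInt (C := 2) (by norm_num) (norm_waveProp_le s) (continuous_waveProp s) hh
    ((Sob.coeffL (s - 1) n).comp (ContinuousLinearMap.snd ℂ _ _)) t
  refine h1.trans (integral_congr_ae (ae_of_all _ fun r => ?_))
  by_cases hr : r ∈ Iic t
  · rw [indicator_of_mem hr, indicator_of_mem hr]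
    change (waveProp s (t - r) (h r)).2.coeff n = _
    rw [waveProp_snd, max_eq_left (sub_nonneg.2 hr)]
  · rw [indicator_of_notMem hr, indicator_of_notMem hr]

end coeff

/-- The Duhamel integral of `w` is a primitive of that of `w'`. -/
theorem integral_duhamel_deriv {w w' : ℝ → ℝ} (hw : ∀ t, HasDerivAt w (w' t) t)
    (hw' : Continuous w') (hw0 : w 0 = 0) {T : ℝ} {φ : ℝ → ℂ} (hφ : Integrable φ (timeMeasure T))
    {t : ℝ} (ht : t ∈ Icc (0 : ℝ) T) :
    ∫ τ in (0 : ℝ)..t, ∫ r, (Iic τ).indicator (fun r => (w' (τ - r) : ℂ) * φ r) r ∂timeMeasure T =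
      ∫ r in (0 : ℝ)..t, (w (t - r) : ℂ) * φ r := by
  obtain ⟨C, hC⟩ := (isCompact_Icc (a := -T) (b := T)).exists_bound_of_continuousOn hw'.continuousOn
  have hT : 0 ≤ T := ht.1.trans ht.2
  have hC0 : 0 ≤ C := (norm_nonneg _).trans (hC 0 ⟨by linarith, hT⟩)
  -- Strict inequality changes the integrand only at r = τ, a null set; after exchanging the
  -- integrals the inner domain is the half-open interval (r, t].
  set F : ℝ → ℝ → ℂ := fun τ r => if r < τ then (w' (τ - r) : ℂ) * φ r else 0 with hF
  have e1 : ∀ τ, ∫ r, (Iic τ).indicator (fun r => (w' (τ - r) : ℂ) * φ r) r ∂timeMeasure T =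
      ∫ r, F τ r ∂timeMeasure T := by
    intro τ
    refine integral_congr_ae ?_
    have hne : ∀ᵐ r ∂timeMeasure T, r ≠ τ := by
      refine ae_restrict_of_ae ?_
      exact measure_eq_zero_iff_ae_notMem.1 (measure_singleton (μ := volume) τ)
    filter_upwards [hne] with r hr
    by_cases h : r < τ
    · rw [indicator_of_mem (mem_Iic.2 h.le), hF]
      simp only [if_pos h]
    · rw [indicator_of_notMem (fun h' => h (lt_of_le_of_ne (mem_Iic.1 h') hr)), hF]
      simp only [if_neg h]
  simp only [e1]
  -- After Fubini the inner integral of w'(τ - r) over τ in (r, t] is w(t - r), as w vanishes at 0.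
  rw [intervalIntegral.integral_of_le ht.1, integral_integral_swap]
  · rw [← integral_indicator_Iic ht]
    refine integral_congr_ae ?_
    filter_upwards [ae_mem_Icc T] with r hr
    have e2 : ∀ τ, F τ r = (Ioi r).indicator (fun τ => (w' (τ - r) : ℂ) * φ r) τ := by
      intro τ
      by_cases h : r < τ
      · rw [indicator_of_mem (mem_Ioi.2 h), hF]; simp only [if_pos h]
      · rw [indicator_of_notMem (fun h' => h (mem_Ioi.1 h')), hF]; simp only [if_neg h]
    simp only [e2]
    rw [integral_indicator measurableSet_Ioi, Measure.restrict_restrict measurableSet_Ioi]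
    have e3 : Ioi r ∩ Ioc 0 t = Ioc r t := by
      ext τ
      exact ⟨fun h => ⟨h.1, h.2.2⟩, fun h => ⟨h.1, hr.1.trans_lt h.1, h.2⟩⟩
    rw [e3]
    by_cases h : r ∈ Iic t
    · rw [indicator_of_mem h, ← intervalIntegral.integral_of_le h,
        intervalIntegral.integral_mul_const]
      congr 1
      have h1 : ∀ τ ∈ uIcc r t, HasDerivAt (fun τ => ((w (τ - r) : ℝ) : ℂ)) (w' (τ - r) : ℂ) τ :=
        fun τ _ => ((hw (τ - r)).comp_sub_const τ r).ofReal_comp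
      rw [intervalIntegral.integral_eq_sub_of_hasDerivAt h1 (by
        apply Continuous.intervalIntegrable; fun_prop), sub_self, hw0]
      simp
    · rw [indicator_of_notMem h, Ioc_eq_empty (fun h' => h h'.le), Measure.restrict_empty,
        integral_zero_measure]
  · have hb : Integrable (fun p : ℝ × ℝ => C * ‖φ p.2‖)
        ((volume.restrict (Ioc 0 t)).prod (timeMeasure T)) := by
      have := (integrable_const (μ := volume.restrict (Ioc 0 t)) C).mul_prod hφ.norm
      exact this
    refine hb.mono' ?_ ?_
    · have hm : MeasurableSet {p : ℝ × ℝ | p.2 < p.1} := measurableSet_lt measurable_snd measurable_fst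
      have : Function.uncurry F = {p : ℝ × ℝ | p.2 < p.1}.indicator
          (fun p => (w' (p.1 - p.2) : ℂ) * φ p.2) := by
        ext ⟨τ, r⟩
        by_cases h : r < τ
        · rw [indicator_of_mem (show (τ, r) ∈ {p : ℝ × ℝ | p.2 < p.1} from h)]
          simp only [Function.uncurry, hF, if_pos h]
        · rw [indicator_of_notMem (show (τ, r) ∉ {p : ℝ × ℝ | p.2 < p.1} from h)]
          simp only [Function.uncurry, hF, if_neg h]
      rw [this]
      refine AEStronglyMeasurable.indicator ?_ hm
      refine AEStronglyMeasurable.mul ?_ hφ.1.comp_snd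
      exact Continuous.aestronglyMeasurable (by fun_prop)
    · have h1 : ∀ᵐ p ∂((volume.restrict (Ioc 0 t)).prod (timeMeasure T)),
          p ∈ Ioc 0 t ×ˢ Icc (0 : ℝ) T := by
        rw [Measure.prod_restrict]
        exact ae_restrict_mem (measurableSet_Ioc.prod measurableSet_Icc)
      filter_upwards [h1] with p hp
      simp only [Function.uncurry, hF]
      split_ifs with h
      · rw [norm_mul, Complex.norm_real]
        gcongr
        exact hC _ ⟨by linarith [hp.1.1, hp.2.2], by linarith [hp.1.2, hp.2.1, ht.2]⟩
      · rw [norm_zero]; positivity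

/-- A curve whose increments are the integrals of a continuous curve is continuously
differentiable. -/
theorem isTimeDeriv_of_integral {s s' T : ℝ} (hT : 0 ≤ T) {u : C(Icc (0 : ℝ) T, Sob s 2)}
    {v : C(Icc (0 : ℝ) T, Sob s' 2)}
    (h : ∀ (t : Icc (0 : ℝ) T) n, (u t).coeff n = (u ⟨0, le_rfl, hT⟩).coeff n +
      ∫ τ in (0 : ℝ)..t, (extend hT v τ).coeff n) : IsTimeDeriv u v := by
  intro t
  have hv := continuous_extend hT v
  have hvc : ∀ n, Continuous fun τ => (extend hT v τ).coeff n := fun n =>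
    (Sob.coeffL s' n).continuous.comp hv
  refine ⟨fun r => ((((r : ℝ) - t : ℝ) : ℂ)⁻¹) • ∫ τ in (t : ℝ)..r, extend hT v τ, fun r n => ?_, ?_⟩
  · rw [Sob.coeff_smul, Pi.smul_apply, smul_eq_mul]
    congr 1
    have e := ((Sob.coeffL s' n).intervalIntegral_comp_comm (μ := volume)
      (hv.intervalIntegrable (t : ℝ) r)).symm
    refine e.trans ?_
    rw [h r, h t, add_sub_add_left_eq_sub]
    exact (intervalIntegral.integral_interval_sub_left ((hvc n).intervalIntegrable _ _)
      ((hvc n).intervalIntegrable _ _)).symm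
  · have hd : HasDerivAt (fun r : ℝ => ∫ τ in (t : ℝ)..r, extend hT v τ) (extend hT v t) t :=
      intervalIntegral.integral_hasDerivAt_right (hv.intervalIntegrable _ _)
        (hv.stronglyMeasurableAtFilter _ _) hv.continuousAt
    have h2 := hasDerivAt_iff_tendsto_slope.1 hd
    have h3 : Tendsto (fun r : Icc (0 : ℝ) T => (r : ℝ)) (𝓝[≠] t) (𝓝[≠] (t : ℝ)) := by
      refine tendsto_nhdsWithin_iff.2
        ⟨(continuous_subtype_val.tendsto t).mono_left nhdsWithin_le_nhds, ?_⟩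
      filter_upwards [self_mem_nhdsWithin] with r hr hrt
      exact hr (Subtype.ext hrt)
    have h4 := h2.comp h3
    rw [extend_of_mem hT v t.2] at h4
    refine h4.congr fun r => ?_
    simp only [Function.comp, slope, intervalIntegral.integral_same, vsub_eq_sub, sub_zero]
    rw [← Complex.ofReal_inv, Complex.coe_smul]

/-- The difference quotients are determined by u through their coefficients, and since T > 0 no time
of [0,T] is isolated, so the limit is unique. -/
theorem IsTimeDeriv.unique {s s' T : ℝ} (hT : 0 < T) {u : C(Icc (0 : ℝ) T, Sob s 2)}
    {v v' : C(Icc (0 : ℝ) T, Sob s' 2)} (h : IsTimeDeriv u v) (h' : IsTimeDeriv u v') : v = v' := by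
  ext1 t
  obtain ⟨q, hq, hlim⟩ := h t
  obtain ⟨q', hq', hlim'⟩ := h' t
  have e : q = q' := funext fun r => Sob.ext (funext fun n => by rw [hq, hq'])
  rw [← e] at hlim'
  have : Nontrivial (Icc (0 : ℝ) T) :=
    ⟨⟨⟨0, le_rfl, hT.le⟩, ⟨T, hT.le, le_rfl⟩, fun h => hT.ne (congrArg Subtype.val h)⟩⟩
  have : PreconnectedSpace (Icc (0 : ℝ) T) := Subtype.preconnectedSpace isPreconnected_Icc
  exact tendsto_nhds_unique hlim hlim'

section curve

variable {s T : ℝ} {h : ℝ → Sob (s - 1) 2} (f : Sob s 2 × Sob (s - 1) 2)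

theorem coeff_wave_fst (hh : Integrable h (timeMeasure T)) {t : ℝ} (ht : t ∈ Icc (0 : ℝ) T) :
    (freeProp s t f + duhInt (waveProp s) T h t).1.coeff =
      linEvol f.1.coeff f.2.coeff t + duhamel (fun r => (h r).coeff) t := by
  ext n
  rw [Prod.fst_add, Sob.coeff_add, Pi.add_apply, Pi.add_apply, coeff_duhInt_fst hh ht,
    freeProp_fst, max_eq_left ht.1, linEvol, duhamel, deriv_waveSym]

theorem wave_zero (hT : 0 ≤ T) :
    freeProp s 0 f + duhInt (waveProp s) T h 0 = f := by
  have h0 : duhInt (waveProp s) T h 0 = 0 := by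
    rw [duhInt, integral_indicator_Iic ⟨le_rfl, hT⟩, intervalIntegral.integral_same]
  rw [h0, add_zero]
  refine Prod.ext (Sob.ext (funext fun n => ?_)) (Sob.ext (funext fun n => ?_))
  · rw [freeProp_fst, max_self, waveSym_zero, waveSym'_zero]; simp
  · rw [freeProp_snd, max_self, waveSym_zero, waveSym'_zero]; simp

/-- The derivative is verified in integrated form, frequency by frequency: the free part has an
explicit primitive, and the Duhamel part is covered by `integral_duhamel_deriv`. -/
theorem isTimeDeriv_wave (hT : 0 ≤ T) (hh : Integrable h (timeMeasure T))
    {u : C(Icc (0 : ℝ) T, Sob s 2)} {v : C(Icc (0 : ℝ) T, Sob (s - 1) 2)}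
    (huv : ∀ t : Icc (0 : ℝ) T, (u t, v t) = freeProp s t f + duhInt (waveProp s) T h t) :
    IsTimeDeriv u v := by
  refine isTimeDeriv_of_integral hT fun t n => ?_
  have hu : ∀ t, u t = (freeProp s t f + duhInt (waveProp s) T h t).1 := fun t =>
    congrArg Prod.fst (huv t)
  have hv : ∀ t, v t = (freeProp s t f + duhInt (waveProp s) T h t).2 := fun t =>
    congrArg Prod.snd (huv t)
  have hu0 : u ⟨0, le_rfl, hT⟩ = f.1 := (hu _).trans (congrArg Prod.fst (wave_zero f hT))
  have hφ : Integrable (fun r => (h r).coeff n) (timeMeasure T) :=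
    (Sob.coeffL (s - 1) n).integrable_comp hh
  set a : ℝ → ℂ := fun τ => -((jap n ^ 2 * waveSym n τ : ℝ) : ℂ) * f.1.coeff n +
      (waveSym' n τ : ℂ) * f.2.coeff n with ha
  set b : ℝ → ℂ := fun τ =>
    ∫ r, (Iic τ).indicator (fun r => (waveSym' n (τ - r) : ℂ) * (h r).coeff n) r ∂timeMeasure T
    with hb
  have hvab : ∀ τ ∈ Icc (0 : ℝ) T, (extend hT v τ).coeff n = a τ + b τ := by
    intro τ hτ
    rw [extend_of_mem hT v hτ, hv, Prod.snd_add, Sob.coeff_add, Pi.add_apply, freeProp_snd,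
      coeff_duhInt_snd hh, max_eq_left hτ.1]
  have hac : Continuous a := by
    have := continuous_waveSym n
    have := continuous_waveSym' n
    fun_prop
  have hbc : Continuous b := by
    have h1 : Continuous fun τ => (duhInt (waveProp s) T h τ).2.coeff n :=
      (Sob.coeffL (s - 1) n).continuous.comp (continuous_snd.comp
        (continuous_duhInt (C := 2) (by norm_num) (norm_waveProp_le s) (continuous_waveProp s) hh))
    exact h1.congr fun τ => coeff_duhInt_snd hh n
  have e1 : ∫ τ in (0 : ℝ)..t, (extend hT v τ).coeff n = ∫ τ in (0 : ℝ)..t, (a τ + b τ) := by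
    refine intervalIntegral.integral_congr fun τ hτ => hvab τ ?_
    rw [uIcc_of_le t.2.1] at hτ
    exact ⟨hτ.1, hτ.2.trans t.2.2⟩
  rw [e1, intervalIntegral.integral_add (hac.intervalIntegrable _ _) (hbc.intervalIntegrable _ _),
    integral_duhamel_deriv (hasDerivAt_waveSym n) (continuous_waveSym' n) (waveSym_zero n) hφ t.2,
    hu0, hu, Prod.fst_add, Sob.coeff_add, Pi.add_apply, coeff_duhInt_fst hh t.2, freeProp_fst,
    max_eq_left t.2.1]
  have e2 : ∀ τ ∈ uIcc (0 : ℝ) t, HasDerivAt (fun τ => (waveSym' n τ : ℂ) * f.1.coeff n +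
      (waveSym n τ : ℂ) * (f.1.coeff n + f.2.coeff n)) (a τ) τ := by
    intro τ _
    have d1 := (hasDerivAt_waveSym' n τ).ofReal_comp.mul_const (f.1.coeff n)
    have d2 := (hasDerivAt_waveSym n τ).ofReal_comp.mul_const (f.1.coeff n + f.2.coeff n)
    refine (d1.add d2).congr_deriv ?_
    rw [ha]
    push_cast
    ring
  rw [intervalIntegral.integral_eq_sub_of_hasDerivAt e2 (hac.intervalIntegrable _ _), waveSym_zero,
    waveSym'_zero]
  push_cast
  ring

end curve

/-! ### The nonlinearities as maps between Sobolev spaces -/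

/-- `Q_{X,Y}` on the Fourier side. -/
def qCoef (φ : ℝ → ℝ) (x y ψ : Coef) : Coef :=
  conv (x + y) (x + y) + 2 * paraLow φ x ψ + 2 * paraHigh φ x ψ + 2 * conv y ψ

/-- `V ∗ (Q_{X,Y} + 2ℜ)` on the Fourier side. -/
def uCoef (φ : ℝ → ℝ) (β : ℝ) (x y ψ r : Coef) : Coef := bessel β (qCoef φ x y ψ + 2 * r)

/-- `V ∗ (Q_{X,Y} + 2ℜ + W)` on the Fourier side. -/
def vCoef (φ : ℝ → ℝ) (β : ℝ) (x y ψ r w : Coef) : Coef := bessel β (qCoef φ x y ψ + 2 * r + w)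

/-- The right-hand side of the `Y`-equation on the Fourier side. -/
def yCoef (φ : ℝ → ℝ) (β : ℝ) (x y ψ r w z : Coef) : Coef :=
  -conv (vCoef φ β x y ψ r w) (x + y)
    - (paraHigh φ (vCoef φ β x y ψ r w) ψ + (reson φ (uCoef φ β x y ψ r) ψ + z))

theorem bessel_add (β : ℝ) (f g : Coef) : bessel β (f + g) = bessel β f + bessel β g := by
  ext n; simp [bessel, mul_add]

theorem vCoef_eq (φ : ℝ → ℝ) (β : ℝ) (x y ψ r w : Coef) :
    vCoef φ β x y ψ r w = uCoef φ β x y ψ r + bessel β w := bessel_add _ _ _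

/-- The conditions on the parameters which make all products well defined. -/
structure Admissible (s₁ s₂ s₃ β θ ε : ℝ) : Prop where
  s₁_gt : 1 / 4 < s₁
  s₂_lt : s₂ < 1
  s₃_gt : -(1 / 2) < s₃
  s₃_neg : s₃ < 0
  ε_pos : 0 < ε
  ε_le : ε ≤ 1 / 16
  ε_lt : ε < β - 1
  le_s₁ : 4 * ε ≤ 1 / 2 - s₁
  le_s₂ : 4 * ε ≤ s₂ - 1 / 2
  lt_β : ε < β + 3 * s₁ - 2 - s₂
  le_β : 5 * ε ≤ β - s₂ - 1 / 2
  le_β' : 5 * ε ≤ β + 2 * s₁ - 2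
  le_θ : 8 * ε ≤ (β - 1 - ε) * θ

/-- Every condition is strict at ε = 0 and hence survives for small ε. The hypothesis on β together
with s₁ < 1/2 < s₂ gives the implicit ones: β > s₂ + 1/2, and β + 2s₁ - 2 > s₂ - s₁ > 0. -/
theorem exists_admissible {s₁ s₂ s₃ β θ : ℝ} (hs₃ : -(1 / 2) < s₃) (hs₃' : s₃ < 0) (hθ : 0 < θ)
    (h1 : 1 / 4 < s₁) (h2 : s₁ < 1 / 2) (h3 : 1 / 2 < s₂) (h4 : s₂ < 1) (h5 : 1 < β)
    (h6 : -3 * s₁ + s₂ + 2 < β) : ∃ ε, Admissible s₁ s₂ s₃ β θ ε := by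
  have hpos : ∀ᶠ ε in 𝓝[>] (0 : ℝ), 0 < ε := self_mem_nhdsWithin
  have hsmall : ∀ c : ℝ, 0 < c → ∀ᶠ ε in 𝓝[>] (0 : ℝ), ε < c := fun c hc => by
    filter_upwards [Ioo_mem_nhdsGT hc] with ε h using h.2
  have hθ' : 0 < (β - 1) * θ := mul_pos (by linarith) hθ
  obtain ⟨ε, e0, e1, e2, e3, e4, e5, e6, e7, e8⟩ := (hpos.and ((hsmall (1 / 16) (by norm_num)).and
    ((hsmall ((β - 1) / 2) (by linarith)).and ((hsmall ((1 / 2 - s₁) / 4) (by linarith)).and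
    ((hsmall ((s₂ - 1 / 2) / 4) (by linarith)).and
    ((hsmall (β + 3 * s₁ - 2 - s₂) (by linarith)).and
    ((hsmall ((β - s₂ - 1 / 2) / 5) (by linarith)).and
    ((hsmall ((β + 2 * s₁ - 2) / 5) (by linarith)).and
    (hsmall ((β - 1) * θ / 16) (by positivity)))))))))).exists
  refine ⟨ε, h1, h4, hs₃, hs₃', e0, e1.le, by linarith, by linarith, by linarith, e5, by linarith,
    by linarith, ?_⟩
  have := mul_le_mul_of_nonneg_right (show (β - 1) / 2 ≤ β - 1 - ε by linarith) hθ.le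
  linarith

/-- The space of states `((X, ∂_t X), (Y, ∂_t Y), (P, ∂_t P))`, where `P = 𝔍_≺^{(1)}(v)`. -/
abbrev State (s₁ s₂ p : ℝ) : Type :=
  (Sob s₁ 2 × Sob (s₁ - 1) 2) × (Sob s₂ 2 × Sob (s₂ - 1) 2) × (Sob p 2 × Sob (p - 1) 2)

/-- The space of forcing terms. -/
abbrev Forcing (s₁ s₂ p : ℝ) : Type := Sob (s₁ - 1) 2 × Sob (s₂ - 1) 2 × Sob (p - 1) 2

/-- The space of the values of `(Ψ, W, Z)`. -/
abbrev Noise (β ε : ℝ) : Type :=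
  Sob (-(1 / 2) - ε) ∞ × Sob (-1 - ε) ∞ × Sob (β - 3 / 2 - ε) ∞

/-- The wave propagators of the three components. -/
def waveProp₃ (s₁ s₂ p : ℝ) (t : ℝ) : Forcing s₁ s₂ p →L[ℂ] State s₁ s₂ p :=
  (waveProp s₁ t).prodMap ((waveProp s₂ t).prodMap (waveProp p t))

theorem norm_waveProp₃_le (s₁ s₂ p t : ℝ) : ‖waveProp₃ s₁ s₂ p t‖ ≤ 2 := by
  refine ContinuousLinearMap.opNorm_le_bound _ (by norm_num) fun f => ?_
  have h1 := (waveProp s₁ t).le_of_opNorm_le (norm_waveProp_le s₁ t) f.1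
  have h2 := (waveProp s₂ t).le_of_opNorm_le (norm_waveProp_le s₂ t) f.2.1
  have h3 := (waveProp p t).le_of_opNorm_le (norm_waveProp_le p t) f.2.2
  have f1 := norm_fst_le f
  have f2 := (norm_fst_le f.2).trans (norm_snd_le f)
  have f3 := (norm_snd_le f.2).trans (norm_snd_le f)
  exact max_le (h1.trans (by linarith)) (max_le (h2.trans (by linarith)) (h3.trans (by linarith)))

theorem continuous_waveProp₃ (s₁ s₂ p : ℝ) :
    Continuous fun q : ℝ × Forcing s₁ s₂ p => waveProp₃ s₁ s₂ p q.1 q.2 :=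
  ((continuous_waveProp s₁).comp (continuous_fst.prodMk (continuous_fst.comp continuous_snd))).prodMk
    (((continuous_waveProp s₂).comp (continuous_fst.prodMk
      (continuous_fst.comp (continuous_snd.comp continuous_snd)))).prodMk
    ((continuous_waveProp p).comp (continuous_fst.prodMk
      (continuous_snd.comp (continuous_snd.comp continuous_snd)))))

/-- The abstract model is the Hartree system. -/
structure IsHartree (φ : ℝ → ℝ) (c₀ : ℝ) {s₁ s₂ s₃ β ε p : ℝ} (θ : ℝ)
    (m : Model (State s₁ s₂ p) (Forcing s₁ s₂ p) (Noise β ε) (Sob s₃ 2) (Sob 0 2)) : Prop where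
  D_eq : m.D = waveProp₃ s₁ s₂ p
  V_coeff : ∀ x g r, (m.V (x, g) r).coeff =
    vCoef φ β x.1.1.coeff x.2.1.1.coeff g.1.coeff r.coeff g.2.1.coeff
  F_fst : ∀ x g r, (m.F (x, g) r).1.coeff = -paraLow φ
    (vCoef φ β x.1.1.coeff x.2.1.1.coeff g.1.coeff r.coeff g.2.1.coeff) g.1.coeff
  F_snd : ∀ x g r, (m.F (x, g) r).2.1.coeff =
    yCoef φ β x.1.1.coeff x.2.1.1.coeff g.1.coeff r.coeff g.2.1.coeff g.2.2.coeff
  F_thd : ∀ x g r, (m.F (x, g) r).2.2.coeff = paraLow₁ φ θ c₀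
    (vCoef φ β x.1.1.coeff x.2.1.1.coeff g.1.coeff r.coeff g.2.1.coeff) g.1.coeff
  ρ_coeff : ∀ x g, (m.ρ (x, g)).coeff = -reson φ x.2.2.1.coeff g.1.coeff

set_option maxHeartbeats 1000000 in
-- All products in the system become bounded multilinear maps between Sobolev spaces with the
-- component P at regularity 1/2 + 4ε. Each map below uses one of the conditions in `Admissible`.
theorem exists_model {φ : ℝ → ℝ} (hφ : IsBump φ) (c₀ : ℝ) {s₁ s₂ s₃ β θ ε : ℝ}
    (h : Admissible s₁ s₂ s₃ β θ ε) :
    ∃ m : Model (State s₁ s₂ (1 / 2 + 4 * ε)) (Forcing s₁ s₂ (1 / 2 + 4 * ε)) (Noise β ε) (Sob s₃ 2)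
      (Sob 0 2), IsHartree φ c₀ θ m := by
  obtain ⟨s₁_gt, s₂_lt, s₃_gt, s₃_neg, ε_pos, ε_le, ε_lt, le_s₁, le_s₂, lt_β, le_β, le_β', le_θ⟩ := h
  have ha : (0 : ℝ) < 1 / 2 + ε := by linarith
  have haε : 1 / 2 + ε + ε < 2 := by linarith
  have ea : -(1 / 2 + ε) = -(1 / 2) - ε := by ring
  have e1 : -(1 - s₁) = s₁ - 1 := by ring
  have e2 : -(1 - s₂) = s₂ - 1 := by ring
  have ep : -(1 / 2 - 4 * ε) = 1 / 2 + 4 * ε - 1 := by ring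
  -- The regularities of Q (κ), of v (σ, limited by V∗W) and of U = V∗(Q + 2ℜ) (u).
  obtain ⟨κ, hκ⟩ : ∃ κ : ℝ, κ = -(3 / 2 + ε - 2 * s₁) := ⟨_, rfl⟩
  obtain ⟨σ, hσ⟩ : ∃ σ : ℝ, σ = β - 1 - ε := ⟨_, rfl⟩
  obtain ⟨u, hu⟩ : ∃ u : ℝ, u = κ + β := ⟨_, rfl⟩
  have hσ0 : 0 ≤ σ := by linarith
  have hu0 : 0 ≤ u := by linarith
  have q := exists_conv (a := s₁) (b := s₁) (c := 3 / 2 + ε - 2 * s₁) (by linarith)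
    (by linarith) (by linarith) (by linarith)
  rw [← hκ] at q
  obtain ⟨B₁, hB₁⟩ := q
  have q := hφ.exists_paraLow (b := s₁) (c := 3 / 2 + ε - 2 * s₁) ha ε_pos haε
    (by linarith) (by linarith) (by linarith)
  rw [ea, ← hκ] at q
  obtain ⟨PL, hPL⟩ := q
  have q := hφ.exists_paraHigh (b := s₁) (c := 3 / 2 + ε - 2 * s₁) ha ε_pos haε
    (by linarith) (by linarith) (by linarith)
  rw [ea, ← hκ] at q
  obtain ⟨PH, hPH⟩ := q
  have q := hφ.exists_convΨ (b := s₂) (c := 3 / 2 + ε - 2 * s₁) ha ε_pos haε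
    (by linarith) (by linarith)
  rw [ea, ← hκ] at q
  obtain ⟨CΨ, hCΨ⟩ := q
  obtain ⟨ιy, hιy⟩ := exists_inclusion (s := s₂) (s' := s₁) (by linarith)
  -- Since s₁ < 1/2, κ lies below -1/2 and therefore below s₃: Q is rougher than ℜ.
  obtain ⟨ιr, hιr⟩ := exists_inclusion (s := s₃) (s' := κ) (by linarith)
  obtain ⟨Vu, hVu⟩ := exists_bessel (s := κ) (s' := u) (β := β) hu.le
  obtain ⟨ιw, hιw⟩ := exists_embed (-1 - ε)
  obtain ⟨Vw, hVw⟩ := exists_bessel (s := -1 - ε) (s' := σ) (β := β) (by linarith)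
  -- Here u - σ = 2s₁ - 1/2 is positive because s₁ > 1/4.
  obtain ⟨ιu, hιu⟩ := exists_inclusion (s := u) (s' := σ) (by linarith)
  obtain ⟨ιv, hιv⟩ := exists_inclusion (s := σ) (s' := 0) hσ0
  have q := hφ.exists_paraLow (b := σ) (c := 1 - s₁) ha ε_pos haε hσ0
    (by linarith) (by linarith)
  rw [ea, e1] at q
  obtain ⟨PX, hPX⟩ := q
  -- The forcing of P reaches H^{-1/2+4ε} precisely because σθ ≥ 8ε.
  have q := hφ.exists_paraLow₁ (b := σ) (c := 1 / 2 - 4 * ε) ha ε_pos haε θ c₀ hσ0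
    (by linarith) (by rw [hσ]; linarith)
  rw [ea, ep] at q
  obtain ⟨P₁, hP₁⟩ := q
  -- U(X+Y) lands in H^{s₂-1}: the requirement u + s₁ + 1 - s₂ > 3/2 is the hypothesis on β, up to
  -- ε.
  have q := exists_conv (b := u) (a := s₁) (c := 1 - s₂) (by linarith) hu0
    (by linarith) (by linarith)
  rw [e2] at q
  obtain ⟨BY, hBY⟩ := q
  -- V∗W is treated as a bounded multiplier, not as an element of H^σ: σ may be too small for a
  -- Sobolev product with X + Y.
  have q := exists_conv_bessel (a := -1 - ε) (b := s₁) (c := 1 - s₂) (β := β)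
    (by linarith) (by linarith) (by linarith)
  rw [e2] at q
  obtain ⟨BW, hBW⟩ := q
  have q := hφ.exists_paraHigh (b := σ) (c := 1 - s₂) ha ε_pos haε hσ0
    (by linarith) (by linarith)
  rw [ea, e2] at q
  obtain ⟨PY, hPY⟩ := q
  have q := hφ.exists_reson (b := u) (c := 1 - s₂) ha ε_pos haε (by linarith) (by linarith)
  rw [ea, e2] at q
  obtain ⟨RY, hRY⟩ := q
  obtain ⟨ιz, hιz⟩ := exists_embed (β - 3 / 2 - ε)
  obtain ⟨ιz', hιz'⟩ := exists_inclusion (s := β - 3 / 2 - ε) (s' := s₂ - 1) (by linarith)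
  -- The regularity 1/2 + 4ε of P exceeds the roughness 1/2 + ε of Ψ by exactly the required 3ε.
  have q := hφ.exists_reson (b := 1 / 2 + 4 * ε) (c := -s₃) ha ε_pos haε (by linarith)
    (by linarith)
  rw [ea, neg_neg] at q
  obtain ⟨RR, hRR⟩ := q
  -- An auxiliary product into H^{-2}, valid for all of v. It serves only to show that `conv` is
  -- additive in U + V∗W, where the two halves are estimated by different maps.
  obtain ⟨Bb, hBb⟩ := exists_conv (b := 0) (a := s₁) (c := 2) (by linarith) le_rfl
    (by norm_num) (by linarith)
  let 𝔼 := State s₁ s₂ (1 / 2 + 4 * ε) × Noise β ε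
  have lx : LocLip fun q : 𝔼 => q.1.1.1 := LocLip.clm
    ((ContinuousLinearMap.fst ℂ _ _).comp ((ContinuousLinearMap.fst ℂ _ _).comp
      (ContinuousLinearMap.fst ℂ (State s₁ s₂ (1 / 2 + 4 * ε)) (Noise β ε))))
  have ly : LocLip fun q : 𝔼 => q.1.2.1.1 := LocLip.clm
    ((ContinuousLinearMap.fst ℂ _ _).comp ((ContinuousLinearMap.fst ℂ _ _).comp
      ((ContinuousLinearMap.snd ℂ _ _).comp
      (ContinuousLinearMap.fst ℂ (State s₁ s₂ (1 / 2 + 4 * ε)) (Noise β ε)))))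
  have lP : LocLip fun q : 𝔼 => q.1.2.2.1 := LocLip.clm
    ((ContinuousLinearMap.fst ℂ _ _).comp ((ContinuousLinearMap.snd ℂ _ _).comp
      ((ContinuousLinearMap.snd ℂ _ _).comp
      (ContinuousLinearMap.fst ℂ (State s₁ s₂ (1 / 2 + 4 * ε)) (Noise β ε)))))
  have lψ : LocLip fun q : 𝔼 => q.2.1 := LocLip.clm
    ((ContinuousLinearMap.fst ℂ _ _).comp
      (ContinuousLinearMap.snd ℂ (State s₁ s₂ (1 / 2 + 4 * ε)) (Noise β ε)))
  have lw : LocLip fun q : 𝔼 => q.2.2.1 := LocLip.clm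
    ((ContinuousLinearMap.fst ℂ _ _).comp ((ContinuousLinearMap.snd ℂ _ _).comp
      (ContinuousLinearMap.snd ℂ (State s₁ s₂ (1 / 2 + 4 * ε)) (Noise β ε))))
  have lz : LocLip fun q : 𝔼 => q.2.2.2 := LocLip.clm
    ((ContinuousLinearMap.snd ℂ _ _).comp ((ContinuousLinearMap.snd ℂ _ _).comp
      (ContinuousLinearMap.snd ℂ (State s₁ s₂ (1 / 2 + 4 * ε)) (Noise β ε))))
  have lS := lx.add (ly.clm_comp ιy)
  have lPL := lx.bilin PL lψ
  have lPH := lx.bilin PH lψ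
  have lC := ly.bilin CΨ lψ
  have lQ := (((lS.bilin B₁ lS).add (lPL.add lPL)).add (lPH.add lPH)).add (lC.add lC)
  have lR : AffLip fun (_ : 𝔼) (r : Sob s₃ 2) => ιr r := AffLip.snd ιr
  have lU := ((lQ.affLip (H := Sob s₃ 2)).add (lR.add lR)).clm_comp Vu
  have lBW := (lw.clm_comp ιw).clm_comp Vw
  have lv := (lU.clm_comp ιu).add (lBW.affLip (H := Sob s₃ 2))
  have lV := lv.clm_comp ιv
  have lX := (lv.bilin PX lψ).neg
  have lP₁ := lv.bilin P₁ lψ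
  have lY := ((lU.bilin BY lS).add ((lS.bilin BW lw).affLip (H := Sob s₃ 2))).neg.add
    ((lv.bilin PY lψ).add ((lU.bilin RY lψ).add
      (((lz.clm_comp ιz).clm_comp ιz').affLip (H := Sob s₃ 2)))).neg
  have lρ := (lP.bilin RR lψ).neg
  have cS : ∀ x : Sob s₁ 2, ∀ y : Sob s₂ 2, (x + ιy y).coeff = x.coeff + y.coeff := fun x y => by
    rw [Sob.coeff_add, hιy]
  have cU : ∀ (x : State s₁ s₂ (1 / 2 + 4 * ε)) (g : Noise β ε) (r : Sob s₃ 2),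
      (Vu (B₁ (x.1.1 + ιy x.2.1.1) (x.1.1 + ιy x.2.1.1) + (PL x.1.1 g.1 + PL x.1.1 g.1) +
        (PH x.1.1 g.1 + PH x.1.1 g.1) + (CΨ x.2.1.1 g.1 + CΨ x.2.1.1 g.1) +
        (ιr r + ιr r))).coeff =
      uCoef φ β x.1.1.coeff x.2.1.1.coeff g.1.coeff r.coeff := by
    intro x g r
    simp only [hVu, Sob.coeff_add, hB₁, (hPL _ _).2, (hPH _ _).2, hCΨ, hιr, hιy, uCoef, qCoef,
      two_mul]
  have cv : ∀ (U : Sob u 2) (w : Sob (-1 - ε) ∞) (U' : Coef), U.coeff = U' →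
      (ιu U + Vw (ιw w)).coeff = U' + bessel β w.coeff := by
    intro U w U' hU
    rw [Sob.coeff_add, hιu, hVw, hιw, hU]
  have cB : ∀ (U : Sob u 2) (w : Sob (-1 - ε) ∞) (S : Sob s₁ 2),
      conv (U.coeff + bessel β w.coeff) S.coeff =
        conv U.coeff S.coeff + conv S.coeff (bessel β w.coeff) := by
    intro U w S
    have h1 := hBb (ιv (ιu U)) S
    have h2 := hBb (ιv (Vw (ιw w))) S
    have h3 := hBb (ιv (ιu U) + ιv (Vw (ιw w))) S
    rw [map_add, add_apply, Sob.coeff_add, h1, h2, Sob.coeff_add] at h3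
    simp only [hιv, hιu, hVw, hιw] at h3
    rw [← h3, conv_comm S.coeff]
  have cY : ∀ (U : Sob u 2) (S : Sob s₁ 2) (w : Sob (-1 - ε) ∞) (ψ : Sob (-(1 / 2) - ε) ∞)
      (z : Sob (β - 3 / 2 - ε) ∞),
      (-(BY U S + BW S w) + -(PY (ιu U + Vw (ιw w)) ψ + (RY U ψ + ιz' (ιz z)))).coeff =
        -conv (U.coeff + bessel β w.coeff) S.coeff -
          (paraHigh φ (U.coeff + bessel β w.coeff) ψ.coeff +
            (reson φ U.coeff ψ.coeff + z.coeff)) := by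
    intro U S w ψ z
    rw [Sob.coeff_add, Sob.coeff_neg, Sob.coeff_neg, Sob.coeff_add, Sob.coeff_add, Sob.coeff_add,
      (hPY _ _).2, (hRY _ _).2, hιz', hιz, hBY, hBW, cv _ _ _ rfl, cB]
    exact (sub_eq_add_neg _ _).symm
  refine ⟨⟨waveProp₃ s₁ s₂ (1 / 2 + 4 * ε), _, _, _, 2, by norm_num,
    norm_waveProp₃_le _ _ _, continuous_waveProp₃ _ _ _, lX.prodMk (lY.prodMk lP₁), lV, lρ⟩,
    rfl, fun x g r => ?_, fun x g r => ?_, fun x g r => ?_, fun x g r => ?_, fun x g => ?_⟩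
  · refine (hιv _).trans ?_
    rw [vCoef_eq]
    exact cv _ _ _ (cU x g r)
  · refine (Sob.coeff_neg _).trans ?_
    rw [(hPX _ _).2, vCoef_eq, cv _ _ _ (cU x g r)]
  · refine (cY _ _ _ _ _).trans ?_
    rw [cU x g r, cS, yCoef, vCoef_eq]
  · refine (hP₁ _ _).trans ?_
    rw [vCoef_eq, cv _ _ _ (cU x g r)]
  · refine (Sob.coeff_neg _).trans ?_
    rw [(hRR _ _).2]

/-! ### Solutions of the system as fixed points -/

section data

variable {s₁ s₂ s₃ β ε T p : ℝ}

variable (T p) in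
/-- The free evolution of the initial data. -/
def freeCurve (f : (Sob s₁ 2 × Sob (s₁ - 1) 2) × (Sob s₂ 2 × Sob (s₂ - 1) 2)) :
    C(Icc (0 : ℝ) T, State s₁ s₂ p) where
  toFun t := (freeProp s₁ t f.1, freeProp s₂ t f.2, freeProp p t 0)
  continuous_toFun := by
    refine Continuous.prodMk ?_ (Continuous.prodMk ?_ ?_)
    · exact (continuous_freeProp s₁).comp (continuous_subtype_val.prodMk continuous_const)
    · exact (continuous_freeProp s₂).comp (continuous_subtype_val.prodMk continuous_const)
    · exact (continuous_freeProp p).comp (continuous_subtype_val.prodMk continuous_const)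

theorem norm_freeCurve_sub_le (f f' : (Sob s₁ 2 × Sob (s₁ - 1) 2) × (Sob s₂ 2 × Sob (s₂ - 1) 2)) :
    ‖freeCurve T p f - freeCurve T p f'‖ ≤ 6 * ‖f - f'‖ := by
  refine (ContinuousMap.norm_le _ (by positivity)).2 fun t => ?_
  have h1 := (freeProp s₁ t).le_of_opNorm_le (norm_freeProp_le s₁ t) (f.1 - f'.1)
  have h2 := (freeProp s₂ t).le_of_opNorm_le (norm_freeProp_le s₂ t) (f.2 - f'.2)
  have e1 := norm_fst_le (f - f')
  have e2 := norm_snd_le (f - f')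
  rw [map_sub] at h1 h2
  refine max_le (h1.trans ?_) (max_le (h2.trans ?_) ?_)
  · exact mul_le_mul_of_nonneg_left e1 (by norm_num)
  · exact mul_le_mul_of_nonneg_left e2 (by norm_num)
  · change ‖freeProp p t 0 - freeProp p t 0‖ ≤ _
    rw [sub_self, norm_zero]
    positivity

theorem freeCurve_zero : freeCurve (s₁ := s₁) (s₂ := s₂) T p 0 = 0 := by
  ext1 t
  change (freeProp s₁ t 0, freeProp s₂ t 0, freeProp p t 0) = 0
  rw [map_zero, map_zero, map_zero]
  rfl

theorem continuous_freeCurve : Continuous (freeCurve (s₁ := s₁) (s₂ := s₂) T p) :=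
  (LipschitzWith.of_dist_le_mul (K := 6) fun f f' => by
    rw [dist_eq_norm, dist_eq_norm]
    exact norm_freeCurve_sub_le f f').continuous

/-- The curve `(Ψ, W, Z)`. -/
def noise (Ξ : EnhancedData s₁ s₂ s₃ β ε T) : C(Icc (0 : ℝ) T, Noise β ε) :=
  Ξ.Ψ.1.1.prodMk (Ξ.W.prodMk Ξ.Z)

variable (p) in
/-- The data of the abstract model. -/
def modelData (Ξ : EnhancedData s₁ s₂ s₃ β ε T) :
    Model.Data (State s₁ s₂ p) (Noise β ε) (Sob s₃ 2) (Sob 0 2) T :=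
  (freeCurve T p ((Ξ.X₀, Ξ.X₁), (Ξ.Y₀, Ξ.Y₁)), noise Ξ, Ξ.J)

theorem causal_modelData (Ξ : EnhancedData s₁ s₂ s₃ β ε T) : Causal (modelData p Ξ).2.2 := Ξ.causal

theorem continuous_prodMk_curve {A B : Type*} [TopologicalSpace A] [TopologicalSpace B] :
    Continuous fun q : C(Icc (0 : ℝ) T, A) × C(Icc (0 : ℝ) T, B) => q.1.prodMk q.2 := by
  refine ContinuousMap.continuous_of_continuous_uncurry _ ?_
  exact (ContinuousEval.continuous_eval.comp
    ((continuous_fst.comp continuous_fst).prodMk continuous_snd)).prodMk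
    (ContinuousEval.continuous_eval.comp
    ((continuous_snd.comp continuous_fst).prodMk continuous_snd))

theorem continuous_modelData :
    Continuous (modelData p : EnhancedData s₁ s₂ s₃ β ε T → _) := by
  have h : Continuous (EnhancedData.toProd : EnhancedData s₁ s₂ s₃ β ε T → _) :=
    continuous_induced_dom
  have h1 := continuous_fst.comp h
  have h2 := continuous_fst.comp (continuous_snd.comp h)
  have h3 := continuous_fst.comp (continuous_snd.comp (continuous_snd.comp h))
  have h4 := continuous_snd.comp (continuous_snd.comp (continuous_snd.comp h))
  have hΨ := continuous_fst.comp (continuous_subtype_val.comp h3)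
  have hW := continuous_fst.comp h4
  have hZ := continuous_fst.comp (continuous_snd.comp h4)
  have hJ := continuous_snd.comp (continuous_snd.comp h4)
  exact (continuous_freeCurve.comp (h1.prodMk h2)).prodMk
    ((continuous_prodMk_curve.comp (hΨ.prodMk (continuous_prodMk_curve.comp (hW.prodMk hZ)))).prodMk
      hJ)

end data

section components

variable {s₁ s₂ p T : ℝ}

/-- The component `X`. -/
def compX : C(State s₁ s₂ p, Sob s₁ 2) := ⟨fun q => q.1.1, by fun_prop⟩

/-- The component `∂_t X`. -/
def compX' : C(State s₁ s₂ p, Sob (s₁ - 1) 2) := ⟨fun q => q.1.2, by fun_prop⟩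

/-- The component `Y`. -/
def compY : C(State s₁ s₂ p, Sob s₂ 2) := ⟨fun q => q.2.1.1, by fun_prop⟩

/-- The component `∂_t Y`. -/
def compY' : C(State s₁ s₂ p, Sob (s₂ - 1) 2) := ⟨fun q => q.2.1.2, by fun_prop⟩

end components

section solution

variable {φ : ℝ → ℝ} {c₀ s₁ s₂ s₃ β ε p θ T : ℝ}
  {m : Model (State s₁ s₂ p) (Forcing s₁ s₂ p) (Noise β ε) (Sob s₃ 2) (Sob 0 2)}
  (hT : 0 ≤ T)

theorem IsHartree.flow_apply (hm : IsHartree φ c₀ θ m) (q : C(Icc (0 : ℝ) T, State s₁ s₂ p × Noise β ε))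
    (r : Lp (Sob s₃ 2) 3 (timeMeasure T)) (t : Icc (0 : ℝ) T) :
    m.flow hT q r t = (duhInt (waveProp s₁) T (fun s => (m.force hT q r s).1) t,
      duhInt (waveProp s₂) T (fun s => (m.force hT q r s).2.1) t,
      duhInt (waveProp p) T (fun s => (m.force hT q r s).2.2) t) := by
  have key := fun {B : Type} [NormedAddCommGroup B] [NormedSpace ℂ B] [CompleteSpace B]
    (P : State s₁ s₂ p →L[ℂ] B) => clm_duhInt m.C_nonneg m.norm_D_le m.cont_D
      (m.integrable_force hT q r) P (t : ℝ)
  have h1 := key (ContinuousLinearMap.fst ℂ _ _)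
  have h2 := key ((ContinuousLinearMap.fst ℂ _ _).comp (ContinuousLinearMap.snd ℂ _ _))
  have h3 := key ((ContinuousLinearMap.snd ℂ _ _).comp (ContinuousLinearMap.snd ℂ _ _))
  rw [hm.D_eq] at h1 h2 h3
  refine Prod.ext ?_ (Prod.ext ?_ ?_)
  · change (duhInt m.D T _ (t : ℝ)).1 = _
    rw [hm.D_eq]; exact h1
  · change (duhInt m.D T _ (t : ℝ)).2.1 = _
    rw [hm.D_eq]; exact h2
  · change (duhInt m.D T _ (t : ℝ)).2.2 = _
    rw [hm.D_eq]; exact h3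

theorem integrable_force_comp {B : Type*} [NormedAddCommGroup B] [NormedSpace ℂ B]
    (P : Forcing s₁ s₂ p →L[ℂ] B) (q : C(Icc (0 : ℝ) T, State s₁ s₂ p × Noise β ε))
    (r : Lp (Sob s₃ 2) 3 (timeMeasure T)) :
    Integrable (fun s => P (m.force hT q r s)) (timeMeasure T) :=
  P.integrable_comp (m.integrable_force hT q r)

end solution

theorem coeffAt_of_mem {s T : ℝ} {p : ℝ≥0∞} [Fact (1 ≤ p)] (u : C(Icc (0 : ℝ) T, Sob s p)) {t : ℝ}
    (ht : t ∈ Icc (0 : ℝ) T) : coeffAt u t = (u ⟨t, ht⟩).coeff := dif_pos ht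

theorem duhamel_congr {F F' : ℝ → Coef} {t : ℝ} (ht : 0 ≤ t) (h : ∀ s ∈ Icc 0 t, F s = F' s) :
    duhamel F t = duhamel F' t := by
  ext n
  refine intervalIntegral.integral_congr fun s hs => ?_
  rw [uIcc_of_le ht] at hs
  rw [h s hs]

theorem linEvol_zero (t : ℝ) : linEvol 0 0 t = 0 := by
  ext n; simp [linEvol]

theorem reson_zero (φ : ℝ → ℝ) (g : Coef) : reson φ 0 g = 0 := by
  ext n; simp [reson, blocks]

section solution

variable {φ : ℝ → ℝ} {c₀ s₁ s₂ s₃ β ε p θ T : ℝ}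
  {m : Model (State s₁ s₂ p) (Forcing s₁ s₂ p) (Noise β ε) (Sob s₃ 2) (Sob 0 2)}
  (hm : IsHartree φ c₀ θ m) (hT : 0 ≤ T) (Ξ : EnhancedData s₁ s₂ s₃ β ε T)

/-- A state whose components `X`, `Y` are those of `z`. -/
def Matches (x : C(Icc (0 : ℝ) T, State s₁ s₂ p)) (z : ZSpace s₁ s₂ s₃ T) : Prop :=
  ∀ t, (x t).1.1 = z.1.1.1 t ∧ (x t).2.1.1 = z.2.1.1.1 t

variable {Ξ} {x : C(Icc (0 : ℝ) T, State s₁ s₂ p)} {z : ZSpace s₁ s₂ s₃ T}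

theorem Matches.curveV_eq (hx : Matches x z) {t : ℝ} (ht : t ∈ Icc (0 : ℝ) T) :
    curveV φ Ξ z t = vCoef φ β (x ⟨t, ht⟩).1.1.coeff (x ⟨t, ht⟩).2.1.1.coeff
      (noise Ξ ⟨t, ht⟩).1.coeff (z.2.2 t).coeff (noise Ξ ⟨t, ht⟩).2.1.coeff := by
  rw [(hx ⟨t, ht⟩).1, (hx ⟨t, ht⟩).2]
  simp only [curveV, curveQ, curveX, curveY, curveR, curveΨ, coeffAt_of_mem _ ht]
  rfl

theorem Matches.curveU_eq (hx : Matches x z) {t : ℝ} (ht : t ∈ Icc (0 : ℝ) T) :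
    curveU φ Ξ z t = uCoef φ β (x ⟨t, ht⟩).1.1.coeff (x ⟨t, ht⟩).2.1.1.coeff
      (noise Ξ ⟨t, ht⟩).1.coeff (z.2.2 t).coeff := by
  rw [(hx ⟨t, ht⟩).1, (hx ⟨t, ht⟩).2]
  simp only [curveU, curveQ, curveX, curveY, curveR, curveΨ, coeffAt_of_mem _ ht]
  rfl

theorem curveΨ_eq {t : ℝ} (ht : t ∈ Icc (0 : ℝ) T) :
    curveΨ Ξ t = (noise Ξ ⟨t, ht⟩).1.coeff := coeffAt_of_mem _ ht

theorem extend_prodMk {t : ℝ} (ht : t ∈ Icc (0 : ℝ) T) :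
    extend hT (x.prodMk (noise Ξ)) t = (x ⟨t, ht⟩, noise Ξ ⟨t, ht⟩) := extend_of_mem hT _ ht

theorem IsHartree.force_fst (hm : IsHartree φ c₀ θ m) (hx : Matches x z) {t : ℝ}
    (ht : t ∈ Icc (0 : ℝ) T) :
    (m.force hT (x.prodMk (noise Ξ)) z.2.2 t).1.coeff = forceX φ Ξ z t := by
  rw [Model.force, extend_prodMk hT ht, hm.F_fst, forceX, hx.curveV_eq ht, curveΨ_eq ht]

theorem IsHartree.force_snd (hm : IsHartree φ c₀ θ m) (hx : Matches x z) {t : ℝ}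
    (ht : t ∈ Icc (0 : ℝ) T) :
    (m.force hT (x.prodMk (noise Ξ)) z.2.2 t).2.1.coeff = forceY φ Ξ z t := by
  rw [Model.force, extend_prodMk hT ht, hm.F_snd, forceY, resonV, hx.curveV_eq ht,
    hx.curveU_eq ht, curveΨ_eq ht, curveX, curveY, coeffAt_of_mem _ ht, coeffAt_of_mem _ ht,
    coeffAt_of_mem _ ht, ← (hx ⟨t, ht⟩).1, ← (hx ⟨t, ht⟩).2]
  rfl

theorem IsHartree.force_thd (hm : IsHartree φ c₀ θ m) (hx : Matches x z) {t : ℝ}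
    (ht : t ∈ Icc (0 : ℝ) T) :
    (m.force hT (x.prodMk (noise Ξ)) z.2.2 t).2.2.coeff =
      paraLow₁ φ θ c₀ (curveV φ Ξ z t) (curveΨ Ξ t) := by
  rw [Model.force, extend_prodMk hT ht, hm.F_thd, hx.curveV_eq ht, curveΨ_eq ht]

theorem IsHartree.arg_coeff (hm : IsHartree φ c₀ θ m) (hx : Matches x z) :
    ∀ᵐ t ∂timeMeasure T,
      (m.arg hT (x.prodMk (noise Ξ)) z.2.2 t).coeff = curveV φ Ξ z t := by
  filter_upwards [m.arg_ae hT (x.prodMk (noise Ξ)) z.2.2, ae_mem_Icc T] with t h1 ht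
  rw [h1, extend_prodMk hT ht, hm.V_coeff, hx.curveV_eq ht]

variable (Ξ) in
theorem IsHartree.step_apply (hm : IsHartree φ c₀ θ m)
    (y : C(Icc (0 : ℝ) T, State s₁ s₂ p) × Lp (Sob s₃ 2) 3 (timeMeasure T)) (t : Icc (0 : ℝ) T) :
    (m.step hT (modelData p Ξ) y).1 t =
      (freeProp s₁ t (Ξ.X₀, Ξ.X₁) + duhInt (waveProp s₁) T
          (fun s => (m.force hT (y.1.prodMk (noise Ξ)) y.2 s).1) t,
        freeProp s₂ t (Ξ.Y₀, Ξ.Y₁) + duhInt (waveProp s₂) T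
          (fun s => (m.force hT (y.1.prodMk (noise Ξ)) y.2 s).2.1) t,
        freeProp p t 0 + duhInt (waveProp p) T
          (fun s => (m.force hT (y.1.prodMk (noise Ξ)) y.2 s).2.2) t) := by
  change freeCurve T p _ t + m.flow hT (y.1.prodMk (noise Ξ)) y.2 t = _
  rw [hm.flow_apply]
  rfl

variable (Ξ) in
/-- The element of the solution space given by a state of the abstract system. -/
def IsHartree.toZ (hm : IsHartree φ c₀ θ m)
    (y : C(Icc (0 : ℝ) T, State s₁ s₂ p) × Lp (Sob s₃ 2) 3 (timeMeasure T)) :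
    ZSpace s₁ s₂ s₃ T :=
  -- The components are taken from the image of y under the step, which is always a Duhamel curve,
  -- so the time derivative is available without assuming that y is a fixed point.
  (⟨(compX.comp (m.step hT (modelData p Ξ) y).1, compX'.comp (m.step hT (modelData p Ξ) y).1),
    isTimeDeriv_wave (Ξ.X₀, Ξ.X₁) hT (integrable_force_comp hT (ContinuousLinearMap.fst ℂ _ _)
      (y.1.prodMk (noise Ξ)) y.2) fun t => congrArg Prod.fst (hm.step_apply hT Ξ y t)⟩,
  ⟨(compY.comp (m.step hT (modelData p Ξ) y).1, compY'.comp (m.step hT (modelData p Ξ) y).1),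
    isTimeDeriv_wave (Ξ.Y₀, Ξ.Y₁) hT (integrable_force_comp hT
      ((ContinuousLinearMap.fst ℂ _ _).comp (ContinuousLinearMap.snd ℂ _ _))
      (y.1.prodMk (noise Ξ)) y.2) fun t => congrArg (fun q => q.2.1) (hm.step_apply hT Ξ y t)⟩,
  y.2)

/-- The third component starts from zero data, hence is the pure Duhamel integral of the truncated
paraproduct. -/
theorem IsHartree.para_eq (hm : IsHartree φ c₀ θ m) (hx : Matches x z) {t : ℝ}
    (ht : t ∈ Icc (0 : ℝ) T) :
    ((m.step hT (modelData p Ξ) (x, z.2.2)).1 ⟨t, ht⟩).2.2.1.coeff =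
      para₁ φ θ c₀ Ξ (curveV φ Ξ z) t := by
  rw [hm.step_apply hT Ξ]
  refine (coeff_wave_fst 0 (integrable_force_comp hT ((ContinuousLinearMap.snd ℂ _ _).comp
    (ContinuousLinearMap.snd ℂ _ _)) (x.prodMk (noise Ξ)) z.2.2) ht).trans ?_
  rw [Prod.fst_zero, Prod.snd_zero, Sob.coeff_zero, Sob.coeff_zero, linEvol_zero, zero_add, para₁]
  exact duhamel_congr ht.1 fun s hs => hm.force_thd hT hx ⟨hs.1, hs.2.trans ht.2⟩

theorem IsHartree.coeff_X (hm : IsHartree φ c₀ θ m) (hx : Matches x z) {t : ℝ}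
    (ht : t ∈ Icc (0 : ℝ) T) :
    ((m.step hT (modelData p Ξ) (x, z.2.2)).1 ⟨t, ht⟩).1.1.coeff =
      linEvol Ξ.X₀.coeff Ξ.X₁.coeff t + duhamel (forceX φ Ξ z) t := by
  rw [hm.step_apply hT Ξ]
  refine (coeff_wave_fst _ (integrable_force_comp hT (ContinuousLinearMap.fst ℂ _ _)
    (x.prodMk (noise Ξ)) z.2.2) ht).trans ?_
  congr 1
  exact duhamel_congr ht.1 fun s hs => hm.force_fst hT hx ⟨hs.1, hs.2.trans ht.2⟩

theorem IsHartree.coeff_Y (hm : IsHartree φ c₀ θ m) (hx : Matches x z) {t : ℝ}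
    (ht : t ∈ Icc (0 : ℝ) T) :
    ((m.step hT (modelData p Ξ) (x, z.2.2)).1 ⟨t, ht⟩).2.1.1.coeff =
      linEvol Ξ.Y₀.coeff Ξ.Y₁.coeff t + duhamel (forceY φ Ξ z) t := by
  rw [hm.step_apply hT Ξ]
  refine (coeff_wave_fst _ (integrable_force_comp hT
    ((ContinuousLinearMap.fst ℂ _ _).comp (ContinuousLinearMap.snd ℂ _ _))
    (x.prodMk (noise Ξ)) z.2.2) ht).trans ?_
  congr 1
  exact duhamel_congr ht.1 fun s hs => hm.force_snd hT hx ⟨hs.1, hs.2.trans ht.2⟩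

theorem IsHartree.step_zero (hm : IsHartree φ c₀ θ m)
    (y : C(Icc (0 : ℝ) T, State s₁ s₂ p) × Lp (Sob s₃ 2) 3 (timeMeasure T)) :
    (m.step hT (modelData p Ξ) y).1 ⟨0, le_rfl, hT⟩ = ((Ξ.X₀, Ξ.X₁), (Ξ.Y₀, Ξ.Y₁), 0) := by
  rw [hm.step_apply hT Ξ]
  refine Prod.ext (wave_zero _ hT) (Prod.ext (wave_zero _ hT) (wave_zero _ hT))

theorem IsHartree.curveX_toZ (hm : IsHartree φ c₀ θ m)
    (y : C(Icc (0 : ℝ) T, State s₁ s₂ p) × Lp (Sob s₃ 2) 3 (timeMeasure T)) {t : ℝ}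
    (ht : t ∈ Icc (0 : ℝ) T) : curveX (hm.toZ hT Ξ y) t =
      ((m.step hT (modelData p Ξ) y).1 ⟨t, ht⟩).1.1.coeff := coeffAt_of_mem _ ht

theorem IsHartree.curveY_toZ (hm : IsHartree φ c₀ θ m)
    (y : C(Icc (0 : ℝ) T, State s₁ s₂ p) × Lp (Sob s₃ 2) 3 (timeMeasure T)) {t : ℝ}
    (ht : t ∈ Icc (0 : ℝ) T) : curveY (hm.toZ hT Ξ y) t =
      ((m.step hT (modelData p Ξ) y).1 ⟨t, ht⟩).2.1.1.coeff := coeffAt_of_mem _ ht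

theorem IsHartree.init_toZ (hm : IsHartree φ c₀ θ m)
    (y : C(Icc (0 : ℝ) T, State s₁ s₂ p) × Lp (Sob s₃ 2) 3 (timeMeasure T)) :
    coeffAt (hm.toZ hT Ξ y).1.1.2 0 = Ξ.X₁.coeff ∧
      coeffAt (hm.toZ hT Ξ y).2.1.1.2 0 = Ξ.Y₁.coeff := by
  have h := hm.step_zero hT (Ξ := Ξ) y
  constructor
  · refine (coeffAt_of_mem _ (show (0 : ℝ) ∈ Icc (0 : ℝ) T from ⟨le_rfl, hT⟩)).trans ?_
    change ((m.step hT (modelData p Ξ) y).1 ⟨0, _⟩).1.2.coeff = _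
    rw [h]
  · refine (coeffAt_of_mem _ (show (0 : ℝ) ∈ Icc (0 : ℝ) T from ⟨le_rfl, hT⟩)).trans ?_
    change ((m.step hT (modelData p Ξ) y).1 ⟨0, _⟩).2.1.2.coeff = _
    rw [h]

theorem IsHartree.matches_toZ (hm : IsHartree φ c₀ θ m)
    {y : C(Icc (0 : ℝ) T, State s₁ s₂ p) × Lp (Sob s₃ 2) 3 (timeMeasure T)}
    (hy : m.step hT (modelData p Ξ) y = y) : Matches y.1 (hm.toZ hT Ξ y) := fun t =>
  have hy1 := congrArg Prod.fst hy
  ⟨congrArg (fun w => (w t).1.1) hy1.symm, congrArg (fun w => (w t).2.1.1) hy1.symm⟩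

/-- The adjoined component P vanishes at time 0, hence so does ρ = -P ⊜ Ψ; the J-term vanishes by
causality. -/
theorem IsHartree.tendsto_toZ (hm : IsHartree φ c₀ θ m) (hT' : 0 < T)
    {y : C(Icc (0 : ℝ) T, State s₁ s₂ p) × Lp (Sob s₃ 2) 3 (timeMeasure T)}
    (hy : m.step hT (modelData p Ξ) y = y) :
    Tendsto (fun t => ‖y.2 t‖) (𝓝[>] 0 ⊓ ae volume) (𝓝 0) := by
  refine m.tendsto_of_step_eq hT hT' (causal_modelData Ξ) hy (Sob.ext ?_)
  refine (hm.ρ_coeff _ _).trans ?_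
  have h : y.1 ⟨0, le_rfl, hT⟩ = ((Ξ.X₀, Ξ.X₁), (Ξ.Y₀, Ξ.Y₁), 0) := by
    rw [← hm.step_zero hT (Ξ := Ξ) y, hy]
  rw [h]
  change -reson φ (Sob.coeff (0 : Sob p 2)) _ = _
  rw [Sob.coeff_zero, Sob.coeff_zero, reson_zero, neg_zero]

/-- Fixed points of the abstract system are solutions. -/
theorem IsHartree.isSolution_toZ (hm : IsHartree φ c₀ θ m) (hT' : 0 < T)
    {y : C(Icc (0 : ℝ) T, State s₁ s₂ p) × Lp (Sob s₃ 2) 3 (timeMeasure T)}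
    (hy : m.step hT (modelData p Ξ) y = y) : IsSolution φ θ c₀ Ξ (hm.toZ hT Ξ y) := by
  have h0 : (0 : ℝ) ∈ Icc (0 : ℝ) T := ⟨le_rfl, hT⟩
  have hmatch := hm.matches_toZ hT hy
  have hy' : (y.1, (hm.toZ hT Ξ y).2.2) = y := rfl
  have hX := fun t ht => hm.coeff_X hT hmatch (t := t) (Ξ := Ξ) ht
  have hY := fun t ht => hm.coeff_Y hT hmatch (t := t) (Ξ := Ξ) ht
  have hP := fun t ht => hm.para_eq hT hmatch (t := t) (Ξ := Ξ) ht
  have hA := hm.arg_coeff hT hmatch (Ξ := Ξ)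
  rw [hy'] at hX hY hP
  have h1 := m.out_ae hT (y.1.prodMk (noise Ξ)) y.2 Ξ.J
  have hy2 : m.out hT (y.1.prodMk (noise Ξ)) y.2 Ξ.J = y.2 := congrArg Prod.snd hy
  rw [hy2] at h1
  rw [hy] at hP
  constructor
  · rw [hm.curveX_toZ hT y h0, hm.step_zero hT y]
  · exact (hm.init_toZ hT y).1
  · rw [hm.curveY_toZ hT y h0, hm.step_zero hT y]
  · exact (hm.init_toZ hT y).2
  · exact hm.tendsto_toZ hT hT' hy
  · intro t ht
    rw [hm.curveX_toZ hT y ht, hX]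
  · intro t ht
    rw [hm.curveY_toZ hT y ht, hY]
  · refine ⟨m.arg hT (y.1.prodMk (noise Ξ)) y.2, hA, ?_⟩
    filter_upwards [h1, ae_mem_Icc T] with t h1 ht
    change (y.2 t).coeff = _
    rw [h1, Sob.coeff_sub, extend_prodMk hT ht, hm.ρ_coeff, curveΨ_eq ht, ← hP t ht]

/-- Every solution comes from a fixed point of the abstract system. -/
theorem IsHartree.exists_step_eq (hm : IsHartree φ c₀ θ m) (hT' : 0 < T)
    {z : ZSpace s₁ s₂ s₃ T} (hz : IsSolution φ θ c₀ Ξ z) :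
    ∃ y : C(Icc (0 : ℝ) T, State s₁ s₂ p) × Lp (Sob s₃ 2) 3 (timeMeasure T),
      m.step hT (modelData p Ξ) y = y ∧ z = hm.toZ hT Ξ y := by
  -- The derivatives and P are filled with zeros. The forcing ignores these slots, so one step
  -- produces the correct values.
  set x₀ : C(Icc (0 : ℝ) T, State s₁ s₂ p) :=
    ⟨fun t => ((z.1.1.1 t, 0), (z.2.1.1.1 t, 0), 0), by fun_prop⟩ with hx₀
  have h₀ : Matches x₀ z := fun t => ⟨rfl, rfl⟩
  set x := (m.step hT (modelData p Ξ) (x₀, z.2.2)).1 with hx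
  have h₁ : Matches x z := by
    intro t
    constructor
    · refine Sob.ext ?_
      rw [hx, hm.coeff_X hT h₀ t.2, ← hz.eq_X t t.2]
      exact coeffAt_of_mem _ t.2
    · refine Sob.ext ?_
      rw [hx, hm.coeff_Y hT h₀ t.2, ← hz.eq_Y t t.2]
      exact coeffAt_of_mem _ t.2
  have hext : ∀ t, (extend hT (x₀.prodMk (noise Ξ)) t).1.1.1 =
      (extend hT (x.prodMk (noise Ξ)) t).1.1.1 ∧ (extend hT (x₀.prodMk (noise Ξ)) t).1.2.1.1 =
      (extend hT (x.prodMk (noise Ξ)) t).1.2.1.1 := fun t =>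
    ⟨((h₀ _).1.trans (h₁ _).1.symm :), ((h₀ _).2.trans (h₁ _).2.symm :)⟩
  -- P enters only ρ, and the derivatives enter nothing; as x and x₀ share X and Y, they produce the
  -- same forcing, and a second step does not change x.
  have hforce : m.force hT (x.prodMk (noise Ξ)) z.2.2 = m.force hT (x₀.prodMk (noise Ξ)) z.2.2 := by
    funext t
    have e1 := (hext t).1
    have e2 := (hext t).2
    refine Prod.ext (Sob.ext ?_) (Prod.ext (Sob.ext ?_) (Sob.ext ?_))
    · rw [Model.force, Model.force, hm.F_fst, hm.F_fst, e1, e2]; rfl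
    · rw [Model.force, Model.force, hm.F_snd, hm.F_snd, e1, e2]; rfl
    · rw [Model.force, Model.force, hm.F_thd, hm.F_thd, e1, e2]; rfl
  have hflow : (m.step hT (modelData p Ξ) (x, z.2.2)).1 = x := by
    ext1 t
    rw [hm.step_apply hT Ξ, hx, hm.step_apply hT Ξ, hforce]
  obtain ⟨w, hw, hR⟩ := hz.eq_R
  have hwarg : w = m.arg hT (x.prodMk (noise Ξ)) z.2.2 := by
    refine Lp.ext ?_
    filter_upwards [hw, hm.arg_coeff hT h₁ (Ξ := Ξ)] with t h1 h2
    exact Sob.ext (h1.trans h2.symm)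
  have hout : m.out hT (x.prodMk (noise Ξ)) z.2.2 Ξ.J = z.2.2 := by
    refine Lp.ext ?_
    filter_upwards [m.out_ae hT (x.prodMk (noise Ξ)) z.2.2 Ξ.J, hR, ae_mem_Icc T] with t h1 h2 ht
    refine Sob.ext ?_
    change _ = curveR z t
    rw [h1, h2, Sob.coeff_sub, extend_prodMk hT ht, hm.ρ_coeff, curveΨ_eq ht,
      ← hm.para_eq hT h₁ ht, hflow, hwarg]
  have hfix : m.step hT (modelData p Ξ) (x, z.2.2) = (x, z.2.2) := Prod.ext hflow hout
  refine ⟨(x, z.2.2), hfix, ?_⟩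
  have hX : z.1.1.1 = (hm.toZ hT Ξ (x, z.2.2)).1.1.1 := by
    ext1 t
    exact ((h₁ t).1.symm.trans (congrArg (fun w => (w t).1.1) hflow.symm) :)
  have hY : z.2.1.1.1 = (hm.toZ hT Ξ (x, z.2.2)).2.1.1.1 := by
    ext1 t
    exact ((h₁ t).2.symm.trans (congrArg (fun w => (w t).2.1.1) hflow.symm) :)
  -- The recorded time derivative is determined by the curve itself.
  have hX' : z.1.1.2 = (hm.toZ hT Ξ (x, z.2.2)).1.1.2 := by
    have := z.1.2
    rw [hX] at this
    exact this.unique hT' (hm.toZ hT Ξ (x, z.2.2)).1.2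
  have hY' : z.2.1.1.2 = (hm.toZ hT Ξ (x, z.2.2)).2.1.1.2 := by
    have := z.2.1.2
    rw [hY] at this
    exact this.unique hT' (hm.toZ hT Ξ (x, z.2.2)).2.1.2
  exact Prod.ext (Subtype.ext (Prod.ext hX hX'))
    (Prod.ext (Subtype.ext (Prod.ext hY hY')) rfl)

end solution

/-! ### Real-valued data -/

namespace IsRealCoef

variable {f g : Coef}

theorem add (hf : IsRealCoef f) (hg : IsRealCoef g) : IsRealCoef (f + g) := fun n => by
  rw [Pi.add_apply, Pi.add_apply, hf, hg, map_add]

theorem neg (hf : IsRealCoef f) : IsRealCoef (-f) := fun n => by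
  rw [Pi.neg_apply, Pi.neg_apply, hf, map_neg]

theorem sub (hf : IsRealCoef f) (hg : IsRealCoef g) : IsRealCoef (f - g) := by
  rw [sub_eq_add_neg]
  exact hf.add hg.neg

theorem two_mul (hf : IsRealCoef f) : IsRealCoef (2 * f) := by
  rw [_root_.two_mul]
  exact hf.add hf

/-- Even real multipliers preserve real-valuedness. -/
theorem multiplier {a : Freq → ℝ} (ha : ∀ n, a (-n) = a n) (hf : IsRealCoef f) :
    IsRealCoef fun n => (a n : ℂ) * f n := fun n => by
  change (a (-n) : ℂ) * f (-n) = _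
  rw [ha, hf, map_mul, Complex.conj_ofReal]

/-- The substitution m ↦ -m in the sum at -n gives the conjugate of the sum at n. -/
theorem bilinear {a : Freq → Freq → ℝ} (ha : ∀ m l, a (-m) (-l) = a m l) (hf : IsRealCoef f)
    (hg : IsRealCoef g) :
    IsRealCoef fun n => ∑' m : Freq, (a m (n - m) : ℂ) * (f m * g (n - m)) := fun n => by
  change ∑' m : Freq, (a m (-n - m) : ℂ) * (f m * g (-n - m)) = _
  rw [Complex.conj_tsum, ← (Equiv.neg Freq).tsum_eq]
  refine tsum_congr fun m => ?_
  rw [Equiv.neg_apply, show -n - -m = -(n - m) by abel, ha, hf, hg, map_mul, map_mul,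
    Complex.conj_ofReal]

theorem conv (hf : IsRealCoef f) (hg : IsRealCoef g) : IsRealCoef (conv f g) := by
  have h := bilinear (a := fun _ _ => 1) (fun _ _ => rfl) hf hg
  simp only [Complex.ofReal_one, one_mul] at h
  exact h

theorem bessel (β : ℝ) (hf : IsRealCoef f) : IsRealCoef (bessel β f) :=
  hf.multiplier fun n => by rw [jap_neg]

end IsRealCoef

theorem lp_neg (φ : ℝ → ℝ) (j : ℕ) (n : Freq) : lp φ j (-n) = lp φ j n := by
  have h : ∀ k, dyadic φ k (-n) = dyadic φ k n := by
    rintro (_ | k) <;> simp only [dyadic, nrm_neg]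
  simp only [lp, h]

namespace IsRealCoef

variable {f g : Coef} (φ : ℝ → ℝ)

theorem blocks (r : ℕ → ℕ → Prop) (hf : IsRealCoef f) (hg : IsRealCoef g) :
    IsRealCoef (blocks φ r f g) := by
  classical
  refine bilinear (a := fun m l => ∑' jk : ℕ × ℕ, if r jk.1 jk.2 then
    lp φ jk.1 m * lp φ jk.2 l else 0) (fun m l => ?_) hf hg
  simp only [lp_neg]

theorem qCoef {x y ψ : Coef} (hx : IsRealCoef x) (hy : IsRealCoef y) (hψ : IsRealCoef ψ) :
    IsRealCoef (qCoef φ x y ψ) :=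
  ((((hx.add hy).conv (hx.add hy)).add (hx.blocks φ _ hψ).two_mul).add
    (hx.blocks φ _ hψ).two_mul).add (hy.conv hψ).two_mul

theorem uCoef (β : ℝ) {x y ψ r : Coef} (hx : IsRealCoef x) (hy : IsRealCoef y) (hψ : IsRealCoef ψ)
    (hr : IsRealCoef r) : IsRealCoef (uCoef φ β x y ψ r) :=
  ((hx.qCoef φ hy hψ).add hr.two_mul).bessel β

theorem vCoef (β : ℝ) {x y ψ r w : Coef} (hx : IsRealCoef x) (hy : IsRealCoef y)
    (hψ : IsRealCoef ψ) (hr : IsRealCoef r) (hw : IsRealCoef w) :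
    IsRealCoef (vCoef φ β x y ψ r w) :=
  (((hx.qCoef φ hy hψ).add hr.two_mul).add hw).bessel β

theorem yCoef (β : ℝ) {x y ψ r w z : Coef} (hx : IsRealCoef x) (hy : IsRealCoef y)
    (hψ : IsRealCoef ψ) (hr : IsRealCoef r) (hw : IsRealCoef w) (hz : IsRealCoef z) :
    IsRealCoef (yCoef φ β x y ψ r w z) :=
  have hv := hx.vCoef φ β hy hψ hr hw
  (hv.conv (hx.add hy)).neg.sub
    ((hv.blocks φ _ hψ).add (((hx.uCoef φ β hy hψ hr).blocks φ _ hψ).add hz))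

end IsRealCoef

/-- The real-valued elements of `H^s`. -/
def realSob (s : ℝ) : Set (Sob s 2) := {f | IsRealCoef f.coeff}

/-- Conjugation is only real-linear, so the defining functionals, the coefficient at -n minus the
conjugate of the one at n, are taken over ℝ. -/
theorem isRealSet_realSob (s : ℝ) : IsRealSet (realSob s) := by
  refine ⟨Freq, fun n => (Sob.coeffL s (-n)).restrictScalars ℝ -
    (Complex.conjCLE : ℂ →L[ℝ] ℂ).comp ((Sob.coeffL s n).restrictScalars ℝ), ?_⟩
  ext f
  refine forall_congr' fun n => ?_
  exact sub_eq_zero.symm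

theorem waveSym_neg (n : Freq) (t : ℝ) : waveSym (-n) t = waveSym n t := by
  simp only [waveSym, jbb, nrm_neg]

theorem waveSym'_neg (n : Freq) (t : ℝ) : waveSym' (-n) t = waveSym' n t := by
  simp only [waveSym', jbb, nrm_neg]

theorem waveProp_mem_realSob (s t : ℝ) {f : Sob (s - 1) 2} (hf : f ∈ realSob (s - 1)) :
    waveProp s t f ∈ realSob s ×ˢ realSob (s - 1) := by
  constructor
  · change IsRealCoef _
    rw [funext (waveProp_fst s t f)]
    exact IsRealCoef.multiplier (fun n => waveSym_neg n _) hf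
  · change IsRealCoef _
    rw [funext (waveProp_snd s t f)]
    exact IsRealCoef.multiplier (fun n => waveSym'_neg n _) hf

theorem freeProp_mem_realSob (s t : ℝ) {f : Sob s 2 × Sob (s - 1) 2}
    (hf : f ∈ realSob s ×ˢ realSob (s - 1)) : freeProp s t f ∈ realSob s ×ˢ realSob (s - 1) := by
  obtain ⟨h1, h2⟩ : IsRealCoef f.1.coeff ∧ IsRealCoef f.2.coeff := hf
  constructor
  · change IsRealCoef _
    rw [funext (freeProp_fst s t f)]
    exact (IsRealCoef.multiplier (fun n => waveSym'_neg n _) h1).add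
      (IsRealCoef.multiplier (fun n => waveSym_neg n _) (h1.add h2))
  · change IsRealCoef _
    rw [funext (freeProp_snd s t f)]
    simp only [← Complex.ofReal_neg]
    exact (IsRealCoef.multiplier (a := fun n => -(jap n ^ 2 * waveSym n (max t 0)))
      (fun n => by simp only [jap_neg, waveSym_neg]) h1).add
      (IsRealCoef.multiplier (fun n => waveSym'_neg n _) h2)

/-- The real-valued states. -/
def realState (s₁ s₂ p : ℝ) : Set (State s₁ s₂ p) :=
  (realSob s₁ ×ˢ realSob (s₁ - 1)) ×ˢ (realSob s₂ ×ˢ realSob (s₂ - 1)) ×ˢ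
    (realSob p ×ˢ realSob (p - 1))

theorem isRealSet_realState (s₁ s₂ p : ℝ) : IsRealSet (realState s₁ s₂ p) :=
  ((isRealSet_realSob _).prod (isRealSet_realSob _)).prod
    (((isRealSet_realSob _).prod (isRealSet_realSob _)).prod
      ((isRealSet_realSob _).prod (isRealSet_realSob _)))

/-- For real-valued data, the fixed point map preserves real-valued functions. -/
theorem IsHartree.step_mem_valuedIn {φ : ℝ → ℝ} {c₀ s₁ s₂ s₃ β ε p θ T : ℝ}
    {m : Model (State s₁ s₂ p) (Forcing s₁ s₂ p) (Noise β ε) (Sob s₃ 2) (Sob 0 2)}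
    (hm : IsHartree φ c₀ θ m) (hT : 0 ≤ T) {Ξ : EnhancedData s₁ s₂ s₃ β ε T} (hΞ : Ξ.IsReal)
    {z : C(Icc (0 : ℝ) T, State s₁ s₂ p) × Lp (Sob s₃ 2) 3 (timeMeasure T)}
    (hz : z ∈ Model.valuedIn T (realState s₁ s₂ p) (realSob s₃)) :
    m.step hT (modelData p Ξ) z ∈ Model.valuedIn T (realState s₁ s₂ p) (realSob s₃) := by
  have h0 : ∀ s, (0 : Sob s 2) ∈ realSob s := fun s => (isRealSet_realSob s).zero_mem
  refine m.step_mem_valuedIn hT (SE' := realSob (s₁ - 1) ×ˢ realSob (s₂ - 1) ×ˢ realSob (p - 1))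
    (SG := {g | IsRealCoef g.1.coeff ∧ IsRealCoef g.2.1.coeff ∧ IsRealCoef g.2.2.coeff})
    (SK := realSob 0) (isRealSet_realState s₁ s₂ p) (isRealSet_realSob s₃) ?_ ?_ ?_ ?_ ?_ ?_ ?_ hz
  · intro t e he
    rw [hm.D_eq]
    exact ⟨waveProp_mem_realSob _ _ he.1, waveProp_mem_realSob _ _ he.2.1,
      waveProp_mem_realSob _ _ he.2.2⟩
  · rintro x ⟨hx, hy, -⟩ g ⟨h1, h2, h3⟩ r hr
    have hx1 : IsRealCoef x.1.1.coeff := hx.1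
    have hy1 : IsRealCoef x.2.1.1.coeff := hy.1
    have hv := hx1.vCoef φ β hy1 h1 hr h2
    refine ⟨?_, ?_, ?_⟩
    · change IsRealCoef _
      rw [hm.F_fst]
      exact (hv.blocks φ _ h1).neg
    · change IsRealCoef _
      rw [hm.F_snd]
      exact hx1.yCoef φ β hy1 h1 hr h2 h3
    · change IsRealCoef _
      rw [hm.F_thd]
      exact hv.blocks φ _ h1
  · rintro x ⟨hx, hy, -⟩ g ⟨h1, h2, -⟩ r hr
    have hx1 : IsRealCoef x.1.1.coeff := hx.1
    change IsRealCoef _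
    rw [hm.V_coeff]
    exact hx1.vCoef φ β hy.1 h1 hr h2
  · rintro x ⟨-, -, hP⟩ g ⟨h1, -, -⟩
    have hP1 : IsRealCoef x.2.2.1.coeff := hP.1
    change IsRealCoef _
    rw [hm.ρ_coeff]
    exact (hP1.blocks φ _ h1).neg
  · intro t
    exact ⟨freeProp_mem_realSob _ _ ⟨hΞ.X₀, hΞ.X₁⟩, freeProp_mem_realSob _ _ ⟨hΞ.Y₀, hΞ.Y₁⟩,
      freeProp_mem_realSob _ _ ⟨h0 _, h0 _⟩⟩
  · exact fun t => ⟨hΞ.Ψ t, hΞ.W t, hΞ.Z t⟩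
  · exact hΞ.J

/-! ### Local well-posedness -/

section restriction

variable {s₁ s₂ s₃ β ε p T T' : ℝ}

theorem norm_comp_inclTime_le {E : Type*} [NormedAddCommGroup E] (hT : T ≤ T')
    (u : C(Icc (0 : ℝ) T', E)) : ‖u.comp (inclTime hT)‖ ≤ ‖u‖ :=
  (ContinuousMap.norm_le _ (norm_nonneg u)).2 fun _ => u.norm_coe_le_norm _

theorem norm_restrict_le (hT : T ≤ T') (J : L2Class s₃ T') : ‖L2Class.restrict hT J‖ ≤ ‖J‖ := by
  have h1 : ‖(restrictLq hT : LqSob ∞ T' s₃ 2 →L[ℂ] LqSob ∞ T s₃ 2)‖ ≤ 1 :=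
    LinearMap.mkContinuous_norm_le _ zero_le_one _
  have h2 : ‖(extendLq hT : LqSob (3 / 2) T 0 2 →L[ℂ] LqSob (3 / 2) T' 0 2)‖ ≤ 1 :=
    LinearMap.mkContinuous_norm_le _ zero_le_one _
  calc ‖L2Class.restrict hT J‖ ≤ 1 * (‖J‖ * 1) :=
        (ContinuousLinearMap.opNorm_comp_le _ _).trans (mul_le_mul h1
          ((ContinuousLinearMap.opNorm_comp_le _ _).trans
            (mul_le_mul_of_nonneg_left h2 (norm_nonneg _))) (norm_nonneg _) zero_le_one)
    _ = ‖J‖ := by ring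

/-- The data of the abstract model are bounded uniformly with respect to the time interval. -/
theorem norm_modelData_restrict_lt (Ξ : EnhancedData s₁ s₂ s₃ β ε T') (hT : T ≤ T') :
    ‖modelData p (Ξ.restrict hT)‖ <
      6 * ‖((Ξ.X₀, Ξ.X₁), (Ξ.Y₀, Ξ.Y₁))‖ + ‖noise Ξ‖ + ‖Ξ.J‖ + 1 := by
  have h1 : ‖freeCurve T p ((Ξ.X₀, Ξ.X₁), (Ξ.Y₀, Ξ.Y₁))‖ ≤
      6 * ‖((Ξ.X₀, Ξ.X₁), (Ξ.Y₀, Ξ.Y₁))‖ := by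
    have h := norm_freeCurve_sub_le (T := T) (p := p) ((Ξ.X₀, Ξ.X₁), (Ξ.Y₀, Ξ.Y₁)) 0
    rwa [freeCurve_zero, sub_zero, sub_zero] at h
  have h2 : ‖noise (Ξ.restrict hT)‖ ≤ ‖noise Ξ‖ := norm_comp_inclTime_le hT (noise Ξ)
  have h3 := norm_restrict_le hT Ξ.J
  have p1 := norm_nonneg ((Ξ.X₀, Ξ.X₁), (Ξ.Y₀, Ξ.Y₁))
  have p2 := norm_nonneg (noise Ξ)
  have p3 := norm_nonneg Ξ.J
  refine max_lt (h1.trans_lt (by linarith)) (max_lt (h2.trans_lt (by linarith))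
    (h3.trans_lt (by linarith)))

end restriction

section topology

variable {s₁ s₂ s₃ T p : ℝ}

/-- Continuity into the solution space, through a family of states. -/
theorem continuousOn_toZSpace {A : Type*} [TopologicalSpace A] {U : Set A}
    {S : A → ZSpace s₁ s₂ s₃ T}
    {y : A → C(Icc (0 : ℝ) T, State s₁ s₂ p) × Lp (Sob s₃ 2) 3 (timeMeasure T)}
    (hy : ContinuousOn y U)
    (hS : ∀ a ∈ U, (S a).1.1 = (compX.comp (y a).1, compX'.comp (y a).1) ∧
      (S a).2.1.1 = (compY.comp (y a).1, compY'.comp (y a).1) ∧ (S a).2.2 = (y a).2) :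
    ContinuousOn S U := by
  have h1 : ContinuousOn (fun a => (y a).1) U := continuous_fst.comp_continuousOn hy
  have hc : ∀ {B : Type} [TopologicalSpace B] (c : C(State s₁ s₂ p, B)),
      ContinuousOn (fun a => c.comp (y a).1) U := fun c =>
    (ContinuousMap.continuous_postcomp c).comp_continuousOn h1
  refine ContinuousOn.prodMk ?_ (ContinuousOn.prodMk ?_ ?_)
  · refine Topology.IsInducing.subtypeVal.continuousOn_iff.2 ?_
    exact ((hc compX).prodMk (hc compX')).congr fun a ha => (hS a ha).1
  · refine Topology.IsInducing.subtypeVal.continuousOn_iff.2 ?_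
    exact ((hc compY).prodMk (hc compY')).congr fun a ha => (hS a ha).2.1
  · exact (continuous_snd.comp_continuousOn hy).congr fun a ha => (hS a ha).2.2

end topology

end HartreeSdNLW

end

/-! ### Local well-posedness of the Hartree system -/

theorem mainTheorem5 (s₃ : ℝ) (hs₃ : -(1 / 2) < s₃) (hs₃' : s₃ < 0) :
    ∃ θ₀ : ℝ, 0 < θ₀ ∧ ∀ θ : ℝ, 0 < θ → θ ≤ θ₀ →
    ∀ s₁ s₂ β : ℝ, 1 / 4 < s₁ → s₁ < 1 / 2 → 1 / 2 < s₂ → s₂ < 1 → 1 < β →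
      -3 * s₁ + s₂ + 2 < β →
    ∃ ε : ℝ, 0 < ε ∧ ∀ φ : ℝ → ℝ, IsBump φ → ∀ c₀ : ℝ,
    ∀ Ξ₁ : EnhancedData s₁ s₂ s₃ β ε 1,
    ∃ (T : ℝ) (_ : 0 < T) (hT : T ≤ 1)
      (𝒰 : Set (EnhancedData s₁ s₂ s₃ β ε T))
      (S : EnhancedData s₁ s₂ s₃ β ε T → ZSpace s₁ s₂ s₃ T),
      IsOpen 𝒰 ∧ Ξ₁.restrict hT ∈ 𝒰 ∧ ContinuousOn S 𝒰 ∧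
      ∀ Ξ ∈ 𝒰,
        IsSolution φ θ c₀ Ξ (S Ξ) ∧
        (∀ z : ZSpace s₁ s₂ s₃ T, IsSolution φ θ c₀ Ξ z → z = S Ξ) ∧
        (Ξ.IsReal → IsRealSol (S Ξ)) := by
  -- The value 1 is arbitrary: any θ > 0 is admissible, because ε is chosen after θ.
  refine ⟨1, one_pos, fun θ hθ _ s₁ s₂ β h1 h2 h3 h4 h5 h6 => ?_⟩
  obtain ⟨ε, hε⟩ := exists_admissible hs₃ hs₃' hθ h1 h2 h3 h4 h5 h6
  refine ⟨ε, hε.ε_pos, fun φ hφ c₀ Ξ₁ => ?_⟩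
  obtain ⟨p, m, hm⟩ : ∃ (p : ℝ) (m : Model (State s₁ s₂ p) (Forcing s₁ s₂ p) (Noise β ε)
    (Sob s₃ 2) (Sob 0 2)), IsHartree φ c₀ θ m := ⟨_, exists_model hφ c₀ hε⟩
  -- M bounds strictly the norms of all restrictions of Ξ₁, whatever the interval. It can thus be
  -- fixed before T, and the open condition of norm below M defines the neighbourhood.
  set M := 6 * ‖((Ξ₁.X₀, Ξ₁.X₁), (Ξ₁.Y₀, Ξ₁.Y₁))‖ + ‖noise Ξ₁‖ + ‖Ξ₁.J‖ + 1 with hMdef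
  have hM : 0 ≤ M := by positivity
  obtain ⟨T, hT0, hT1, L, hsol⟩ := m.exists_solution hM
  obtain ⟨sol, hfix, hlip, hmem⟩ := hsol hT0.le le_rfl
  have hcont : Continuous (modelData p : EnhancedData s₁ s₂ s₃ β ε T → _) := continuous_modelData
  have hy : ContinuousOn (fun Ξ : EnhancedData s₁ s₂ s₃ β ε T => sol (modelData p Ξ))
      {Ξ | ‖modelData p Ξ‖ < M} := by
    intro Ξ hΞ
    have hlim : Tendsto (fun Ξ' => L * ‖modelData p Ξ' - modelData p Ξ‖)
        (𝓝[{Ξ | ‖modelData p Ξ‖ < M}] Ξ) (𝓝 0) := by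
      have h : Continuous fun Ξ' => L * ‖modelData p Ξ' - modelData p Ξ‖ :=
        continuous_const.mul (hcont.sub continuous_const).norm
      have h' := h.tendsto Ξ
      rw [sub_self, norm_zero, mul_zero] at h'
      exact h'.mono_left nhdsWithin_le_nhds
    refine tendsto_iff_norm_sub_tendsto_zero.2 (squeeze_zero' ?_ ?_ hlim)
    · exact Eventually.of_forall fun _ => norm_nonneg _
    · filter_upwards [self_mem_nhdsWithin] with Ξ' hΞ'
      exact hlip _ (causal_modelData _) hΞ'.le _ (causal_modelData _) hΞ.le
  have hstep : ∀ Ξ : EnhancedData s₁ s₂ s₃ β ε T, ‖modelData p Ξ‖ < M →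
      m.step hT0.le (modelData p Ξ) (sol (modelData p Ξ)) = sol (modelData p Ξ) := fun Ξ hΞ =>
    hfix _ (causal_modelData _) hΞ.le
  have hcomp : ∀ Ξ : EnhancedData s₁ s₂ s₃ β ε T, ‖modelData p Ξ‖ < M →
      (hm.toZ hT0.le Ξ (sol (modelData p Ξ))).1.1 =
        (compX.comp (sol (modelData p Ξ)).1, compX'.comp (sol (modelData p Ξ)).1) ∧
      (hm.toZ hT0.le Ξ (sol (modelData p Ξ))).2.1.1 =
        (compY.comp (sol (modelData p Ξ)).1, compY'.comp (sol (modelData p Ξ)).1) ∧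
      (hm.toZ hT0.le Ξ (sol (modelData p Ξ))).2.2 = (sol (modelData p Ξ)).2 := by
    intro Ξ hΞ
    have h := congrArg Prod.fst (hstep Ξ hΞ)
    exact ⟨congrArg (fun x => (compX.comp x, compX'.comp x)) h,
      congrArg (fun x => (compY.comp x, compY'.comp x)) h, rfl⟩
  refine ⟨T, hT0, hT1, {Ξ | ‖modelData p Ξ‖ < M},
    fun Ξ => hm.toZ hT0.le Ξ (sol (modelData p Ξ)), isOpen_lt hcont.norm continuous_const,
    norm_modelData_restrict_lt Ξ₁ hT1, continuousOn_toZSpace hy hcomp, fun Ξ hΞ =>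
    ⟨hm.isSolution_toZ hT0.le hT0 (hstep Ξ hΞ), fun z hz => ?_, fun hreal => ?_⟩⟩
  -- Uniqueness holds in the whole space: no bound on z is assumed, since `Model.step_unique` needs
  -- none.
  · obtain ⟨y, hy, rfl⟩ := hm.exists_step_eq hT0.le hT0 hz
    rw [m.step_unique hT0.le hT1 (causal_modelData Ξ) hy (hstep Ξ hΞ)]
  -- The real-valued states form a closed set which contains 0 and is preserved by the step, so the
  -- limit of the iterates belongs to it.
  · obtain ⟨h1, h2⟩ := hmem _ (causal_modelData Ξ) (le_of_lt hΞ)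
      (Model.valuedIn T (realState s₁ s₂ p) (realSob s₃))
      (Model.isClosed_valuedIn (isRealSet_realState s₁ s₂ p).isClosed
        (isRealSet_realSob s₃).isClosed)
      (Model.zero_mem_valuedIn (isRealSet_realState s₁ s₂ p) (isRealSet_realSob s₃))
      fun z hz => hm.step_mem_valuedIn hT0.le hreal hz
    obtain ⟨c1, c2, c3⟩ := hcomp Ξ hΞ
    refine ⟨fun t => ?_, fun t => ?_, ?_⟩
    · rw [c1]
      exact (h1 t).1.1
    · rw [c2]
      exact (h1 t).2.1.1
    · rw [c3]
      exact h2
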